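/- Let $G$ be a finite group. An \emph{indexing system} $\mathcal O$ assigns to each subgroup $H\le G$ a class $\mathcal O(H)$, closed under isomorphism, of finite $H$-sets (the admissible ones), such that the classes are compatible with restriction and conjugation, contain all trivial sets, and are closed under disjoint unions, finite limits and self-induction (if $H/K\in\mathcal O(H)$ and $T\in\mathcal O(K)$ then $H\times_K T\in\mathcal O(H)$). Let $\mathrm{Set}^G_{\mathcal O}$ be the category of finite $G$-sets and those equivariant maps $f\colon S\to T$ with $G_{f(s)}/G_s\in\mathcal O(G_{f(s)})$ for all $s\in S$, where $G_x$ denotes the stabilizer of $x$, and let $\mathrm{Orb}_{\mathcal O}$ be its full subcategory on the orbits $G/H$. Let $\mathcal P^G_{\mathcal O}$ be the category whose objects are the finite $G$-sets and whose morphisms $X\to Y$ are the isomorphism classes of bispans $X\xleftarrow{h}A\xrightarrow{g}B\xrightarrow{f}Y$ with $g\in\mathrm{Set}^G_{\mathcal O}$; such a morphism is $T_f\circ N_g\circ R_h$. Composition is that of polynomials (by pullbacks and dependent products). An \emph{$\mathcal O$-Tambara functor} is a product preserving functor $\mathcal P^G_{\mathcal O}\to\mathrm{Set}$ whose values, with the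 addition $F(X)\times F(X)\cong F(X\amalg X)\to F(X)$ given by the transfer along the fold map, are groups; morphisms are natural transformations. A \emph{commutative Green functor} is a Mackey functor $R$ on finite $G$-sets whose values are commutative rings, whose restrictions $R_f$ are ring homomorphisms, and whose transfers satisfy $a\cdot T_f(b)=T_f(R_f(a)\cdot b)$. A commutative Green functor \emph{with norms for $\mathcal O$} is a commutative Green functor $R$ together with a map of multiplicative monoids $N_f\colon R(G/H)\to R(G/K)$ for each $f\colon G/H\to G/K$ in $\mathrm{Orb}_{\mathcal O}$. Extend these to maps $N_g\colon R(A)\to R(B)$ for all $g\colon A\to B$ in $\mathrm{Set}^G_{\mathcal O}$ by $$N_g(x)|_{G/G_b}=\prod_{a}N_{G/G_a\to G/G_b}\bigl(x|_{G/G_a}\bigr)\qquad(b\in B),$$ where $a$ runs over representatives of the $G_b$-orbits of $g^{-1}(b)$. The following is required. \begin{enumerate} \item $N_{\mathrm{id}}=\mathrm{id}$ and $N_{f\circ f'}=N_f\circ N_{f'}$ in $\mathrm{Orb}_{\mathcal O}$. \item (Double coset formula) For $f\colon G/H\to G/K$ in $\mathrm{Orb}_{\mathcal O}$ and any $k\colon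 G/L\to G/K$, one has $R_k\circ N_f=N_{f'}\circ R_{k'}$, where $f'$ and $k'$ are the projections of $G/L\times_{G/K}G/H$ to $G/L$ and $G/H$. \item (Tambara reciprocity) For $f\colon G/H\to G/K$ in $\mathrm{Orb}_{\mathcal O}$ and a map $p\colon E\to G/H$ of finite $G$-sets, let $\prod_f E\to G/K$ be the dependent product, whose fibre over $y$ is the set of sections of $p$ over $f^{-1}(y)$. Let $t\colon\prod_fE\to G/K$ and $g\colon G/H\times_{G/K}\prod_fE\to\prod_fE$ be the projections and $e\colon G/H\times_{G/K}\prod_fE\to E$ the evaluation. Then \begin{itemize} \item for $p$ the fold map $G/H\amalg G/H\to G/H$, so that, when $f$ is the quotient map for $H\le K$, $\prod_fE\cong G\times_K\mathrm{Map}(K/H,*\amalg*)$: $\;N_f(a+b)=T_t\,N_g\,R_e(a\oplus b)$ for all $a,b\in R(G/H)$; \item for every map of orbits $p\colon E=G/L\to G/H$: $\;N_f(T_p(a))=T_t\,N_g\,R_e(a)$ for all $a\in R(G/L)$. \end{itemize} \end{enumerate} Morphisms of commutative Green functors with norms for $\mathcal O$ are the families of ring homomorphisms that commute with restrictions, transfers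 and norms. \textbf{Theorem.} For every indexing system $\mathcal O$, the category of $\mathcal O$-Tambara functors is equivalent to the category of commutative Green functors with norms for $\mathcal O$. The equivalence is compatible with the underlying structure: it takes $F$ to a Green functor $R$ with natural bijections $R(X)\cong F(X)$ under which the restrictions, transfers and norms of $R$ are $F(R_f)$, $F(T_f)$ and $F(N_f)$, and the addition, multiplication, $0$ and $1$ are given by the transfers and norms of $F$ along the fold maps $X\amalg X\to X$ and the maps $\emptyset\to X$. -/

import Mathlib

open CategoryTheory

universe u w

/-! ## Finite `Γ`-sets -/

/-- A finite set with an action of the group `Γ`. Morphisms of finite `Γ`-sets are the equivariant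
maps `X →[Γ] Y` of Mathlib. -/
structure FinGSet (Γ : Type u) [Group Γ] where
  carrier : Type u
  [action : MulAction Γ carrier]
  [finite : Finite carrier]

namespace FinGSet

instance {Γ : Type u} [Group Γ] : CoeSort (FinGSet Γ) (Type u) := ⟨FinGSet.carrier⟩

attribute [instance] FinGSet.action FinGSet.finite

section

variable {Γ : Type u} [Group Γ]

/-- The orbit `Γ/H`. -/
abbrev orbit [Finite Γ] (H : Subgroup Γ) : FinGSet Γ := ⟨Γ ⧸ H⟩

/-- A finite set with trivial action. -/
def triv (S : Type u) [Finite S] : FinGSet Γ :=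
  @FinGSet.mk Γ _ S { smul := fun _ x => x, one_smul := fun _ => rfl, mul_smul := fun _ _ _ => rfl } _

/-- The empty `Γ`-set. -/
def empty : FinGSet Γ := triv PEmpty

/-- The disjoint union. -/
abbrev sum (X Y : FinGSet Γ) : FinGSet Γ := ⟨X ⊕ Y⟩

/-- The product, with diagonal action. -/
abbrev prod (X Y : FinGSet Γ) : FinGSet Γ := ⟨X × Y⟩

/-- The equalizer of two equivariant maps. -/
def equalizer {X Y : FinGSet Γ} (f g : X →[Γ] Y) : FinGSet Γ :=
  @FinGSet.mk Γ _ {x : X // f x = g x}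
    { smul := fun a x => ⟨a • x.1, by rw [map_smul, map_smul, x.2]⟩
      one_smul := fun x => Subtype.ext (one_smul Γ x.1)
      mul_smul := fun a b x => Subtype.ext (mul_smul a b x.1) } _

/-- The fibre product `X ×_Z Y`. -/
def pullback {X Y Z : FinGSet Γ} (f : X →[Γ] Z) (g : Y →[Γ] Z) : FinGSet Γ :=
  @FinGSet.mk Γ _ {p : X × Y // f p.1 = g p.2}
    { smul := fun a p => ⟨(a • p.1.1, a • p.1.2), by simp only [map_smul, p.2]⟩
      one_smul := fun p => Subtype.ext (one_smul Γ p.1)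
      mul_smul := fun a b p => Subtype.ext (mul_smul a b p.1) } _

/-- The first projection `X ×_Z Y → X`. -/
def pullback.fst {X Y Z : FinGSet Γ} (f : X →[Γ] Z) (g : Y →[Γ] Z) : pullback f g →[Γ] X where
  toFun p := p.1.1
  map_smul' _ _ := rfl

/-- The second projection `X ×_Z Y → Y`. -/
def pullback.snd {X Y Z : FinGSet Γ} (f : X →[Γ] Z) (g : Y →[Γ] Z) : pullback f g →[Γ] Y where
  toFun p := p.1.2
  map_smul' _ _ := rfl

/-- The commutative square with `f ∘ k = g ∘ h` is a pullback square. -/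
def IsPullbackSquare {P X Y Z : FinGSet Γ} (k : P →[Γ] X) (h : P →[Γ] Y) (f : X →[Γ] Z)
    (g : Y →[Γ] Z) : Prop :=
  (∀ p, f (k p) = g (h p)) ∧ ∀ x y, f x = g y → ∃! p, k p = x ∧ h p = y

/-- The inclusion of the first summand. -/
def inl (X Y : FinGSet Γ) : X →[Γ] X.sum Y where
  toFun := Sum.inl
  map_smul' _ _ := rfl

/-- The inclusion of the second summand. -/
def inr (X Y : FinGSet Γ) : Y →[Γ] X.sum Y where
  toFun := Sum.inr
  map_smul' _ _ := rfl

/-- The fold map `∇ : X ⊔ X → X`. -/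
def fold (X : FinGSet Γ) : X.sum X →[Γ] X where
  toFun := Sum.elim id id
  map_smul' := by rintro a (x | x) <;> rfl

/-- The unique map `∅ → X`. -/
def fromEmpty (X : FinGSet Γ) : (empty : FinGSet Γ) →[Γ] X where
  toFun x := PEmpty.elim x
  map_smul' _ x := PEmpty.elim x

/-- A `Γ`-set viewed as a `Γ'`-set along a homomorphism `Γ' → Γ`. -/
def comap {Γ' : Type u} [Group Γ'] (φ : Γ' →* Γ) (X : FinGSet Γ) : FinGSet Γ' :=
  @FinGSet.mk Γ' _ X (MulAction.compHom X φ) _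

/-! ### Dependent products -/

/-- A point of the dependent product `∏_n E` of `p : E → C` along `n : C → D`: a point `d` of `D`
with a section of `p` over the fibre `n⁻¹(d)`. -/
structure PiPt {C D E : FinGSet Γ} (n : C →[Γ] D) (p : E →[Γ] C) where
  base : D
  sec : ∀ c, n c = base → E
  p_sec : ∀ c h, p (sec c h) = c

namespace PiPt

variable {C D E : FinGSet Γ} {n : C →[Γ] D} {p : E →[Γ] C}

theorem ext' {x y : PiPt n p} (h : x.base = y.base)
    (h' : ∀ c hx hy, x.sec c hx = y.sec c hy) : x = y := by
  obtain ⟨d, σ, hσ⟩ := x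
  obtain ⟨d', σ', hσ'⟩ := y
  obtain rfl : d = d' := h
  obtain rfl : σ = σ' := by
    funext c hc
    exact h' c hc hc
  rfl

theorem sec_congr {x y : PiPt n p} (h : x = y) {c c' : C} (hc : c = c') (hx : n c = x.base)
    (hy : n c' = y.base) : x.sec c hx = y.sec c' hy := by
  subst h hc
  rfl

/-- The action by conjugation: `(a • σ)(c) = a • σ(a⁻¹ • c)`. -/
instance : MulAction Γ (PiPt n p) where
  smul a x :=
    { base := a • x.base
      sec := fun c h => a • x.sec (a⁻¹ • c) (by rw [map_smul, h, inv_smul_smul])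
      p_sec := fun c h => by rw [map_smul, x.p_sec, smul_inv_smul] }
  one_smul x := by
    refine ext' (one_smul Γ x.base) fun c hx hy => ?_
    change (1 : Γ) • x.sec _ _ = _
    rw [one_smul]
    exact sec_congr rfl (by simp) _ _
  mul_smul a b x := by
    refine ext' (mul_smul a b x.base) fun c hx hy => ?_
    change (a * b) • x.sec _ _ = a • b • x.sec _ _
    rw [mul_smul]
    congr 2
    exact sec_congr rfl (by simp [mul_smul]) _ _

theorem smul_base (a : Γ) (x : PiPt n p) : (a • x).base = a • x.base := rfl

theorem smul_sec (a : Γ) (x : PiPt n p) (c : C) (h : n c = x.base)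
    (h' : n (a • c) = (a • x).base) : (a • x).sec (a • c) h' = a • x.sec c h := by
  change a • x.sec _ _ = _
  congr 1
  exact sec_congr rfl (by simp) _ _

instance : Finite (PiPt n p) := by
  classical
  refine Finite.of_injective
    (β := D × (C → Option E))
    (fun x => (x.base, fun c => if h : n c = x.base then some (x.sec c h) else none)) ?_
  intro x y hxy
  simp only [Prod.mk.injEq] at hxy
  refine ext' hxy.1 fun c hx hy => ?_
  have := congrFun hxy.2 c
  rw [dif_pos hx, dif_pos hy] at this
  exact Option.some.inj this

end PiPt

/-- The dependent product `∏_n E` of `p : E → C` along `n : C → D`. -/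
abbrev depProd {C D E : FinGSet Γ} (n : C →[Γ] D) (p : E →[Γ] C) : FinGSet Γ := ⟨PiPt n p⟩

/-- The structure map `∏_n E → D`. -/
def depProd.base {C D E : FinGSet Γ} (n : C →[Γ] D) (p : E →[Γ] C) : depProd n p →[Γ] D where
  toFun := PiPt.base
  map_smul' _ _ := rfl

/-- The evaluation map `C ×_D ∏_n E → E`. -/
def depProd.eval {C D E : FinGSet Γ} (n : C →[Γ] D) (p : E →[Γ] C) :
    pullback n (depProd.base n p) →[Γ] E where
  toFun x := x.1.2.sec x.1.1 x.2
  map_smul' a x := PiPt.smul_sec a x.1.2 x.1.1 x.2 _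

end

section

variable {G : Type u} [Group G]

/-- The setoid on `H × T` with `(h k, t) ∼ (h, k t)` for `k` in `K`. -/
def indSetoid {K H : Subgroup G} (hKH : K ≤ H) (T : FinGSet K) : Setoid (H × T) where
  r x y := ∃ k : K, y.1 = x.1 * (Subgroup.inclusion hKH k)⁻¹ ∧ y.2 = k • x.2
  iseqv :=
    { refl := fun x => ⟨1, by simp⟩
      symm := by
        rintro x y ⟨k, h1, h2⟩
        exact ⟨k⁻¹, by simp [h1], by simp [h2]⟩
      trans := by
        rintro x y z ⟨k, h1, h2⟩ ⟨l, h3, h4⟩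
        exact ⟨l * k, by simp [h1, h3, mul_assoc], by simp [h2, h4, mul_smul]⟩ }

/-- The induced `H`-set `H ×_K T`. -/
def ind [Finite G] {K H : Subgroup G} (hKH : K ≤ H) (T : FinGSet K) : FinGSet H :=
  @FinGSet.mk H _ (Quotient (indSetoid hKH T))
    { smul := fun a => Quotient.map (fun x => (a * x.1, x.2)) (by
        rintro x y ⟨k, h1, h2⟩
        exact ⟨k, by simp [h1, mul_assoc], h2⟩)
      one_smul := by
        rintro ⟨x⟩
        exact congrArg (Quotient.mk _) (Prod.ext (one_mul x.1) rfl)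
      mul_smul := by
        rintro a b ⟨x⟩
        exact congrArg (Quotient.mk _) (Prod.ext (mul_assoc a b x.1) rfl) } _

/-- For `g⁻¹ K g ≤ H`, the homomorphism `K → H`, `k ↦ g⁻¹ k g`. -/
def conjHom (H K : Subgroup G) (g : G) (h : ∀ k ∈ K, g⁻¹ * k * g ∈ H) : K →* H where
  toFun k := ⟨g⁻¹ * k * g, h k k.2⟩
  map_one' := Subtype.ext (by simp)
  map_mul' a b := Subtype.ext (by simp [mul_assoc])

end

end FinGSet

open FinGSet

/-! ## Indexing systems -/

/-- An indexing system: a full (replete) symmetric monoidal sub-coefficient system of the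
coefficient system `G/H ↦ (finite H-sets, ⊔)` that contains all trivial sets and is closed under
finite limits and self-induction. `Adm H T` says that `T` is an admissible `H`-set. -/
structure IndexingSystem (G : Type u) [Group G] [Finite G] where
  Adm : ∀ H : Subgroup G, FinGSet H → Prop
  iso : ∀ {H : Subgroup G} {X Y : FinGSet H} (f : X →[H] Y), Function.Bijective f →
    Adm H X → Adm H Y
  sum : ∀ {H : Subgroup G} {X Y : FinGSet H}, Adm H X → Adm H Y → Adm H (X.sum Y)
  /-- Functoriality along the map `G/K → G/H`, `eK ↦ gH`, of the orbit category. -/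
  restrict : ∀ {H K : Subgroup G} (g : G) (h : ∀ k ∈ K, g⁻¹ * k * g ∈ H) {X : FinGSet H},
    Adm H X → Adm K (X.comap (conjHom H K g h))
  trivial : ∀ {H : Subgroup G} {X : FinGSet H}, (∀ (h : H) (x : X), h • x = x) → Adm H X
  prod : ∀ {H : Subgroup G} {X Y : FinGSet H}, Adm H X → Adm H Y → Adm H (X.prod Y)
  equalizer : ∀ {H : Subgroup G} {X Y : FinGSet H} (f g : X →[H] Y), Adm H X → Adm H Y →
    Adm H (FinGSet.equalizer f g)
  selfInd : ∀ {K H : Subgroup G} (hKH : K ≤ H) {T : FinGSet K},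
    Adm H (orbit (K.subgroupOf H)) → Adm K T → Adm H (ind hKH T)

namespace IndexingSystem

variable {G : Type u} [Group G] [Finite G] (O : IndexingSystem G)

/-- The equivariant map `f : S → T` lies in `Set_O^G`: for all `s`, the `G_{f(s)}`-set
`G_{f(s)} / G_s` is admissible. -/
def Mem {S T : FinGSet G} (f : S →[G] T) : Prop :=
  ∀ s : S, O.Adm (MulAction.stabilizer G (f s))
    (orbit ((MulAction.stabilizer G s).subgroupOf (MulAction.stabilizer G (f s))))

variable {O}

theorem adm_of_injective {H : Subgroup G} {X Y : FinGSet H} (f : Y →[H] X)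
    (hf : Function.Injective f) (hX : O.Adm H X) : O.Adm H Y := by
  classical
  let two : FinGSet H := triv (ULift.{u} Bool)
  have hr : ∀ (h : H) (x : X), h • x ∈ Set.range f ↔ x ∈ Set.range f := by
    intro h x
    constructor
    · rintro ⟨y, hy⟩
      exact ⟨h⁻¹ • y, by rw [map_smul, hy, inv_smul_smul]⟩
    · rintro ⟨y, rfl⟩
      exact ⟨h • y, map_smul f h y⟩
  let φ : X →[H] two :=
    { toFun := fun x => ULift.up (decide (x ∈ Set.range f))
      map_smul' := fun h x => by
        change ULift.up _ = ULift.up _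
        simp only [hr] }
  let ψ : X →[H] two := { toFun := fun _ => ULift.up true, map_smul' := fun _ _ => rfl }
  have hE : O.Adm H (FinGSet.equalizer φ ψ) := O.equalizer φ ψ hX (O.trivial fun _ _ => rfl)
  have key : ∀ x : X, φ x = ψ x ↔ x ∈ Set.range f := by
    intro x
    change ULift.up (decide _) = ULift.up true ↔ _
    simp
  let F : FinGSet.equalizer φ ψ →[H] Y :=
    { toFun := fun x => ((key x.1).1 x.2).choose
      map_smul' := fun h x => by
        apply hf
        rw [((key (h • x).1).1 (h • x).2).choose_spec]
        simp only [id, map_smul]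
        rw [((key x.1).1 x.2).choose_spec]
        rfl }
  have hF : ∀ x, f (F x) = x.1 := fun x => ((key x.1).1 x.2).choose_spec
  refine O.iso F ⟨fun x y h => Subtype.ext ?_, fun y => ⟨⟨f y, (key _).2 ⟨y, rfl⟩⟩, hf (hF _)⟩⟩ hE
  rw [← hF x, ← hF y, h]

theorem adm_quotient_of_eq {H K : Subgroup G} (h : ∀ g ∈ H, g ∈ K) :
    O.Adm H (orbit (K.subgroupOf H)) := by
  refine O.trivial fun a x => ?_
  have : K.subgroupOf H = ⊤ := by
    rw [Subgroup.subgroupOf_eq_top]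
    exact h
  have hs : Subsingleton (H ⧸ K.subgroupOf H) := by
    rw [this]
    exact QuotientGroup.subsingleton_quotient_top
  exact Subsingleton.elim _ _

/-- An injective map lies in `Set_O^G`. -/
theorem mem_of_injective {S T : FinGSet G} (f : S →[G] T) (hf : Function.Injective f) :
    O.Mem f := by
  intro s
  refine adm_quotient_of_eq fun g hg => ?_
  rw [MulAction.mem_stabilizer_iff] at hg ⊢
  exact hf (by rw [map_smul, hg])

/-- `H/L` is admissible for `L ≤ K ≤ H` if `H/K` and `K/L` are. -/
theorem adm_trans {L K H : Subgroup G} (hLK : L ≤ K) (hKH : K ≤ H)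
    (h1 : O.Adm H (orbit (K.subgroupOf H))) (h2 : O.Adm K (orbit (L.subgroupOf K))) :
    O.Adm H (orbit (L.subgroupOf H)) := by
  let T : FinGSet K := orbit (L.subgroupOf K)
  let e : T := QuotientGroup.mk (1 : K)
  let F : orbit (L.subgroupOf H) →[H] ind hKH T :=
    { toFun := Quotient.lift
        (fun a : H => Quotient.mk (indSetoid hKH T) (a, e))
        (by
          intro a b hab
          have hab : a⁻¹ * b ∈ L.subgroupOf H := QuotientGroup.leftRel_apply.1 hab
          rw [Subgroup.mem_subgroupOf] at hab
          refine Quotient.sound ⟨⟨_, hLK (L.inv_mem hab)⟩, ?_, ?_⟩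
          · apply Subtype.ext
            simp
          · refine QuotientGroup.eq.2 ?_
            rw [Subgroup.mem_subgroupOf]
            simpa using L.inv_mem hab)
      map_smul' := by
        rintro h ⟨a⟩
        rfl }
  refine adm_of_injective F ?_ (O.selfInd hKH h1 h2)
  rintro ⟨a⟩ ⟨b⟩ hab
  obtain ⟨k, hk1, hk2⟩ := Quotient.exact hab
  have hk2 : (QuotientGroup.mk (1 : K) : K ⧸ L.subgroupOf K) = QuotientGroup.mk (k * 1) := hk2
  have hk3 := QuotientGroup.eq.1 hk2
  rw [Subgroup.mem_subgroupOf] at hk3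
  have hk4 : ((k : K) : G) ∈ L := by simpa using hk3
  refine Quotient.sound (QuotientGroup.leftRel_apply.2 ?_)
  rw [Subgroup.mem_subgroupOf]
  have hk1 : b = a * (Subgroup.inclusion hKH k)⁻¹ := hk1
  rw [hk1]
  simpa using hk4

theorem stabilizer_le {S T : FinGSet G} (f : S →[G] T) (s : S) :
    MulAction.stabilizer G s ≤ MulAction.stabilizer G (f s) := by
  intro g hg
  rw [MulAction.mem_stabilizer_iff] at hg ⊢
  rw [← map_smul, hg]

/-- `Set_O^G` is closed under composition. -/
theorem mem_comp {S T U : FinGSet G} {f : T →[G] U} {g : S →[G] T} (hf : O.Mem f)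
    (hg : O.Mem g) : O.Mem (f.comp g) := fun s =>
  adm_trans (stabilizer_le g s) (stabilizer_le f (g s)) (hf (g s)) (hg s)

/-- `Set_O^G` is stable under pullback (and under restriction to a subobject of the source). -/
theorem mem_of_square {U V S T : FinGSet G} {f : S →[G] T} (hf : O.Mem f) (g : V →[G] T)
    (k : U →[G] V) (h : U →[G] S) (hc : ∀ u, f (h u) = g (k u))
    (hi : ∀ u u', k u = k u' → h u = h u' → u = u') : O.Mem k := by
  intro u
  have hle : MulAction.stabilizer G (k u) ≤ MulAction.stabilizer G (f (h u)) := by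
    rw [hc]
    exact stabilizer_le g (k u)
  have hle' : ∀ a ∈ MulAction.stabilizer G (k u),
      1⁻¹ * a * 1 ∈ MulAction.stabilizer G (f (h u)) := by
    intro a ha
    simpa using hle ha
  have h1 := O.restrict 1 hle' (hf (h u))
  have key : ∀ a : G, a ∈ MulAction.stabilizer G (k u) →
      (a ∈ MulAction.stabilizer G u ↔ a ∈ MulAction.stabilizer G (h u)) := by
    intro a ha
    refine ⟨fun hu => stabilizer_le h u hu, fun hh => ?_⟩
    rw [MulAction.mem_stabilizer_iff] at ha hh ⊢
    exact hi _ _ (by rw [map_smul, ha]) (by rw [map_smul, hh])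
  let X : FinGSet (MulAction.stabilizer G (f (h u))) :=
    orbit ((MulAction.stabilizer G (h u)).subgroupOf (MulAction.stabilizer G (f (h u))))
  let F : orbit ((MulAction.stabilizer G u).subgroupOf (MulAction.stabilizer G (k u)))
      →[MulAction.stabilizer G (k u)]
      X.comap (conjHom _ (MulAction.stabilizer G (k u)) 1 hle') :=
    { toFun := Quotient.lift (fun a => (QuotientGroup.mk (Subgroup.inclusion hle a) : X)) (by
        intro a b hab
        have hab := QuotientGroup.leftRel_apply.1 hab
        rw [Subgroup.mem_subgroupOf, key _ (a⁻¹ * b).2] at hab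
        refine QuotientGroup.eq.2 ?_
        rw [Subgroup.mem_subgroupOf]
        exact hab)
      map_smul' := by
        rintro a ⟨b⟩
        change QuotientGroup.mk _ = QuotientGroup.mk _
        congr 1
        apply Subtype.ext
        change (a : G) * b = (1⁻¹ * a * 1) * b
        simp }
  refine adm_of_injective F ?_ h1
  rintro ⟨a⟩ ⟨b⟩ hab
  have hab := QuotientGroup.eq.1 hab
  rw [Subgroup.mem_subgroupOf] at hab
  refine Quotient.sound (QuotientGroup.leftRel_apply.2 ?_)
  rw [Subgroup.mem_subgroupOf, key _ (a⁻¹ * b).2]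
  exact hab

end IndexingSystem

/-! ## Polynomials with exponents in `Set_O^G` -/

/-- A bispan `X ← A → B → Y` of finite `G`-sets with `A → B` in `Set_O^G`. -/
structure Bispan {G : Type u} [Group G] [Finite G] (O : IndexingSystem G) (X Y : FinGSet G) where
  A : FinGSet G
  B : FinGSet G
  r : A →[G] X
  n : A →[G] B
  t : B →[G] Y
  mem : O.Mem n

namespace Bispan

variable {G : Type u} [Group G] [Finite G] {O : IndexingSystem G}

/-- Isomorphism of bispans, relative to `X` and `Y`. -/
def Iso {X Y : FinGSet G} (P Q : Bispan O X Y) : Prop :=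
  ∃ (α : P.A →[G] Q.A) (β : P.B →[G] Q.B), Function.Bijective α ∧ Function.Bijective β ∧
    (∀ a, Q.r (α a) = P.r a) ∧ (∀ a, Q.n (α a) = β (P.n a)) ∧ ∀ b, Q.t (β b) = P.t b

/-- The identity bispan. -/
def identity (X : FinGSet G) : Bispan O X X where
  A := X
  B := X
  r := MulActionHom.id G
  n := MulActionHom.id G
  t := MulActionHom.id G
  mem := IndexingSystem.mem_of_injective _ fun _ _ h => h

/-- The composite of `X ← A → B → Y` and `Y ← C → D → Z`, built from the diagram
`B ← B ×_Y C ← C ×_D ∏ → ∏ → D`, where `∏` is the dependent product of `B ×_Y C → C` along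
`C → D`: it is `X ← A ×_B (C ×_D ∏) → ∏ → Z`. -/
def comp {X Y Z : FinGSet G} (P : Bispan O X Y) (Q : Bispan O Y Z) : Bispan O X Z :=
  let p := pullback.snd P.t Q.r
  let ev : pullback Q.n (depProd.base Q.n p) →[G] P.B :=
    (pullback.fst P.t Q.r).comp (depProd.eval Q.n p)
  { A := pullback P.n ev
    B := depProd Q.n p
    r := P.r.comp (pullback.fst P.n ev)
    n := (pullback.snd Q.n (depProd.base Q.n p)).comp (pullback.snd P.n ev)
    t := Q.t.comp (depProd.base Q.n p)
    mem := IndexingSystem.mem_comp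
      (IndexingSystem.mem_of_square Q.mem (depProd.base Q.n p) _ (pullback.fst _ _)
        (fun u => u.2) fun _ _ h h' => Subtype.ext (Prod.ext h' h))
      (IndexingSystem.mem_of_square P.mem ev _ (pullback.fst _ _)
        (fun u => u.2) fun _ _ h h' => Subtype.ext (Prod.ext h' h)) }

theorem iso_refl {X Y : FinGSet G} (P : Bispan O X Y) : P.Iso P :=
  ⟨MulActionHom.id G, MulActionHom.id G, Function.bijective_id, Function.bijective_id,
    fun _ => rfl, fun _ => rfl, fun _ => rfl⟩

theorem exists_inv {S T : FinGSet G} (f : S →[G] T) (hf : Function.Bijective f) :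
    ∃ g : T →[G] S, Function.Bijective g ∧ (∀ s, g (f s) = s) ∧ ∀ t, f (g t) = t := by
  let e := Equiv.ofBijective f hf
  refine ⟨⟨e.symm, fun a t => hf.1 ?_⟩, e.symm.bijective, e.symm_apply_apply, e.apply_symm_apply⟩
  exact (e.apply_symm_apply _).trans ((congrArg (a • ·) (e.apply_symm_apply t).symm).trans
    (map_smul f a _).symm)

theorem iso_symm {X Y : FinGSet G} {P Q : Bispan O X Y} (h : P.Iso Q) : Q.Iso P := by
  obtain ⟨α, β, hα, hβ, h1, h2, h3⟩ := h
  obtain ⟨α', hα', ha, ha'⟩ := exists_inv α hα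
  obtain ⟨β', hβ', hb, hb'⟩ := exists_inv β hβ
  refine ⟨α', β', hα', hβ', fun a => ?_, fun a => ?_, fun b => ?_⟩
  · rw [← h1, ha']
  · rw [← hb (P.n _), ← h2, ha']
  · rw [← h3, hb']

theorem iso_trans {X Y : FinGSet G} {P Q R : Bispan O X Y} (h : P.Iso Q) (h' : Q.Iso R) :
    P.Iso R := by
  obtain ⟨α, β, hα, hβ, h1, h2, h3⟩ := h
  obtain ⟨α', β', hα', hβ', h1', h2', h3'⟩ := h'
  exact ⟨α'.comp α, β'.comp β, hα'.comp hα, hβ'.comp hβ, fun a => (h1' _).trans (h1 a),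
    fun a => (h2' _).trans (congrArg β' (h2 a)), fun b => (h3' _).trans (h3 b)⟩

/-- An elementwise description of the diagrams that exhibit `R` as a composite of `P` and `Q`. -/
structure CompData {X Y Z : FinGSet G} (P : Bispan O X Y) (Q : Bispan O Y Z)
    (R : Bispan O X Z) where
  β : R.B →[G] Q.B
  ε : ∀ (b : R.B) (c : Q.A), Q.n c = β b → P.B
  ε_smul : ∀ (g : G) b c h h', ε (g • b) (g • c) h' = g • ε b c h
  t_β : ∀ b, Q.t (β b) = R.t b
  t_ε : ∀ b c h, P.t (ε b c h) = Q.r c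
  unique_b : ∀ (d : Q.B) (σ : ∀ c, Q.n c = d → P.B), (∀ c h, P.t (σ c h) = Q.r c) →
    ∃! b, β b = d ∧ ∀ c h h', ε b c h = σ c h'
  α : R.A →[G] P.A
  κ : R.A →[G] Q.A
  n_κ : ∀ x, Q.n (κ x) = β (R.n x)
  n_α : ∀ x, P.n (α x) = ε (R.n x) (κ x) (n_κ x)
  r_α : ∀ x, P.r (α x) = R.r x
  unique_a : ∀ b c h a, P.n a = ε b c h → ∃! x, R.n x = b ∧ κ x = c ∧ α x = a

/-- The canonical composite is a composite. -/
def compData {X Y Z : FinGSet G} (P : Bispan O X Y) (Q : Bispan O Y Z) :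
    CompData P Q (P.comp Q) where
  β := depProd.base _ _
  ε b c h := (PiPt.sec b c h).1.1
  ε_smul g b c h h' := congrArg (fun x => x.1.1) (PiPt.smul_sec g b c h h')
  t_β _ := rfl
  t_ε b c h := by
    rw [(PiPt.sec b c h).2]
    exact congrArg Q.r (PiPt.p_sec b c h)
  unique_b d σ hσ := by
    refine ⟨⟨d, fun c h => ⟨(σ c h, c), hσ c h⟩, fun _ _ => rfl⟩, ⟨rfl, fun _ _ _ => rfl⟩, ?_⟩
    rintro b ⟨hb, hb'⟩
    exact PiPt.ext' hb fun c hx hy =>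
      Subtype.ext (Prod.ext (hb' c hx hy) (PiPt.p_sec b c hx))
  α := pullback.fst _ _
  κ := (pullback.fst _ _).comp (pullback.snd _ _)
  n_κ x := x.1.2.2
  n_α x := x.2
  r_α _ := rfl
  unique_a b c h a ha := by
    refine ⟨⟨(a, ⟨(c, b), h⟩), ha⟩, ⟨rfl, rfl, rfl⟩, ?_⟩
    rintro x ⟨h1, h2, h3⟩
    exact Subtype.ext (Prod.ext h3 (Subtype.ext (Prod.ext h2 h1)))

namespace CompData

variable {X Y Z W : FinGSet G} {P : Bispan O X Y} {Q : Bispan O Y Z} {R R' : Bispan O X Z}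

theorem ε_congr (D : CompData P Q R) {b b' : R.B} {c c' : Q.A} (hb : b = b') (hc : c = c')
    (h : Q.n c = D.β b) (h' : Q.n c' = D.β b') : D.ε b c h = D.ε b' c' h' := by
  subst hb hc
  rfl

theorem ext_b (D : CompData P Q R) {b b' : R.B} (h : D.β b = D.β b')
    (h' : ∀ c hc hc', D.ε b c hc = D.ε b' c hc') : b = b' := by
  obtain ⟨_, _, hu⟩ := D.unique_b (D.β b') (fun c hc => D.ε b' c hc) fun c hc => D.t_ε b' c hc
  exact (hu b ⟨h, fun c hc hc' => h' c hc hc'⟩).trans (hu b' ⟨rfl, fun _ _ _ => rfl⟩).symm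

theorem ext_a (D : CompData P Q R) {x x' : R.A} (h1 : R.n x = R.n x') (h2 : D.κ x = D.κ x')
    (h3 : D.α x = D.α x') : x = x' := by
  obtain ⟨_, _, hu⟩ := D.unique_a (R.n x') (D.κ x') (D.n_κ x') (D.α x') (D.n_α x')
  exact (hu x ⟨h1, h2, h3⟩).trans (hu x' ⟨rfl, rfl, rfl⟩).symm

theorem exists_hom (D : CompData P Q R) (D' : CompData P Q R') :
    ∃ (k : R.A →[G] R'.A) (f : R.B →[G] R'.B), (∀ b, D'.β (f b) = D.β b) ∧
      (∀ b c h h', D'.ε (f b) c h' = D.ε b c h) ∧ (∀ x, R'.n (k x) = f (R.n x)) ∧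
      (∀ x, D'.κ (k x) = D.κ x) ∧ ∀ x, D'.α (k x) = D.α x := by
  choose f hf1 hf2 using fun b =>
    (D'.unique_b (D.β b) (fun c hc => D.ε b c hc) fun c hc => D.t_ε b c hc).exists
  have hf : ∀ (g : G) (b : R.B), f (g • b) = g • f b := by
    intro g b
    refine D'.ext_b (by rw [hf1, map_smul, map_smul, hf1]) fun c hc hc' => ?_
    have hc1 : Q.n (g⁻¹ • c) = D'.β (f b) := by
      rw [map_smul, hc', map_smul, inv_smul_smul]
    have hc2 : Q.n (g⁻¹ • c) = D.β b := by rw [hc1, hf1]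
    have e1 := D'.ε_smul g (f b) (g⁻¹ • c) hc1 (by rw [smul_inv_smul, hc'])
    have e2 := D.ε_smul g b (g⁻¹ • c) hc2 (by rw [smul_inv_smul, hc, hf1])
    rw [hf2 (g • b) c hc (by rw [hc, hf1]), D'.ε_congr rfl (smul_inv_smul g c).symm hc'
      (by rw [smul_inv_smul, hc']), e1, hf2 b _ hc1 hc2, ← e2]
    exact D.ε_congr rfl (smul_inv_smul g c).symm _ _
  have hk : ∀ x : R.A, Q.n (D.κ x) = D'.β (f (R.n x)) := fun x => by rw [hf1, D.n_κ]
  choose k hk1 hk2 hk3 using fun x : R.A =>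
    (D'.unique_a (f (R.n x)) (D.κ x) (hk x) (D.α x)
      (by rw [D.n_α]; exact (hf2 _ _ _ _).symm)).exists
  refine ⟨⟨k, fun g x => D'.ext_a ?_ ?_ ?_⟩, ⟨f, hf⟩, hf1, fun b c h h' => hf2 b c h' h,
    hk1, hk2, hk3⟩
  · rw [hk1, map_smul, hf, map_smul, hk1]
    rfl
  · rw [hk2, map_smul, map_smul, hk2]
    rfl
  · rw [hk3, map_smul, map_smul, hk3]
    rfl

/-- Composites are unique up to isomorphism. -/
theorem iso (D : CompData P Q R) (D' : CompData P Q R') : R.Iso R' := by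
  obtain ⟨k, f, h1, h2, h3, h4, h5⟩ := exists_hom D D'
  obtain ⟨k', f', h1', h2', h3', h4', h5'⟩ := exists_hom D' D
  have hff : ∀ b, f' (f b) = b := fun b => D.ext_b (by rw [h1', h1]) fun c hc hc' => by
    rw [h2' _ _ (by rw [h1, hc']) hc, h2 _ _ hc']
  have hff' : ∀ b, f (f' b) = b := fun b => D'.ext_b (by rw [h1, h1']) fun c hc hc' => by
    rw [h2 _ _ (by rw [h1', hc']) hc, h2' _ _ hc']
  have hkk : ∀ x, k' (k x) = x := fun x =>
    D.ext_a (by rw [h3', h3, hff]) (by rw [h4', h4]) (by rw [h5', h5])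
  have hkk' : ∀ x, k (k' x) = x := fun x =>
    D'.ext_a (by rw [h3, h3', hff']) (by rw [h4, h4']) (by rw [h5, h5'])
  refine ⟨k, f, Function.bijective_iff_has_inverse.2 ⟨k', hkk, hkk'⟩,
    Function.bijective_iff_has_inverse.2 ⟨f', hff, hff'⟩, fun a => ?_, h3, fun b => ?_⟩
  · rw [← D'.r_α, h5, D.r_α]
  · rw [← D'.t_β, h1, D.t_β]

/-- Composites are invariant under isomorphism. -/
theorem transport {P' : Bispan O X Y} {Q' : Bispan O Y Z} (hP : P.Iso P') (hQ : Q.Iso Q')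
    (D : CompData P' Q' R) : Nonempty (CompData P Q R) := by
  obtain ⟨a, b, ha, hb, hr, hn, ht⟩ := hP
  obtain ⟨c, d, hc, hd, hr', hn', ht'⟩ := hQ
  obtain ⟨a', -, ha1, ha2⟩ := exists_inv a ha
  obtain ⟨b', -, hb1, hb2⟩ := exists_inv b hb
  obtain ⟨c', -, hc1, hc2⟩ := exists_inv c hc
  obtain ⟨d', -, hd1, hd2⟩ := exists_inv d hd
  have ht2 : ∀ z, P.t (b' z) = P'.t z := fun z => by rw [← ht, hb2]
  have hn2 : ∀ z, P.n (a' z) = b' (P'.n z) := fun z => by rw [← hb1 (P.n _), ← hn, ha2]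
  have hn2' : ∀ z, Q.n (c' z) = d' (Q'.n z) := fun z => by rw [← hd1 (Q.n _), ← hn', hc2]
  have hq : ∀ (x : R.B) (y : Q.A), Q.n y = d' (D.β x) → Q'.n (c y) = D.β x := fun x y h => by
    rw [hn', h, hd2]
  refine ⟨{
    β := d'.comp D.β
    ε := fun x y h => b' (D.ε x (c y) (hq x y h))
    ε_smul := ?_
    t_β := fun x => ?_
    t_ε := fun x y h => by rw [ht2, D.t_ε, hr']
    unique_b := ?_
    α := a'.comp D.α
    κ := c'.comp D.κ
    n_κ := fun x => by
      change Q.n (c' (D.κ x)) = d' (D.β _)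
      rw [hn2', D.n_κ]
    n_α := fun x => by
      change P.n (a' (D.α x)) = _
      rw [hn2, D.n_α]
      exact congrArg b' (D.ε_congr rfl (hc2 _).symm _ _)
    r_α := fun x => by
      change P.r (a' (D.α x)) = _
      rw [← hr, ha2, D.r_α]
    unique_a := ?_ }⟩
  · intro g x y h h'
    rw [← map_smul, ← D.ε_smul g x (c y) (hq x y h) (by rw [← map_smul]; exact hq _ _ h')]
    exact congrArg b' (D.ε_congr rfl (map_smul c g y) _ _)
  · change Q.t (d' (D.β x)) = _
    rw [← ht', hd2, D.t_β]
  · intro z σ hσ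
    obtain ⟨x, ⟨hx1, hx2⟩, hu⟩ := D.unique_b (d z)
      (fun y h => b (σ (c' y) (by rw [hn2', h, hd1])))
      (fun y h => by rw [ht, hσ, ← hr', hc2])
    refine ⟨x, ⟨(congrArg d' hx1).trans (hd1 z), fun y h h' => ?_⟩, ?_⟩
    · rw [hx2 (c y) _ (by rw [hn', h']), hb1]
      congr 1
      exact hc1 y
    · rintro x' ⟨h1, h2⟩
      have h1' : D.β x' = d z := by
        rw [← h1]
        exact (hd2 _).symm
      refine hu x' ⟨h1', fun y h h' => ?_⟩
      rw [← h2 (c' y) (by rw [hn2', h]; rfl) (by rw [hn2', h', hd1]), hb2]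
      exact D.ε_congr rfl (hc2 y).symm _ _
  · intro x y h z hz
    obtain ⟨w, ⟨h1, h2, h3⟩, hu⟩ := D.unique_a x (c y) (hq x y h) (a z) (by rw [hn, hz, hb2])
    refine ⟨w, ⟨h1, (congrArg c' h2).trans (hc1 y), (congrArg a' h3).trans (ha1 z)⟩, ?_⟩
    rintro w' ⟨h1', h2', h3'⟩
    refine hu w' ⟨h1', ?_, ?_⟩
    · rw [← h2']
      exact (hc2 _).symm
    · rw [← h3']
      exact (ha2 _).symm

/-- The identity bispan is a left unit. -/
def identityComp (Q : Bispan O X Y) : CompData (identity X) Q Q where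
  β := MulActionHom.id G
  ε _ c _ := Q.r c
  ε_smul g _ c _ _ := map_smul Q.r g c
  t_β _ := rfl
  t_ε _ _ _ := rfl
  unique_b d _ hσ := ⟨d, ⟨rfl, fun c _ h' => (hσ c h').symm⟩, fun _ h => h.1⟩
  α := Q.r
  κ := MulActionHom.id G
  n_κ _ := rfl
  n_α _ := rfl
  r_α _ := rfl
  unique_a _ c h _ ha := ⟨c, ⟨h, rfl, ha.symm⟩, fun _ hx => hx.2.1⟩

/-- The identity bispan is a right unit. -/
def compIdentity (P : Bispan O X Y) : CompData P (identity Y) P where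
  β := P.t
  ε b _ _ := b
  ε_smul _ _ _ _ _ := rfl
  t_β _ := rfl
  t_ε _ _ h := h.symm
  unique_b d σ hσ := by
    refine ⟨σ d rfl, ⟨hσ d rfl, ?_⟩, fun b hb => hb.2 d hb.1.symm rfl⟩
    intro c h h'
    obtain rfl : c = d := h'
    rfl
  α := MulActionHom.id G
  κ := P.t.comp P.n
  n_κ _ := rfl
  n_α _ := rfl
  r_α _ := rfl
  unique_a b c h a ha := by
    refine ⟨a, ⟨ha, ?_, rfl⟩, fun x hx => hx.2.2⟩
    change P.t (P.n a) = c
    rw [ha]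
    exact h.symm

/-- Associativity of composition. -/
theorem assoc {S : Bispan O Z W} {R₁ : Bispan O X Z} {R₂ : Bispan O Y W} {T : Bispan O X W}
    (D₁ : CompData P Q R₁) (D₂ : CompData R₁ S T) (D₃ : CompData Q S R₂) :
    Nonempty (CompData P R₂ T) := by
  choose β hβ1 hβ2 using fun τ : T.B =>
    (D₃.unique_b (D₂.β τ) (fun e h => D₁.β (D₂.ε τ e h))
      (fun e h => by rw [D₁.t_β, D₂.t_ε])).exists
  have hβs : ∀ (g : G) (τ : T.B), β (g • τ) = g • β τ := by
    intro g τ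
    refine D₃.ext_b (by rw [hβ1, map_smul, map_smul, hβ1]) fun e he he' => ?_
    have he1 : S.n (g⁻¹ • e) = D₃.β (β τ) := by rw [map_smul, he', map_smul, inv_smul_smul]
    have he2 : S.n (g⁻¹ • e) = D₂.β τ := by rw [he1, hβ1]
    have e1 := D₃.ε_smul g (β τ) (g⁻¹ • e) he1 (by rw [smul_inv_smul, he'])
    have e2 := D₂.ε_smul g τ (g⁻¹ • e) he2 (by rw [smul_inv_smul, he, hβ1])
    rw [hβ2 (g • τ) e he (by rw [he, hβ1]), D₃.ε_congr rfl (smul_inv_smul g e).symm he'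
      (by rw [smul_inv_smul, he']), e1, hβ2 τ _ he1 he2, ← map_smul, ← e2]
    exact congrArg D₁.β (D₂.ε_congr rfl (smul_inv_smul g e).symm _ _)
  have k1 : ∀ (τ : T.B) (x : R₂.A), R₂.n x = β τ → S.n (D₃.κ x) = D₂.β τ := fun τ x h => by
    rw [D₃.n_κ, h, hβ1]
  have k2 : ∀ (τ : T.B) (x : R₂.A) (h : R₂.n x = β τ),
      Q.n (D₃.α x) = D₁.β (D₂.ε τ (D₃.κ x) (k1 τ x h)) := fun τ x h => by
    rw [D₃.n_α, ← hβ2 τ _ (by rw [D₃.n_κ, h]) (k1 τ x h)]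
    exact D₃.ε_congr h rfl _ _
  have k3 : ∀ y : T.A, S.n (D₂.κ y) = D₃.β (β (T.n y)) := fun y => by rw [hβ1, D₂.n_κ]
  have k4 : ∀ y : T.A, Q.n (D₁.κ (D₂.α y)) = D₃.ε (β (T.n y)) (D₂.κ y) (k3 y) := fun y => by
    rw [D₁.n_κ, D₂.n_α, hβ2 _ _ _ (D₂.n_κ y)]
  choose κ hκ1 hκ2 hκ3 using fun y : T.A =>
    (D₃.unique_a (β (T.n y)) (D₂.κ y) (k3 y) (D₁.κ (D₂.α y)) (k4 y)).exists
  have ε_smul : ∀ (g : G) (τ : T.B) (x : R₂.A) (h : R₂.n x = β τ) (h' : R₂.n (g • x) = β (g • τ)),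
      D₁.ε (D₂.ε (g • τ) (D₃.κ (g • x)) (k1 _ _ h')) (D₃.α (g • x)) (k2 _ _ h') =
        g • D₁.ε (D₂.ε τ (D₃.κ x) (k1 τ x h)) (D₃.α x) (k2 τ x h) := by
    intro g τ x h h'
    have e2 : D₂.ε (g • τ) (D₃.κ (g • x)) (k1 _ _ h') = g • D₂.ε τ (D₃.κ x) (k1 τ x h) := by
      rw [← D₂.ε_smul g τ _ (k1 τ x h) (by rw [← map_smul]; exact k1 _ _ h')]
      exact D₂.ε_congr rfl (map_smul D₃.κ g x) _ _
    rw [← D₁.ε_smul g _ _ (k2 τ x h) (by rw [map_smul, map_smul, k2 τ x h])]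
    exact D₁.ε_congr e2 (map_smul D₃.α g x) _ _
  refine ⟨{
    β := ⟨β, hβs⟩
    ε := fun τ x h => D₁.ε (D₂.ε τ (D₃.κ x) (k1 τ x h)) (D₃.α x) (k2 τ x h)
    ε_smul := ε_smul
    t_β := fun τ => by
      change R₂.t (β τ) = _
      rw [← D₃.t_β, hβ1, D₂.t_β]
    t_ε := fun τ x h => by rw [D₁.t_ε, D₃.r_α]
    unique_b := ?_
    α := D₁.α.comp D₂.α
    κ := ⟨κ, fun g y => D₃.ext_a ?_ ?_ ?_⟩
    n_κ := hκ1
    n_α := fun y => by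
      change P.n (D₁.α (D₂.α y)) = _
      rw [D₁.n_α]
      refine D₁.ε_congr ?_ (hκ3 y).symm _ _
      rw [D₂.n_α]
      exact D₂.ε_congr rfl (hκ2 y).symm _ _
    r_α := fun y => by
      change P.r (D₁.α (D₂.α y)) = _
      rw [D₁.r_α, D₂.r_α]
    unique_a := ?_ }⟩
  · intro ρ σ hσ
    choose x hx1 hx2 hx3 using fun (e : S.A) (he : S.n e = D₃.β ρ) (c : Q.A)
      (hc : Q.n c = D₃.ε ρ e he) => (D₃.unique_a ρ e he c hc).exists
    choose q hq1 hq2 using fun (e : S.A) (he : S.n e = D₃.β ρ) =>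
      (D₁.unique_b (D₃.ε ρ e he) (fun c hc => σ (x e he c hc) (hx1 e he c hc))
        (fun c hc => by rw [hσ, ← D₃.r_α, hx3])).exists
    obtain ⟨τ, ⟨hτ1, hτ2⟩, -⟩ := D₂.unique_b (D₃.β ρ) q
      (fun e he => by rw [← D₁.t_β, hq1, D₃.t_ε])
    have hτ : β τ = ρ := by
      refine D₃.ext_b (by rw [hβ1, hτ1]) fun e he he' => ?_
      rw [hβ2 τ e he (by rw [he', hτ1]), hτ2 e _ he', hq1]
    refine ⟨τ, ⟨hτ, fun y h h' => ?_⟩, ?_⟩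
    · have hy : S.n (D₃.κ y) = D₃.β ρ := by rw [D₃.n_κ, h']
      have hy2 : Q.n (D₃.α y) = D₃.ε ρ (D₃.κ y) hy := by
        rw [D₃.n_α]
        exact D₃.ε_congr h' rfl _ _
      have e1 : D₁.ε (D₂.ε τ (D₃.κ y) (k1 τ y h)) (D₃.α y) (k2 τ y h) =
          D₁.ε (q _ hy) (D₃.α y) (by rw [hq1, hy2]) :=
        D₁.ε_congr (hτ2 _ _ _) rfl _ _
      refine e1.trans ?_
      rw [hq2 _ hy _ _ hy2]
      have e2 : x _ hy _ hy2 = y :=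
        D₃.ext_a (by rw [hx1, h']) (hx2 _ _ _ _) (hx3 _ _ _ _)
      congr 1
    · rintro τ' ⟨h1, h2⟩
      have h1 : β τ' = ρ := h1
      refine D₂.ext_b (by rw [hτ1, ← h1, hβ1]) fun e he he' => ?_
      have he2 : S.n e = D₃.β ρ := by rw [he', hτ1]
      rw [hτ2 e he' he2]
      have hb : D₁.β (D₂.ε τ' e he) = D₃.ε ρ e he2 := by
        rw [← hβ2 τ' e (by rw [hβ1, he]) he]
        exact D₃.ε_congr h1 rfl _ _
      refine D₁.ext_b (by rw [hb, hq1]) fun c hc hc' => ?_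
      have hc2 : Q.n c = D₃.ε ρ e he2 := by rw [hc, hb]
      rw [hq2 e he2 c hc' hc2]
      have hx := hx1 e he2 c hc2
      rw [← h2 (x e he2 c hc2) (by rw [hx]; exact h1.symm) hx]
      exact D₁.ε_congr (D₂.ε_congr rfl (hx2 _ _ _ _).symm _ _) (hx3 _ _ _ _).symm _ _
  · rw [hκ1, map_smul T.n, hβs, map_smul R₂.n, hκ1]
    rfl
  · rw [hκ2, map_smul D₂.κ, map_smul D₃.κ, hκ2]
    rfl
  · rw [hκ3, map_smul D₂.α, map_smul D₁.κ, map_smul D₃.α, hκ3]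
    rfl
  · intro τ y h a ha
    have h : R₂.n y = β τ := h
    obtain ⟨v, ⟨hv1, hv2, hv3⟩, -⟩ := D₁.unique_a _ _ (k2 τ y h) a ha
    obtain ⟨w, ⟨hw1, hw2, hw3⟩, -⟩ := D₂.unique_a τ (D₃.κ y) (k1 τ y h) v hv1
    refine ⟨w, ⟨hw1, D₃.ext_a ?_ ?_ ?_, ?_⟩, ?_⟩
    · exact (hκ1 w).trans (by rw [hw1, h])
    · exact (hκ2 w).trans hw2
    · exact (hκ3 w).trans (by rw [hw3, hv2])
    · change D₁.α (D₂.α w) = a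
      rw [hw3, hv3]
    · rintro w' ⟨h1, h2, h3⟩
      have h2 : κ w' = y := h2
      have h3 : D₁.α (D₂.α w') = a := h3
      have hκ' : D₂.κ w' = D₂.κ w := by rw [← hκ2, h2, hw2]
      refine D₂.ext_a (by rw [h1, hw1]) hκ' (D₁.ext_a ?_ ?_ ?_)
      · rw [D₂.n_α, D₂.n_α]
        exact D₂.ε_congr (by rw [h1, hw1]) hκ' _ _
      · rw [← hκ3, h2, hw3, hv2]
      · rw [h3, hw3, hv3]

end CompData

theorem comp_congr {X Y Z : FinGSet G} {P P' : Bispan O X Y} {Q Q' : Bispan O Y Z}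
    (hP : P.Iso P') (hQ : Q.Iso Q') : (P.comp Q).Iso (P'.comp Q') := by
  obtain ⟨D⟩ := CompData.transport hP hQ (compData P' Q')
  exact (compData P Q).iso D

/-- Bispans up to isomorphism. -/
instance setoid (X Y : FinGSet G) : Setoid (Bispan O X Y) where
  r := Iso
  iseqv := ⟨iso_refl, iso_symm, iso_trans⟩

end Bispan

/-- The category `P_O^G` of polynomials with exponents in `Set_O^G`: its objects are the finite
`G`-sets and its morphisms are the isomorphism classes of bispans with exponents in `Set_O^G`. -/
structure PolyCat {G : Type u} [Group G] [Finite G] (O : IndexingSystem G) where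
  set : FinGSet G

namespace PolyCat

variable {G : Type u} [Group G] [Finite G] {O : IndexingSystem G}

instance : Category.{u + 1} (PolyCat O) where
  Hom X Y := Quotient (Bispan.setoid (O := O) X.set Y.set)
  id X := Quotient.mk _ (Bispan.identity X.set)
  comp := Quotient.map₂ Bispan.comp fun _ _ hP _ _ hQ => Bispan.comp_congr hP hQ
  id_comp := by
    rintro X Y ⟨Q⟩
    exact Quotient.sound ((Bispan.compData _ _).iso (Bispan.CompData.identityComp Q))
  comp_id := by
    rintro X Y ⟨P⟩
    exact Quotient.sound ((Bispan.compData _ _).iso (Bispan.CompData.compIdentity P))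
  assoc := by
    rintro W X Y Z ⟨P⟩ ⟨Q⟩ ⟨S⟩
    obtain ⟨D⟩ := Bispan.CompData.assoc (Bispan.compData P Q) (Bispan.compData (P.comp Q) S)
      (Bispan.compData Q S)
    exact Quotient.sound (D.iso (Bispan.compData _ _))

/-- The class of a bispan. -/
def homMk {X Y : FinGSet G} (P : Bispan O X Y) : (⟨X⟩ : PolyCat O) ⟶ ⟨Y⟩ :=
  Quotient.mk (Bispan.setoid (O := O) X Y) P

theorem mem_id (X : FinGSet G) : O.Mem (MulActionHom.id G : X →[G] X) :=
  IndexingSystem.mem_of_injective _ fun _ _ h => h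

/-- `R_f = [T ← S → S → S]` for `f : S → T`. -/
def R (O : IndexingSystem G) {S T : FinGSet G} (f : S →[G] T) : (⟨T⟩ : PolyCat O) ⟶ ⟨S⟩ :=
  homMk ⟨S, S, f, MulActionHom.id G, MulActionHom.id G, mem_id S⟩

/-- `N_f = [S ← S → T → T]` for `f : S → T` in `Set_O^G`. -/
def N {S T : FinGSet G} (f : S →[G] T) (hf : O.Mem f) : (⟨S⟩ : PolyCat O) ⟶ ⟨T⟩ :=
  homMk ⟨S, T, MulActionHom.id G, f, MulActionHom.id G, hf⟩

/-- `T_f = [S ← S → S → T]` for `f : S → T`. -/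
def T (O : IndexingSystem G) {S T : FinGSet G} (f : S →[G] T) : (⟨S⟩ : PolyCat O) ⟶ ⟨T⟩ :=
  homMk ⟨S, S, MulActionHom.id G, MulActionHom.id G, f, mem_id S⟩

end PolyCat

/-! ## Incomplete Tambara functors -/

namespace PolyCat

variable {G : Type u} [Group G] [Finite G] {O : IndexingSystem G} (F : PolyCat O ⥤ Type w)

/-- `s = a + b` in `F(X)`, where addition is `F(X) × F(X) ≅ F(X ⊔ X) → F(X)`, the second map being
the transfer along the fold map. -/
def IsSum {X : FinGSet G} (a b s : F.obj ⟨X⟩) : Prop :=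
  ∃ c : F.obj ⟨X.sum X⟩, F.map (R O (inl X X)) c = a ∧ F.map (R O (inr X X)) c = b ∧
    F.map (T O (fold X)) c = s

/-- `z = 0` in `F(X)`: the image of `F(∅)` under the transfer along `∅ → X`. -/
def IsZero {X : FinGSet G} (z : F.obj ⟨X⟩) : Prop :=
  ∃ e : F.obj ⟨empty⟩, F.map (T O (fromEmpty X)) e = z

theorem mem_fold (X : FinGSet G) : O.Mem (fold X) := by
  intro s
  refine IndexingSystem.adm_quotient_of_eq fun g hg => ?_
  rw [MulAction.mem_stabilizer_iff] at hg ⊢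
  rcases s with s | s
  · exact congrArg Sum.inl hg
  · exact congrArg Sum.inr hg

theorem mem_fromEmpty (X : FinGSet G) : O.Mem (fromEmpty X) := fun s => PEmpty.elim s

/-- `s = a * b` in `F(X)`, where multiplication is `F(X) × F(X) ≅ F(X ⊔ X) → F(X)`, the second map
being the norm along the fold map. -/
def IsProd {X : FinGSet G} (a b s : F.obj ⟨X⟩) : Prop :=
  ∃ c : F.obj ⟨X.sum X⟩, F.map (R O (inl X X)) c = a ∧ F.map (R O (inr X X)) c = b ∧
    F.map (N (fold X) (mem_fold X)) c = s

/-- `z = 1` in `F(X)`: the image of `F(∅)` under the norm along `∅ → X`. -/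
def IsOne {X : FinGSet G} (z : F.obj ⟨X⟩) : Prop :=
  ∃ e : F.obj ⟨empty⟩, F.map (N (fromEmpty X) (mem_fromEmpty X)) e = z

/-- An `O`-Tambara functor: a product preserving functor `P_O^G → Set` (an `O`-semi-Tambara
functor) whose values, with their natural addition, are groups. -/
def IsTambara : ObjectProperty (PolyCat O ⥤ Type w) := fun F =>
  Limits.PreservesFiniteProducts F ∧
    ∀ (X : FinGSet G) (a : F.obj ⟨X⟩), ∃ b z, IsZero F z ∧ IsSum F a b z

end PolyCat

/-- The category of `O`-Tambara functors and natural transformations. -/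
abbrev TambaraFunctor {G : Type u} [Group G] [Finite G] (O : IndexingSystem G) :
    Type (max (u + 1) (w + 1)) :=
  (PolyCat.IsTambara.{u, w} (O := O)).FullSubcategory

/-! ## Green functors with norms -/

/-- A commutative Green functor: a Mackey functor on finite `G`-sets whose values are commutative
rings, whose restrictions are ring homomorphisms and which satisfies Frobenius reciprocity. -/
structure GreenFunctor (G : Type u) [Group G] where
  obj : FinGSet G → Type w
  [ring : ∀ X, CommRing (obj X)]
  res : ∀ {X Y : FinGSet G}, (X →[G] Y) → (obj Y →+* obj X)
  tr : ∀ {X Y : FinGSet G}, (X →[G] Y) → (obj X →+ obj Y)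
  res_id : ∀ {X : FinGSet G} (x : obj X), res (MulActionHom.id G) x = x
  res_comp : ∀ {X Y Z : FinGSet G} (g : Y →[G] Z) (f : X →[G] Y) (z : obj Z),
    res (g.comp f) z = res f (res g z)
  tr_id : ∀ {X : FinGSet G} (x : obj X), tr (MulActionHom.id G) x = x
  tr_comp : ∀ {X Y Z : FinGSet G} (g : Y →[G] Z) (f : X →[G] Y) (x : obj X),
    tr (g.comp f) x = tr g (tr f x)
  /-- `R_f T_g = T_k R_h` for a pullback square `f ∘ k = g ∘ h`. -/
  res_tr : ∀ {P X Y Z : FinGSet G} (k : P →[G] X) (h : P →[G] Y) (f : X →[G] Z) (g : Y →[G] Z),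
    IsPullbackSquare k h f g → ∀ y : obj Y, res f (tr g y) = tr k (res h y)
  /-- Additivity: finite disjoint unions are taken to products. -/
  additive : ∀ X Y : FinGSet G,
    Function.Bijective fun c : obj (X.sum Y) => (res (inl X Y) c, res (inr X Y) c)
  additive_empty : Subsingleton (obj empty)
  frobenius : ∀ {X Y : FinGSet G} (f : X →[G] Y) (a : obj Y) (b : obj X),
    a * tr f b = tr f (res f a * b)

attribute [instance] GreenFunctor.ring

namespace FinGSet

variable {G : Type u} [Group G] [Finite G]

/-- The map `G/G_x → X`, `γ G_x ↦ γ x`. -/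
def ofPoint {X : FinGSet G} (x : X) : orbit (MulAction.stabilizer G x) →[G] X where
  toFun := MulAction.ofQuotientStabilizer G x
  map_smul' a q := MulAction.ofQuotientStabilizer_smul G x a q

/-- The quotient map `G/G_a → G/G_b`, where `b = g(a)`. -/
def stabMap {A B : FinGSet G} (g : A →[G] B) {b : B} (a : {a : A // g a = b}) :
    orbit (MulAction.stabilizer G a.1) →[G] orbit (MulAction.stabilizer G b) where
  toFun := Subgroup.quotientMapOfLE (by
    have h := IndexingSystem.stabilizer_le g a.1
    rwa [a.2] at h)
  map_smul' := by
    rintro x ⟨y⟩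
    rfl

theorem mem_stabMap {O : IndexingSystem G} {A B : FinGSet G} {g : A →[G] B} (hg : O.Mem g) {b : B}
    (a : {a : A // g a = b}) : O.Mem (stabMap g a) := by
  refine IndexingSystem.mem_of_square hg (ofPoint b) _ (ofPoint a.1) ?_ fun u u' _ h =>
    MulAction.injective_ofQuotientStabilizer G a.1 h
  rintro ⟨x⟩
  change g (x • a.1) = x • b
  rw [map_smul, a.2]

theorem mem_pullback_fst {O : IndexingSystem G} {X Y Z : FinGSet G} (f : X →[G] Z) {g : Y →[G] Z}
    (hg : O.Mem g) : O.Mem (pullback.fst f g) :=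
  IndexingSystem.mem_of_square hg f _ (pullback.snd f g) (fun u => u.2.symm)
    fun _ _ h h' => Subtype.ext (Prod.ext h h')

theorem mem_pullback_snd {O : IndexingSystem G} {X Y Z : FinGSet G} {f : X →[G] Z}
    (hf : O.Mem f) (g : Y →[G] Z) : O.Mem (pullback.snd f g) :=
  IndexingSystem.mem_of_square hf g _ (pullback.fst f g) (fun u => u.2)
    fun _ _ h h' => Subtype.ext (Prod.ext h' h)

end FinGSet

namespace GreenFunctor

variable {G : Type u} [Group G] [Finite G] (M : GreenFunctor.{u, w} G) {O : IndexingSystem G}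

/-- A family of maps of multiplicative monoids `N_f : M(G/H) → M(G/K)`, one for each map
`f : G/H → G/K` in `Orb_O`. -/
abbrev NormMaps (O : IndexingSystem G) : Type (max u w) :=
  ∀ {H K : Subgroup G} (f : (orbit H : FinGSet G) →[G] orbit K), O.Mem f →
    (M.obj (orbit H) →* M.obj (orbit K))

variable {M} (N : M.NormMaps O)

/-- `y = N_g(x)` for an arbitrary map `g : A → B` in `Set_O^G`, the norm being extended from orbits
to coproducts of orbits by products: for each point `b`, the restriction of `y` along
`G/G_b → B` is the product, over representatives `a` of the `G_b`-orbits of `g⁻¹(b)`, of the norms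
along `G/G_a → G/G_b` of the restrictions of `x` along `G/G_a → A`.
(Two points of `g⁻¹(b)` lie in one `G`-orbit iff they lie in one `G_b`-orbit.) -/
def IsNorm {A B : FinGSet G} (g : A →[G] B) (hg : O.Mem g) (x : M.obj A) (y : M.obj B) : Prop :=
  ∀ (b : B) (s : Finset {a : A // g a = b}),
    (∀ a : {a : A // g a = b}, ∃! a', a' ∈ s ∧ a'.1 ∈ MulAction.orbit G a.1) →
    M.res (ofPoint b) y = ∏ a ∈ s, N (stabMap g a) (mem_stabMap hg a) (M.res (ofPoint a.1) x)

/-- `z = T_{f'} N_{g'} R_{h'} (x)` for the exponential diagram of `p : E → A` and `g : A → B`, where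
`f' : ∏_g E → B`, `g' : A ×_B ∏_g E → ∏_g E` and `h' : A ×_B ∏_g E → E` is the evaluation. -/
def IsExponential {A B E : FinGSet G} (g : A →[G] B) (hg : O.Mem g) (p : E →[G] A) (x : M.obj E)
    (z : M.obj B) : Prop :=
  ∃ y : M.obj (depProd g p),
    IsNorm N (pullback.snd g (depProd.base g p)) (mem_pullback_snd hg _)
      (M.res (depProd.eval g p) x) y ∧
    z = M.tr (depProd.base g p) y

end GreenFunctor

/-- A commutative Green functor with norm maps: maps of multiplicative monoids
`N_f : M(G/H) → M(G/K)` for the maps `f : G/H → G/K` in `Orb_O`, functorial in `f` and compatible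
with restrictions, that satisfy the Tambara reciprocity relations. -/
structure NormedGreenFunctor {G : Type u} [Group G] [Finite G] (O : IndexingSystem G) extends
    GreenFunctor.{u, w} G where
  norm : toGreenFunctor.NormMaps O
  norm_id : ∀ {H : Subgroup G} (x : obj (orbit H)),
    norm (MulActionHom.id G) (PolyCat.mem_id _) x = x
  norm_comp : ∀ {H K L : Subgroup G} (g : (orbit K : FinGSet G) →[G] orbit L)
    (f : (orbit H : FinGSet G) →[G] orbit K) (hg : O.Mem g) (hf : O.Mem f) (x : obj (orbit H)),
    norm (g.comp f) (IndexingSystem.mem_comp hg hf) x = norm g hg (norm f hf x)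
  /-- The double coset formula: `R_k N_f` is the norm along `G/L ×_{G/K} G/H → G/L` after
  the restriction along `G/L ×_{G/K} G/H → G/H`. -/
  res_norm : ∀ {H K L : Subgroup G} (k : (orbit L : FinGSet G) →[G] orbit K)
    (f : (orbit H : FinGSet G) →[G] orbit K) (hf : O.Mem f) (x : obj (orbit H)),
    GreenFunctor.IsNorm norm (pullback.fst k f) (mem_pullback_fst k hf)
      (res (pullback.snd k f) x) (res k (norm f hf x))
  /-- Tambara reciprocity for sums: the norm of `a + b`, with `(a, b)` in
  `M(G/H) × M(G/H) ≅ M(G/H ⊔ G/H)`, is computed by the exponential diagram of the fold map; the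
  fibres of the dependent product are the sets of functions from the fibres of `f` to a two-element
  set. -/
  norm_add : ∀ {H K : Subgroup G} (f : (orbit H : FinGSet G) →[G] orbit K) (hf : O.Mem f)
    (a b : obj (orbit H)) (c : obj ((orbit H).sum (orbit H))),
    res (inl _ _) c = a → res (inr _ _) c = b →
    GreenFunctor.IsExponential norm f hf (fold (orbit H)) c (norm f hf (a + b))
  /-- Tambara reciprocity for transfers along maps of orbits. -/
  norm_tr : ∀ {L H K : Subgroup G} (f : (orbit H : FinGSet G) →[G] orbit K) (hf : O.Mem f)
    (q : (orbit L : FinGSet G) →[G] orbit H) (a : obj (orbit L)),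
    GreenFunctor.IsExponential norm f hf q a (norm f hf (tr q a))

namespace NormedGreenFunctor

variable {G : Type u} [Group G] [Finite G] {O : IndexingSystem G}

/-- Maps of Green functors that commute with the norms. -/
@[ext]
structure Hom (M M' : NormedGreenFunctor.{u, w} O) where
  app : ∀ X : FinGSet G, M.obj X →+* M'.obj X
  app_res : ∀ {X Y : FinGSet G} (f : X →[G] Y) (y : M.obj Y),
    app X (M.res f y) = M'.res f (app Y y)
  app_tr : ∀ {X Y : FinGSet G} (f : X →[G] Y) (x : M.obj X),
    app Y (M.tr f x) = M'.tr f (app X x)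
  app_norm : ∀ {H K : Subgroup G} (f : (orbit H : FinGSet G) →[G] orbit K) (hf : O.Mem f)
    (x : M.obj (orbit H)), app (orbit K) (M.norm f hf x) = M'.norm f hf (app (orbit H) x)

instance : Category (NormedGreenFunctor.{u, w} O) where
  Hom := Hom
  id M :=
    { app := fun X => RingHom.id _
      app_res := fun _ _ => rfl
      app_tr := fun _ _ => rfl
      app_norm := fun _ _ _ => rfl }
  comp φ ψ :=
    { app := fun X => (ψ.app X).comp (φ.app X)
      app_res := fun f y => by simp [φ.app_res, ψ.app_res]
      app_tr := fun f x => by simp [φ.app_tr, ψ.app_tr]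
      app_norm := fun f hf x => by simp [φ.app_norm, ψ.app_norm] }

end NormedGreenFunctor

/-- An identification of a Green functor with norms `M` with the structure underlying the
`O`-Tambara functor `F`: bijections `M(X) ≃ F(X)` that match the ring operations (given on `F(X)` by
transfer and norm along fold maps and along `∅ → X`), the restrictions, transfers and norms. -/
structure Underlying {G : Type u} [Group G] [Finite G] {O : IndexingSystem G}
    (F : TambaraFunctor.{u, w} O) (M : NormedGreenFunctor.{u, w} O) where
  equiv : ∀ X : FinGSet G, M.obj X ≃ F.obj.obj ⟨X⟩
  zero : ∀ X, PolyCat.IsZero F.obj (equiv X 0)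
  one : ∀ X, PolyCat.IsOne F.obj (equiv X 1)
  add : ∀ X (a b : M.obj X), PolyCat.IsSum F.obj (equiv X a) (equiv X b) (equiv X (a + b))
  mul : ∀ X (a b : M.obj X), PolyCat.IsProd F.obj (equiv X a) (equiv X b) (equiv X (a * b))
  res : ∀ {X Y : FinGSet G} (f : X →[G] Y) (y : M.obj Y),
    equiv X (M.res f y) = F.obj.map (PolyCat.R O f) (equiv Y y)
  tr : ∀ {X Y : FinGSet G} (f : X →[G] Y) (x : M.obj X),
    equiv Y (M.tr f x) = F.obj.map (PolyCat.T O f) (equiv X x)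
  norm : ∀ {H K : Subgroup G} (f : (orbit H : FinGSet G) →[G] orbit K) (hf : O.Mem f)
    (x : M.obj (orbit H)),
    equiv (orbit K) (M.norm f hf x) = F.obj.map (PolyCat.N f hf) (equiv (orbit H) x)

/-! ## Finite `G`-sets: coproducts, pullbacks, orbits -/

namespace FinGSet

section

variable {Γ : Type u} [Group Γ]

/-! Every polynomial is T ∘ N ∘ R, so a functor on polynomials amounts to restrictions, norms and
transfers subject to the relations that rewrite a composite of two such words as one word:
functoriality of each kind, base change of N and of T along R, and the exponential relation for N
after T. A composite may be computed from any diagram with the right universal property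
(`homMk_comp`), which gives all these relations by exhibiting the diagrams. Disjoint unions are the
products of the category, because a bispan into X ⊔ Y splits.

From Tambara to Green: transfers and norms along fold maps make each value a commutative monoid in
two ways. Both are treated at once by `SemiMackey`. The exponential diagram of p ⊔ q along a fold
map is a fibre product (`T_N_fold`), hence the product of two transfers is a transfer (`mul_tr_tr`);
Frobenius reciprocity and the ring axioms are special cases. Base change to orbits shows that every
norm obeys the product formula (`isNorm_map`). As elements are detected on orbits (`ext_orbit`), a
map that commutes with the norms between orbits commutes with all norms (`app_map_norm`), so the
functor is fully faithful.

From Green to Tambara: the norm along g : A → B is prescribed on each orbit G/L → B as a product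
over an orbit decomposition of the fibre product with A. The result does not depend on the
decomposition (`val_eq`), it is compatible with restriction by the double coset formula (`res_val`),
and compatible values glue by additivity (`exists_normExt`). Let polynomials act by T N R.
Functoriality of this action (`act_comp`) has one hard ingredient, `distributes`: N after T obeys
the exponential relation for every transfer p : E → A and norm g : A → B, whereas the axioms give it
only for g a map of orbits and p a fold map or a map of orbits.

Detection on orbits reduces `distributes` to B an orbit. If A is a disjoint union, g is a fold map
after a disjoint union of maps, and fold maps are handled by Frobenius reciprocity; so A may be an
orbit. Now induct on the size of the fibres of p. If E is an orbit, this is the transfer axiom. If E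
= E₁ ⊔ E₂ with both parts nonempty, p is the fold map after p₁ ⊔ p₂; the sum axiom deals with the
fold map and leaves a base change of p₁ ⊔ p₂, whose fibres are strictly smaller because p₁ and p₂
are onto the orbit. If E is empty, one needs N(0) = 0 (`normExt_zero`). This is not an axiom. It
follows from the sum axiom for 0 + 0: the two constant sections contribute N(0) each, the others
contribute 0 by induction on the fibres, and N(0) = N(0) + N(0) in a group forces N(0) = 0. -/

theorem hom_ext {X Y : FinGSet Γ} {f g : X →[Γ] Y} (h : ∀ x, f x = g x) : f = g :=
  MulActionHom.ext h

/-- The map out of a disjoint union given by two maps. -/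
def sumDesc {X Y Z : FinGSet Γ} (f : X →[Γ] Z) (g : Y →[Γ] Z) : X.sum Y →[Γ] Z where
  toFun := Sum.elim f g
  map_smul' := by
    rintro a (x | x)
    · exact map_smul f a x
    · exact map_smul g a x

/-- The disjoint union of two maps. -/
def sumMap {X Y X' Y' : FinGSet Γ} (f : X →[Γ] X') (g : Y →[Γ] Y') : X.sum Y →[Γ] X'.sum Y' :=
  sumDesc ((inl X' Y').comp f) ((inr X' Y').comp g)

/-- The maps `i` and `j` exhibit `Z` as the disjoint union of `X` and `Y`. -/
structure IsCoprod {X Y Z : FinGSet Γ} (i : X →[Γ] Z) (j : Y →[Γ] Z) : Prop where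
  inj_left : Function.Injective i
  inj_right : Function.Injective j
  disj : ∀ x y, i x ≠ j y
  cover : ∀ z, (∃ x, i x = z) ∨ ∃ y, j y = z

theorem isCoprod_sum (X Y : FinGSet Γ) : IsCoprod (inl X Y) (inr X Y) where
  inj_left := Sum.inl_injective
  inj_right := Sum.inr_injective
  disj _ _ := Sum.inl_ne_inr
  cover := by
    rintro (x | y)
    · exact Or.inl ⟨x, rfl⟩
    · exact Or.inr ⟨y, rfl⟩

theorem IsCoprod.bijective {X Y Z : FinGSet Γ} {i : X →[Γ] Z} {j : Y →[Γ] Z} (h : IsCoprod i j) :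
    Function.Bijective (sumDesc i j) := by
  refine ⟨?_, fun z => ?_⟩
  · rintro (x | x) (y | y) hxy
    · exact congrArg _ (h.inj_left hxy)
    · exact (h.disj _ _ hxy).elim
    · exact (h.disj _ _ hxy.symm).elim
    · exact congrArg _ (h.inj_right hxy)
  · rcases h.cover z with ⟨x, rfl⟩ | ⟨y, rfl⟩
    · exact ⟨Sum.inl x, rfl⟩
    · exact ⟨Sum.inr y, rfl⟩

/-- The sub-`Γ`-set of an invariant subset. -/
def sub {X : FinGSet Γ} (S : Set X) (hS : ∀ (a : Γ) x, x ∈ S → a • x ∈ S) : FinGSet Γ :=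
  @FinGSet.mk Γ _ S
    { smul := fun a x => ⟨a • x.1, hS a x.1 x.2⟩
      one_smul := fun x => Subtype.ext (one_smul Γ x.1)
      mul_smul := fun a b x => Subtype.ext (mul_smul a b x.1) } _

/-- The inclusion of an invariant subset. -/
def sub.incl {X : FinGSet Γ} (S : Set X) (hS : ∀ (a : Γ) x, x ∈ S → a • x ∈ S) :
    sub S hS →[Γ] X where
  toFun x := x.1
  map_smul' _ _ := rfl

/-- Splits an orbit off a set; most inductions below rest on this. The membership criterion is kept
so that cardinalities can be compared. -/
theorem isCoprod_compl {X : FinGSet Γ} {Y : FinGSet Γ} (i : Y →[Γ] X)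
    (hi : Function.Injective i) :
    ∃ (S : Set X) (hS : ∀ (a : Γ) x, x ∈ S → a • x ∈ S), IsCoprod i (sub.incl S hS) ∧
      ∀ x, x ∈ S ↔ ∀ y, i y ≠ x := by
  refine ⟨{x | ∀ y, i y ≠ x}, fun a x hx y hy => hx (a⁻¹ • y) ?_, ⟨hi, ?_, ?_, ?_⟩, fun _ => Iff.rfl⟩
  · rw [map_smul, hy, inv_smul_smul]
  · exact Subtype.val_injective
  · exact fun x y h => y.2 x h
  · intro z
    by_cases h : ∃ x, i x = z
    · exact Or.inl h
    · exact Or.inr ⟨⟨z, fun y hy => h ⟨y, hy⟩⟩, rfl⟩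

/-- A pointwise choice of preimages is unique, hence equivariant, because `i` is injective. -/
theorem exists_lift {X Y Z : FinGSet Γ} (i : X →[Γ] Z) (hi : Function.Injective i)
    (k : Y →[Γ] Z) (h : ∀ y, ∃ x, i x = k y) : ∃ m : Y →[Γ] X, ∀ y, i (m y) = k y := by
  choose m hm using h
  exact ⟨⟨m, fun a y => hi (by rw [hm, map_smul, map_smul, hm]; rfl)⟩, hm⟩

theorem exists_inverse {X Y : FinGSet Γ} (f : X →[Γ] Y) (hf : Function.Bijective f) :
    ∃ g : Y →[Γ] X, Function.Bijective g ∧ (∀ x, g (f x) = x) ∧ ∀ y, f (g y) = y := by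
  obtain ⟨g, hg⟩ := exists_lift f hf.1 (MulActionHom.id Γ : Y →[Γ] Y) fun y => hf.2 y
  have hg' : ∀ x, g (f x) = x := fun x => hf.1 (hg _)
  exact ⟨g, Function.bijective_iff_has_inverse.2 ⟨f, hg, hg'⟩, hg', hg⟩

/-! ### Pullback squares -/

theorem isPullbackSquare_pullback {X Y Z : FinGSet Γ} (f : X →[Γ] Z) (g : Y →[Γ] Z) :
    IsPullbackSquare (pullback.fst f g) (pullback.snd f g) f g :=
  ⟨fun p => p.2, fun x y h => ⟨⟨(x, y), h⟩, ⟨rfl, rfl⟩, fun _ hp =>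
    Subtype.ext (Prod.ext hp.1 hp.2)⟩⟩

/-- A set over a disjoint union is a disjoint union. -/
theorem isCoprod_pullback {X Y W : FinGSet Γ} (t : W →[Γ] X.sum Y) :
    IsCoprod (pullback.fst t (inl X Y)) (pullback.fst t (inr X Y)) := by
  refine ⟨?_, ?_, ?_, ?_⟩
  · intro x y h
    exact Subtype.ext (Prod.ext h (Sum.inl_injective
      (x.2.symm.trans ((congrArg t h).trans y.2))))
  · intro x y h
    exact Subtype.ext (Prod.ext h (Sum.inr_injective
      (x.2.symm.trans ((congrArg t h).trans y.2))))
  · intro x y h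
    exact Sum.inl_ne_inr (x.2.symm.trans ((congrArg t h).trans y.2))
  · intro z
    rcases h : t z with x | y
    · exact Or.inl ⟨⟨(z, x), h⟩, rfl⟩
    · exact Or.inr ⟨⟨(z, y), h⟩, rfl⟩

theorem IsPullbackSquare.symm {P X Y Z : FinGSet Γ} {k : P →[Γ] X} {h : P →[Γ] Y} {f : X →[Γ] Z}
    {g : Y →[Γ] Z} (H : IsPullbackSquare k h f g) : IsPullbackSquare h k g f :=
  ⟨fun p => (H.1 p).symm, fun y x e => by
    obtain ⟨p, hp, hu⟩ := H.2 x y e.symm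
    exact ⟨p, hp.symm, fun q hq => hu q hq.symm⟩⟩

theorem IsPullbackSquare.inj {P X Y Z : FinGSet Γ} {k : P →[Γ] X} {h : P →[Γ] Y} {f : X →[Γ] Z}
    {g : Y →[Γ] Z} (H : IsPullbackSquare k h f g) {p q : P} (h1 : k p = k q) (h2 : h p = h q) :
    p = q :=
  (H.2 (k q) (h q) (H.1 q)).unique ⟨h1, h2⟩ ⟨rfl, rfl⟩

theorem isPullbackSquare_of_injective {X Y : FinGSet Γ} (f : X →[Γ] Y)
    (hf : Function.Injective f) :
    IsPullbackSquare (MulActionHom.id Γ) (MulActionHom.id Γ) f f :=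
  ⟨fun _ => rfl, fun x _ h => ⟨x, ⟨rfl, hf h⟩, fun _ hp => hp.1⟩⟩

theorem isPullbackSquare_of_bijective {P X Y Z : FinGSet Γ} {k : P →[Γ] X} {h : P →[Γ] Y}
    {f : X →[Γ] Z} {g : Y →[Γ] Z} (hk : Function.Bijective k) (hg : Function.Injective g)
    (hc : ∀ p, f (k p) = g (h p)) : IsPullbackSquare k h f g := by
  refine ⟨hc, fun x y hxy => ?_⟩
  obtain ⟨p, rfl⟩ := hk.2 x
  exact ⟨p, ⟨rfl, hg ((hc p).symm.trans hxy)⟩, fun q hq => hk.1 hq.1⟩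

theorem isPullbackSquare_inl {X Y X' Y' : FinGSet Γ} (f : X →[Γ] X') (g : Y →[Γ] Y') :
    IsPullbackSquare f (inl X Y) (inl X' Y') (sumMap f g) := by
  refine ⟨fun _ => rfl, ?_⟩
  rintro x' (x | y) h
  · exact ⟨x, ⟨(Sum.inl_injective h).symm, rfl⟩, fun p hp => Sum.inl_injective hp.2⟩
  · exact (Sum.inl_ne_inr h).elim

theorem isPullbackSquare_inr {X Y X' Y' : FinGSet Γ} (f : X →[Γ] X') (g : Y →[Γ] Y') :
    IsPullbackSquare g (inr X Y) (inr X' Y') (sumMap f g) := by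
  refine ⟨fun _ => rfl, ?_⟩
  rintro y' (x | y) h
  · exact (Sum.inr_ne_inl h).elim
  · exact ⟨y, ⟨(Sum.inr_injective h).symm, rfl⟩, fun p hp => Sum.inr_injective hp.2⟩

theorem isPullbackSquare_fold {X Y : FinGSet Γ} (f : X →[Γ] Y) :
    IsPullbackSquare (fold X) (sumMap f f) f (fold Y) := by
  refine ⟨by rintro (x | x) <;> rfl, ?_⟩
  rintro x (y | y) h
  · obtain rfl : f x = y := h
    refine ⟨Sum.inl x, ⟨rfl, rfl⟩, ?_⟩
    rintro (p | p) ⟨h1, h2⟩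
    · exact congrArg Sum.inl h1
    · exact (Sum.inr_ne_inl h2).elim
  · obtain rfl : f x = y := h
    refine ⟨Sum.inr x, ⟨rfl, rfl⟩, ?_⟩
    rintro (p | p) ⟨h1, h2⟩
    · exact (Sum.inl_ne_inr h2).elim
    · exact congrArg Sum.inr h1

end

/-! ### Orbits, points and admissible maps -/

section

variable {G : Type u} [Group G] [Finite G]

/-- The coset of `1`. -/
def one (H : Subgroup G) : (orbit H : FinGSet G) := QuotientGroup.mk 1

theorem exists_smul_one {H : Subgroup G} (q : (orbit H : FinGSet G)) : ∃ a : G, q = a • one H := by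
  obtain ⟨a, rfl⟩ := QuotientGroup.mk_surjective q
  exact ⟨a, congrArg QuotientGroup.mk (mul_one a).symm⟩

theorem exists_smul_eq {H : Subgroup G} (q r : (orbit H : FinGSet G)) : ∃ a : G, r = a • q := by
  obtain ⟨a, rfl⟩ := exists_smul_one q
  obtain ⟨b, rfl⟩ := exists_smul_one r
  exact ⟨b * a⁻¹, by rw [smul_smul, inv_mul_cancel_right]⟩

theorem orbit_hom_ext {H : Subgroup G} {X : FinGSet G} {f g : (orbit H : FinGSet G) →[G] X}
    (h : f (one H) = g (one H)) : f = g := by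
  refine hom_ext fun q => ?_
  obtain ⟨a, rfl⟩ := exists_smul_one q
  rw [map_smul, map_smul, h]

theorem ofPoint_one {X : FinGSet G} (x : X) : ofPoint x (one _) = x :=
  one_smul G x

theorem ofPoint_injective {X : FinGSet G} (x : X) : Function.Injective (ofPoint x) :=
  MulAction.injective_ofQuotientStabilizer G x

theorem stabMap_one {A B : FinGSet G} (g : A →[G] B) {b : B} (a : {a : A // g a = b}) :
    stabMap g a (one _) = one _ := rfl

theorem ofPoint_stabMap {A B : FinGSet G} (g : A →[G] B) {b : B} (a : {a : A // g a = b}) :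
    (ofPoint b).comp (stabMap g a) = g.comp (ofPoint a.1) := by
  apply orbit_hom_ext
  change ofPoint b (one _) = g (ofPoint a.1 (one _))
  rw [ofPoint_one, ofPoint_one, a.2]

theorem ofPoint_orbit_bijective {H : Subgroup G} (q : (orbit H : FinGSet G)) :
    Function.Bijective (ofPoint q) := by
  refine ⟨ofPoint_injective q, fun r => ?_⟩
  obtain ⟨a, rfl⟩ := exists_smul_eq q r
  exact ⟨a • one _, by rw [map_smul, ofPoint_one]⟩

theorem surjective_of_orbit {H : Subgroup G} {X : FinGSet G} [Nonempty X]
    (f : X →[G] (orbit H : FinGSet G)) : Function.Surjective f := by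
  intro r
  obtain ⟨x⟩ := ‹Nonempty X›
  obtain ⟨a, ha⟩ := exists_smul_eq (f x) r
  exact ⟨a • x, by rw [map_smul, ha]⟩

instance (H : Subgroup G) : Nonempty (orbit H : FinGSet G).carrier := ⟨one H⟩

/-- Every map from an orbit factors through the inclusion of an orbit of the target. -/
theorem exists_factor_ofPoint {H : Subgroup G} {X : FinGSet G}
    (k : (orbit H : FinGSet G) →[G] X) (x : X) (hx : k (one H) ∈ MulAction.orbit G x) :
    ∃ m : (orbit H : FinGSet G) →[G] orbit (MulAction.stabilizer G x), k = (ofPoint x).comp m := by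
  obtain ⟨m, hm⟩ := exists_lift (ofPoint x) (ofPoint_injective x) k (by
    intro q
    obtain ⟨a, rfl⟩ := exists_smul_one q
    obtain ⟨c, hc⟩ := hx
    refine ⟨(a * c) • one _, ?_⟩
    rw [map_smul, map_smul, ofPoint_one, mul_smul, ← hc])
  exact ⟨m, hom_ext fun q => (hm q).symm⟩

/-- Membership only involves stabilizers, and an injective equivariant map preserves them. -/
theorem mem_of_coprod {O : IndexingSystem G} {X Y Z W : FinGSet G} {i : X →[G] Z} {j : Y →[G] Z}
    (h : IsCoprod i j) {f : Z →[G] W} (hi : O.Mem (f.comp i)) (hj : O.Mem (f.comp j)) :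
    O.Mem f := by
  have key : ∀ {X : FinGSet G} (i : X →[G] Z), Function.Injective i → O.Mem (f.comp i) →
      ∀ x, O.Adm (MulAction.stabilizer G (f (i x)))
    (orbit ((MulAction.stabilizer G (i x)).subgroupOf (MulAction.stabilizer G (f (i x))))) := by
    intro X i hi hm x
    have e : MulAction.stabilizer G (i x) = MulAction.stabilizer G x := by
      ext a
      rw [MulAction.mem_stabilizer_iff, MulAction.mem_stabilizer_iff, ← map_smul]
      exact hi.eq_iff
    rw [e]
    exact hm x
  intro z
  rcases h.cover z with ⟨x, rfl⟩ | ⟨x, rfl⟩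
  · exact key i h.inj_left hi x
  · exact key j h.inj_right hj x

theorem mem_sumDesc {O : IndexingSystem G} {X Y Z : FinGSet G} {f : X →[G] Z} {g : Y →[G] Z}
    (hf : O.Mem f) (hg : O.Mem g) : O.Mem (sumDesc f g) :=
  mem_of_coprod (isCoprod_sum X Y) hf hg

theorem mem_sumMap {O : IndexingSystem G} {X Y X' Y' : FinGSet G} {f : X →[G] X'} {g : Y →[G] Y'}
    (hf : O.Mem f) (hg : O.Mem g) : O.Mem (sumMap f g) :=
  mem_sumDesc
    (IndexingSystem.mem_comp (IndexingSystem.mem_of_injective (inl X' Y') Sum.inl_injective) hf)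
    (IndexingSystem.mem_comp (IndexingSystem.mem_of_injective (inr X' Y') Sum.inr_injective) hg)

theorem IsPullbackSquare.mem_left {O : IndexingSystem G} {P X Y Z : FinGSet G} {k : P →[G] X}
    {h : P →[G] Y} {f : X →[G] Z} {g : Y →[G] Z} (H : IsPullbackSquare k h f g) (hg : O.Mem g) :
    O.Mem k :=
  IndexingSystem.mem_of_square hg f k h (fun u => (H.1 u).symm) fun _ _ => H.inj

end

end FinGSet

/-- The indexing system in which every finite set is admissible. -/
def IndexingSystem.complete (G : Type u) [Group G] [Finite G] : IndexingSystem G where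
  Adm _ _ := True
  iso _ _ _ := True.intro
  sum _ _ := True.intro
  restrict _ _ _ _ := True.intro
  trivial _ := True.intro
  prod _ _ := True.intro
  equalizer _ _ _ _ := True.intro
  selfInd _ _ _ _ := True.intro

/-- Transfers exist along all maps, so their formal theory is the theory of norms for this indexing
system. -/
theorem IndexingSystem.mem_complete {G : Type u} [Group G] [Finite G] {X Y : FinGSet G}
    (f : X →[G] Y) : (IndexingSystem.complete G).Mem f := fun _ => True.intro

/-! ## Relations between restrictions, norms and transfers in the category of polynomials -/

namespace Bispan

variable {G : Type u} [Group G] [Finite G] {O : IndexingSystem G}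

/-- The bispan of a restriction. -/
abbrev ofR (O : IndexingSystem G) {X Y : FinGSet G} (f : X →[G] Y) : Bispan O Y X :=
  ⟨X, X, f, MulActionHom.id G, MulActionHom.id G, PolyCat.mem_id X⟩

/-- The bispan of a norm. -/
abbrev ofN {X Y : FinGSet G} (f : X →[G] Y) (hf : O.Mem f) : Bispan O X Y :=
  ⟨X, Y, MulActionHom.id G, f, MulActionHom.id G, hf⟩

/-- The bispan of a transfer. -/
abbrev ofT (O : IndexingSystem G) {X Y : FinGSet G} (f : X →[G] Y) : Bispan O X Y :=
  ⟨X, X, MulActionHom.id G, MulActionHom.id G, f, PolyCat.mem_id X⟩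

namespace CompData

variable {X Y Z : FinGSet G}

/-- Composition with a transfer. -/
def compT (P : Bispan O X Y) (f : Y →[G] Z) :
    CompData P (ofT O f) ⟨P.A, P.B, P.r, P.n, f.comp P.t, P.mem⟩ where
  β := P.t
  ε b _ _ := b
  ε_smul _ _ _ _ _ := rfl
  t_β _ := rfl
  t_ε _ _ h := h.symm
  unique_b d σ hσ := by
    refine ⟨σ d rfl, ⟨hσ d rfl, ?_⟩, fun b hb => hb.2 d hb.1.symm rfl⟩
    intro c h h'
    obtain rfl : c = d := h'
    rfl
  α := MulActionHom.id G
  κ := P.t.comp P.n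
  n_κ _ := rfl
  n_α _ := rfl
  r_α _ := rfl
  unique_a b c h a ha := by
    refine ⟨a, ⟨ha, ?_, rfl⟩, fun x hx => hx.2.2⟩
    change P.t (P.n a) = c
    rw [ha]
    exact h.symm

/-- Composition of a restriction with a bispan. -/
def Rcomp (f : Y →[G] X) (Q : Bispan O Y Z) :
    CompData (ofR O f) Q ⟨Q.A, Q.B, f.comp Q.r, Q.n, Q.t, Q.mem⟩ where
  β := MulActionHom.id G
  ε _ c _ := Q.r c
  ε_smul g _ c _ _ := map_smul Q.r g c
  t_β _ := rfl
  t_ε _ _ _ := rfl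
  unique_b d _ hσ := ⟨d, ⟨rfl, fun c _ h' => (hσ c h').symm⟩, fun _ h => h.1⟩
  α := Q.r
  κ := MulActionHom.id G
  n_κ _ := rfl
  n_α _ := rfl
  r_α _ := rfl
  unique_a _ c h _ ha := ⟨c, ⟨h, rfl, ha.symm⟩, fun _ hx => hx.2.1⟩

/-- Composition of a bispan without transfer and a norm. -/
def compN {A B : FinGSet G} (r : A →[G] X) (n : A →[G] B) (hn : O.Mem n) (g : B →[G] Z)
    (hg : O.Mem g) :
    CompData (⟨A, B, r, n, MulActionHom.id G, hn⟩ : Bispan O X B) (ofN g hg)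
      ⟨A, Z, r, g.comp n, MulActionHom.id G, IndexingSystem.mem_comp hg hn⟩ where
  β := MulActionHom.id G
  ε _ c _ := c
  ε_smul _ _ _ _ _ := rfl
  t_β _ := rfl
  t_ε _ _ _ := rfl
  unique_b d _ hσ := ⟨d, ⟨rfl, fun c _ h' => (hσ c h').symm⟩, fun _ h => h.1⟩
  α := MulActionHom.id G
  κ := n
  n_κ _ := rfl
  n_α _ := rfl
  r_α _ := rfl
  unique_a _ _ h a ha := by
    refine ⟨a, ⟨(congrArg g ha).trans h, ha, rfl⟩, fun x hx => hx.2.2⟩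

/-- Base change for norms. -/
def NR {P B : FinGSet G} {k : P →[G] X} {h : P →[G] Y} {f : X →[G] B} {g : Y →[G] B}
    (H : IsPullbackSquare k h f g) (hg : O.Mem g) :
    CompData (ofN g hg) (ofR O f) ⟨P, X, h, k, MulActionHom.id G, H.mem_left hg⟩ where
  β := MulActionHom.id G
  ε _ c _ := f c
  ε_smul a _ c _ _ := map_smul f a c
  t_β _ := rfl
  t_ε _ _ _ := rfl
  unique_b d _ hσ := ⟨d, ⟨rfl, fun c _ h' => (hσ c h').symm⟩, fun _ h => h.1⟩
  α := h
  κ := k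
  n_κ _ := rfl
  n_α x := (H.1 x).symm
  r_α _ := rfl
  unique_a b c hc a ha := by
    obtain ⟨p, ⟨h1, h2⟩, hu⟩ := H.2 c a ha.symm
    exact ⟨p, ⟨h1.trans hc, h1, h2⟩, fun q hq => hu q ⟨hq.2.1, hq.2.2⟩⟩

/-- Base change for transfers. -/
def TR {P B : FinGSet G} {k : P →[G] X} {h : P →[G] Y} {f : X →[G] B} {g : Y →[G] B}
    (H : IsPullbackSquare k h f g) :
    CompData (ofT O g) (ofR O f) ⟨P, P, h, MulActionHom.id G, k, PolyCat.mem_id P⟩ where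
  β := k
  ε b _ _ := h b
  ε_smul a b _ _ _ := map_smul h a b
  t_β _ := rfl
  t_ε b c hc := by
    have hc : c = k b := hc
    rw [hc]
    exact (H.1 b).symm
  unique_b d σ hσ := by
    obtain ⟨p, ⟨h1, h2⟩, hu⟩ := H.2 d (σ d rfl) (hσ d rfl).symm
    refine ⟨p, ⟨h1, fun c hc hc' => ?_⟩, fun q hq => hu q ⟨hq.1, hq.2 d hq.1.symm rfl⟩⟩
    obtain rfl : c = d := hc'
    exact h2
  α := h
  κ := k
  n_κ _ := rfl
  n_α _ := rfl
  r_α _ := rfl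
  unique_a b c hc a ha := ⟨b, ⟨rfl, hc.symm, ha.symm⟩, fun q hq => hq.1⟩

/-- The exponential diagram. -/
def TN (p : X →[G] Y) (g : Y →[G] Z) (hg : O.Mem g) :
    CompData (ofT O p) (ofN g hg)
      ⟨pullback g (depProd.base g p), depProd g p, depProd.eval g p,
        pullback.snd g (depProd.base g p), depProd.base g p, mem_pullback_snd hg _⟩ where
  β := depProd.base g p
  ε b c h := b.sec c h
  ε_smul a b c h h' := PiPt.smul_sec a b c h h'
  t_β _ := rfl
  t_ε b c h := b.p_sec c h
  unique_b d σ hσ := by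
    refine ⟨⟨d, σ, hσ⟩, ⟨rfl, fun _ _ _ => rfl⟩, ?_⟩
    rintro b ⟨hb, hb'⟩
    exact PiPt.ext' hb fun c hx hy => hb' c hx hy
  α := depProd.eval g p
  κ := pullback.fst g (depProd.base g p)
  n_κ x := x.2
  n_α _ := rfl
  r_α _ := rfl
  unique_a b c h a ha := by
    refine ⟨⟨(c, b), h⟩, ⟨rfl, rfl, ha.symm⟩, ?_⟩
    rintro x ⟨h1, h2, h3⟩
    exact Subtype.ext (Prod.ext h2 h1)

/-- The exponential diagram of a fold map. -/
def TNfold {X' : FinGSet G} (p : X →[G] Y) (q : X' →[G] Y) :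
    CompData (ofT O (sumMap p q)) (ofN (fold Y) (PolyCat.mem_fold Y))
      ⟨(pullback p q).sum (pullback p q), pullback p q,
        sumMap (pullback.fst p q) (pullback.snd p q), fold (pullback p q),
        p.comp (pullback.fst p q), PolyCat.mem_fold _⟩ where
  β := p.comp (pullback.fst p q)
  ε b c _ := Sum.elim (fun _ => Sum.inl b.1.1) (fun _ => Sum.inr b.1.2) c
  ε_smul a b c _ _ := by rcases c with c | c <;> rfl
  t_β _ := rfl
  t_ε b c h := by
    rcases c with c | c
    · exact congrArg Sum.inl h.symm
    · exact congrArg Sum.inr (b.2.symm.trans h.symm)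
  unique_b d σ hσ := by
    have h1 := hσ (Sum.inl d) rfl
    have h2 := hσ (Sum.inr d) rfl
    generalize e1 : σ (Sum.inl d) rfl = s1 at h1
    generalize e2 : σ (Sum.inr d) rfl = s2 at h2
    -- The section condition forces the value over the left copy of `d` into the left summand and
    -- the value over the right copy into the right one, so a section is a point of the fibre
    -- product.
    rcases s1 with s1 | s1
    swap
    · exact (Sum.inr_ne_inl h1).elim
    rcases s2 with s2 | s2
    · exact (Sum.inl_ne_inr h2).elim
    have h1 : p s1 = d := Sum.inl_injective h1
    have h2 : q s2 = d := Sum.inr_injective h2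
    refine ⟨⟨(s1, s2), h1.trans h2.symm⟩, ⟨h1, ?_⟩, ?_⟩
    · rintro (c | c) hc hc'
      · obtain rfl : c = d := hc'
        exact e1.symm
      · obtain rfl : c = d := hc'
        exact e2.symm
    · rintro b ⟨hb, hb'⟩
      refine Subtype.ext (Prod.ext ?_ ?_)
      · exact Sum.inl_injective ((hb' (Sum.inl d) hb.symm rfl).trans e1)
      · exact Sum.inr_injective ((hb' (Sum.inr d) hb.symm rfl).trans e2)
  α := sumMap (pullback.fst p q) (pullback.snd p q)
  κ := sumMap (p.comp (pullback.fst p q)) (p.comp (pullback.fst p q))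
  n_κ x := by rcases x with x | x <;> rfl
  n_α x := by rcases x with x | x <;> rfl
  r_α _ := rfl
  unique_a b c h a ha := by
    have ha : a = _ := ha
    subst ha
    rcases c with c | c
    · obtain rfl : c = p b.1.1 := h
      refine ⟨Sum.inl b, ⟨rfl, rfl, rfl⟩, ?_⟩
      rintro (x | x) ⟨h1, h2, h3⟩
      · exact congrArg Sum.inl h1
      · exact (Sum.inr_ne_inl h2).elim
    · obtain rfl : c = p b.1.1 := h
      refine ⟨Sum.inr b, ⟨rfl, rfl, rfl⟩, ?_⟩
      rintro (x | x) ⟨h1, h2, h3⟩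
      · exact (Sum.inl_ne_inr h2).elim
      · exact congrArg Sum.inr h1

end CompData

end Bispan

namespace PolyCat

variable {G : Type u} [Group G] [Finite G] {O : IndexingSystem G}

open Bispan

/-- Composites can be read off from any diagram with the universal property, so the canonical
dependent product need not be simplified. -/
theorem homMk_comp {X Y Z : FinGSet G} {P : Bispan O X Y} {Q : Bispan O Y Z} {S : Bispan O X Z}
    (D : CompData P Q S) : homMk P ≫ homMk Q = homMk S :=
  Quotient.sound ((compData P Q).iso D)

theorem homMk_eq {X Y : FinGSet G} (P : Bispan O X Y) :
    homMk P = R O P.r ≫ N P.n P.mem ≫ T O P.t := by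
  unfold R N T
  rw [homMk_comp (CompData.compT (ofN P.n P.mem) P.t)]
  exact (homMk_comp (CompData.Rcomp P.r
    (⟨P.A, P.B, MulActionHom.id G, P.n, P.t, P.mem⟩ : Bispan O P.A Y))).symm

theorem exists_eq {X Y : PolyCat O} (φ : X ⟶ Y) : ∃ P : Bispan O X.set Y.set, φ = homMk P :=
  ⟨Quotient.out φ, (Quotient.out_eq φ).symm⟩

variable (O) in
theorem R_id (X : FinGSet G) : R O (MulActionHom.id G : X →[G] X) = 𝟙 _ := rfl

variable (O) in
theorem T_id (X : FinGSet G) : T O (MulActionHom.id G : X →[G] X) = 𝟙 _ := rfl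

theorem N_id (X : FinGSet G) (h : O.Mem (MulActionHom.id G : X →[G] X)) :
    N (MulActionHom.id G : X →[G] X) h = 𝟙 _ := rfl

variable (O) in
theorem R_comp {X Y Z : FinGSet G} (g : Y →[G] Z) (f : X →[G] Y) :
    R O (g.comp f) = R O g ≫ R O f :=
  (homMk_comp (CompData.Rcomp g (ofR O f))).symm

variable (O) in
theorem T_comp {X Y Z : FinGSet G} (g : Y →[G] Z) (f : X →[G] Y) :
    T O (g.comp f) = T O f ≫ T O g :=
  (homMk_comp (CompData.compT (ofT O f) g)).symm

theorem N_comp {X Y Z : FinGSet G} (g : Y →[G] Z) (f : X →[G] Y) (hg : O.Mem g) (hf : O.Mem f) :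
    N (g.comp f) (IndexingSystem.mem_comp hg hf) = N f hf ≫ N g hg :=
  (homMk_comp (CompData.compN (MulActionHom.id G) f hf g hg)).symm

theorem N_R {P X Y Z : FinGSet G} {k : P →[G] X} {h : P →[G] Y} {f : X →[G] Z} {g : Y →[G] Z}
    (H : IsPullbackSquare k h f g) (hg : O.Mem g) :
    N g hg ≫ R O f = R O h ≫ N k (H.mem_left hg) := by
  unfold N R
  rw [homMk_comp (CompData.NR H hg)]
  exact (homMk_comp (CompData.Rcomp h (ofN k (H.mem_left hg)))).symm

variable (O) in
theorem T_R {P X Y Z : FinGSet G} {k : P →[G] X} {h : P →[G] Y} {f : X →[G] Z} {g : Y →[G] Z}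
    (H : IsPullbackSquare k h f g) : T O g ≫ R O f = R O h ≫ T O k := by
  unfold T R
  rw [homMk_comp (CompData.TR H)]
  exact (homMk_comp (CompData.Rcomp h (ofT O k))).symm

theorem T_N {X Y Z : FinGSet G} (p : X →[G] Y) (g : Y →[G] Z) (hg : O.Mem g) :
    T O p ≫ N g hg = R O (depProd.eval g p) ≫
      N (pullback.snd g (depProd.base g p)) (mem_pullback_snd hg _) ≫ T O (depProd.base g p) :=
  (homMk_comp (CompData.TN p g hg)).trans (homMk_eq _)

-- A section of p ⊔ q over the two copies of a point is a pair of points in the fibres of p and q.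
-- All distributivity in the ring structure comes from this identity.
variable (O) in
theorem T_N_fold {X X' Y : FinGSet G} (p : X →[G] Y) (q : X' →[G] Y) :
    T O (sumMap p q) ≫ N (fold Y) (mem_fold Y) =
      R O (sumMap (pullback.fst p q) (pullback.snd p q)) ≫ N (fold (pullback p q)) (mem_fold _) ≫
        T O (p.comp (pullback.fst p q)) :=
  (homMk_comp (CompData.TNfold p q)).trans (homMk_eq _)

/-! ### Products -/

/-- The pairing of two bispans. -/
def pairBispan {X Y Z : FinGSet G} (P : Bispan O Z X) (Q : Bispan O Z Y) :
    Bispan O Z (X.sum Y) where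
  A := P.A.sum Q.A
  B := P.B.sum Q.B
  r := sumDesc P.r Q.r
  n := sumMap P.n Q.n
  t := sumMap P.t Q.t
  mem := mem_sumMap P.mem Q.mem

theorem pairBispan_congr {X Y Z : FinGSet G} {P P' : Bispan O Z X} {Q Q' : Bispan O Z Y}
    (hP : P.Iso P') (hQ : Q.Iso Q') : (pairBispan P Q).Iso (pairBispan P' Q') := by
  obtain ⟨a, b, ha, hb, h1, h2, h3⟩ := hP
  obtain ⟨a', b', ha', hb', h1', h2', h3'⟩ := hQ
  refine ⟨sumMap a a', sumMap b b', ⟨Sum.map_injective.2 ⟨ha.1, ha'.1⟩,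
    Sum.map_surjective.2 ⟨ha.2, ha'.2⟩⟩, ⟨Sum.map_injective.2 ⟨hb.1, hb'.1⟩,
    Sum.map_surjective.2 ⟨hb.2, hb'.2⟩⟩, ?_, ?_, ?_⟩
  · rintro (x | x)
    · exact h1 x
    · exact h1' x
  · rintro (x | x)
    · exact congrArg Sum.inl (h2 x)
    · exact congrArg Sum.inr (h2' x)
  · rintro (x | x)
    · exact congrArg Sum.inl (h3 x)
    · exact congrArg Sum.inr (h3' x)

/-- The restriction of a bispan along a map to its target. -/
def restrBispan {X Y Z : FinGSet G} (P : Bispan O Z Y) (f : X →[G] Y) : Bispan O Z X where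
  A := pullback (P.t.comp P.n) f
  B := pullback P.t f
  r := P.r.comp (pullback.fst _ _)
  n :=
    { toFun := fun x => ⟨(P.n x.1.1, x.1.2), x.2⟩
      map_smul' := fun a x => Subtype.ext (Prod.ext (map_smul P.n a x.1.1) rfl) }
  t := pullback.snd _ _
  mem := IndexingSystem.mem_of_square P.mem (pullback.fst P.t f) _ (pullback.fst _ _)
    (fun _ => rfl) fun _ _ h h' => Subtype.ext (Prod.ext h' (congrArg (fun z => z.1.2) h))

/-- The restriction of a bispan is the composite with the restriction. -/
def compR {X Y Z : FinGSet G} (P : Bispan O Z Y) (f : X →[G] Y) :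
    CompData P (ofR O f) (restrBispan P f) where
  β := pullback.snd _ _
  ε b _ _ := b.1.1
  ε_smul _ _ _ _ _ := rfl
  t_β _ := rfl
  t_ε b c hc := by
    obtain rfl : c = b.1.2 := hc
    exact b.2
  unique_b d σ hσ := by
    refine ⟨⟨(σ d rfl, d), hσ d rfl⟩, ⟨rfl, fun c hc hc' => ?_⟩, fun b hb => ?_⟩
    · obtain rfl : c = d := hc'
      rfl
    · exact Subtype.ext (Prod.ext (hb.2 d hb.1.symm rfl) hb.1)
  α := pullback.fst _ _
  κ := pullback.snd _ _
  n_κ _ := rfl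
  n_α _ := rfl
  r_α _ := rfl
  unique_a b c hc a ha := by
    obtain rfl : c = b.1.2 := hc
    refine ⟨⟨(a, b.1.2), (congrArg P.t ha).trans b.2⟩,
      ⟨Subtype.ext (Prod.ext ha rfl), rfl, rfl⟩, fun x hx => Subtype.ext (Prod.ext hx.2.2 hx.2.1)⟩

theorem homMk_comp_R {X Y Z : FinGSet G} (P : Bispan O Z Y) (f : X →[G] Y) :
    homMk P ≫ R O f = homMk (restrBispan P f) :=
  homMk_comp (compR P f)

/-- Both sets of the bispan lie over X ⊔ Y and therefore split. This is the uniqueness half of the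
universal property of the product. -/
theorem pairBispan_restr {X Y Z : FinGSet G} (P : Bispan O Z (X.sum Y)) :
    (pairBispan (restrBispan P (inl X Y)) (restrBispan P (inr X Y))).Iso P := by
  refine ⟨sumDesc (pullback.fst _ _) (pullback.fst _ _),
    sumDesc (pullback.fst _ _) (pullback.fst _ _), (isCoprod_pullback _).bijective,
    (isCoprod_pullback _).bijective, ?_, ?_, ?_⟩
  · rintro (x | x) <;> rfl
  · rintro (x | x) <;> rfl
  · rintro (x | x)
    · exact x.2
    · exact x.2

theorem restr_pairBispan_left {X Y Z : FinGSet G} (P : Bispan O Z X) (Q : Bispan O Z Y) :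
    P.Iso (restrBispan (pairBispan P Q) (inl X Y)) := by
  refine ⟨⟨fun a => ⟨(Sum.inl a, P.t (P.n a)), rfl⟩, fun g a => Subtype.ext (Prod.ext rfl ?_)⟩,
    ⟨fun b => ⟨(Sum.inl b, P.t b), rfl⟩, fun g b => Subtype.ext (Prod.ext rfl ?_)⟩,
    ⟨?_, ?_⟩, ⟨?_, ?_⟩, fun _ => rfl, fun _ => rfl, fun _ => rfl⟩
  · exact (congrArg P.t (map_smul P.n g a)).trans (map_smul P.t g _)
  · exact map_smul P.t g b
  · exact fun x y h => Sum.inl_injective (congrArg (fun z => z.1.1) h)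
  · rintro ⟨⟨x | x, y⟩, h⟩
    · obtain rfl : P.t (P.n x) = y := Sum.inl_injective h
      exact ⟨x, rfl⟩
    · exact (Sum.inr_ne_inl h).elim
  · exact fun x y h => Sum.inl_injective (congrArg (fun z => z.1.1) h)
  · rintro ⟨⟨x | x, y⟩, h⟩
    · obtain rfl : P.t x = y := Sum.inl_injective h
      exact ⟨x, rfl⟩
    · exact (Sum.inr_ne_inl h).elim

theorem restr_pairBispan_right {X Y Z : FinGSet G} (P : Bispan O Z X) (Q : Bispan O Z Y) :
    Q.Iso (restrBispan (pairBispan P Q) (inr X Y)) := by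
  refine ⟨⟨fun a => ⟨(Sum.inr a, Q.t (Q.n a)), rfl⟩, fun g a => Subtype.ext (Prod.ext rfl ?_)⟩,
    ⟨fun b => ⟨(Sum.inr b, Q.t b), rfl⟩, fun g b => Subtype.ext (Prod.ext rfl ?_)⟩,
    ⟨?_, ?_⟩, ⟨?_, ?_⟩, fun _ => rfl, fun _ => rfl, fun _ => rfl⟩
  · exact (congrArg Q.t (map_smul Q.n g a)).trans (map_smul Q.t g _)
  · exact map_smul Q.t g b
  · exact fun x y h => Sum.inr_injective (congrArg (fun z => z.1.1) h)
  · rintro ⟨⟨x | x, y⟩, h⟩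
    · exact (Sum.inl_ne_inr h).elim
    · obtain rfl : Q.t (Q.n x) = y := Sum.inr_injective h
      exact ⟨x, rfl⟩
  · exact fun x y h => Sum.inr_injective (congrArg (fun z => z.1.1) h)
  · rintro ⟨⟨x | x, y⟩, h⟩
    · exact (Sum.inl_ne_inr h).elim
    · obtain rfl : Q.t x = y := Sum.inr_injective h
      exact ⟨x, rfl⟩

/-- The disjoint union is the product in the category of polynomials. -/
noncomputable def isLimitSum (X Y : FinGSet G) :
    Limits.IsLimit (Limits.BinaryFan.mk (R O (inl X Y)) (R O (inr X Y))) := by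
  refine Limits.BinaryFan.IsLimit.mk _
    (fun f g => homMk (pairBispan (Quotient.out f) (Quotient.out g))) ?_ ?_ ?_
  · intro Z f g
    refine (homMk_comp_R _ _).trans ((Quotient.sound ?_).trans (Quotient.out_eq f))
    exact iso_symm (restr_pairBispan_left _ _)
  · intro Z f g
    refine (homMk_comp_R _ _).trans ((Quotient.sound ?_).trans (Quotient.out_eq g))
    exact iso_symm (restr_pairBispan_right _ _)
  · intro Z f g m h1 h2
    obtain ⟨P, rfl⟩ := exists_eq m
    have h1 := (homMk_comp_R P _).symm.trans h1
    have h2 := (homMk_comp_R P _).symm.trans h2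
    refine Quotient.sound (iso_trans (iso_symm (pairBispan_restr P)) (pairBispan_congr ?_ ?_))
    · exact Quotient.exact (h1.trans (Quotient.out_eq f).symm)
    · exact Quotient.exact (h2.trans (Quotient.out_eq g).symm)

/-- The empty set is terminal in the category of polynomials. -/
def isTerminalEmpty : Limits.IsTerminal (⟨empty⟩ : PolyCat O) := by
  refine Limits.IsTerminal.ofUniqueHom (fun X => homMk ⟨empty, empty, fromEmpty _,
    MulActionHom.id G, MulActionHom.id G, PolyCat.mem_id _⟩) fun X m => ?_
  obtain ⟨P, rfl⟩ := exists_eq m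
  refine Quotient.sound (iso_symm ⟨fromEmpty _, fromEmpty _, ⟨fun x => PEmpty.elim x, fun a => ?_⟩,
    ⟨fun x => PEmpty.elim x, fun b => ?_⟩, fun x => PEmpty.elim x, fun x => PEmpty.elim x,
    fun x => PEmpty.elim x⟩)
  · exact PEmpty.elim (P.t (P.n a))
  · exact PEmpty.elim (P.t b)

end PolyCat

/-! ## Additive systems with restrictions and covariant operations -/

/-- Sets `obj X` with restrictions along all maps and covariant operations along the maps in
`Set_O^G`, satisfying base change and additivity. -/
structure SemiMackey {G : Type u} [Group G] [Finite G] (O : IndexingSystem G) where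
  obj : FinGSet G → Type w
  res : ∀ {X Y : FinGSet G}, (X →[G] Y) → obj Y → obj X
  push : ∀ {X Y : FinGSet G} (f : X →[G] Y), O.Mem f → obj X → obj Y
  res_id : ∀ {X : FinGSet G} (x : obj X), res (MulActionHom.id G) x = x
  res_comp : ∀ {X Y Z : FinGSet G} (g : Y →[G] Z) (f : X →[G] Y) (z : obj Z),
    res (g.comp f) z = res f (res g z)
  push_id : ∀ {X : FinGSet G} (x : obj X), push (MulActionHom.id G) (PolyCat.mem_id X) x = x
  push_comp : ∀ {X Y Z : FinGSet G} (g : Y →[G] Z) (f : X →[G] Y) (hg : O.Mem g) (hf : O.Mem f)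
    (x : obj X), push (g.comp f) (IndexingSystem.mem_comp hg hf) x = push g hg (push f hf x)
  res_push : ∀ {P X Y Z : FinGSet G} {k : P →[G] X} {h : P →[G] Y} {f : X →[G] Z} {g : Y →[G] Z}
    (H : IsPullbackSquare k h f g) (hg : O.Mem g) (y : obj Y),
    res f (push g hg y) = push k (H.mem_left hg) (res h y)
  additive : ∀ X Y : FinGSet G,
    Function.Bijective fun c : obj (X.sum Y) => (res (inl X Y) c, res (inr X Y) c)
  pt : obj empty
  eq_pt : ∀ x : obj empty, x = pt

namespace FinGSet

/-- The maps `j i` exhibit `A` as the disjoint union of the `X i`. -/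
structure IsCover {G : Type u} [Group G] {ι : Type*} {A : FinGSet G} {X : ι → FinGSet G}
    (j : ∀ i, X i →[G] A) : Prop where
  inj : ∀ i, Function.Injective (j i)
  disj : ∀ i i' x y, j i x = j i' y → i = i'
  cover : ∀ a, ∃ i x, j i x = a

end FinGSet

namespace SemiMackey

variable {G : Type u} [Group G] [Finite G] {O : IndexingSystem G} (M : SemiMackey.{u, w} O)

variable {M}

theorem push_congr {X Y : FinGSet G} {f f' : X →[G] Y} (h : f = f') (hf : O.Mem f)
    (hf' : O.Mem f') (x : M.obj X) : M.push f hf x = M.push f' hf' x := by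
  subst h
  rfl

/-- For injective `f` the square with two identities is a pullback, so base change makes `res f` a
left inverse of `push f`; the inverse map makes it two-sided. -/
theorem push_res_of_bijective {X Y : FinGSet G} {f : X →[G] Y} (h : Function.Bijective f)
    (hf : O.Mem f) (y : M.obj Y) : M.push f hf (M.res f y) = y := by
  have key : ∀ x, M.res f (M.push f hf x) = x := fun x => by
    rw [M.res_push (isPullbackSquare_of_injective f h.1) hf, M.push_id, M.res_id]
  obtain ⟨g, -, -, hg⟩ := exists_inverse f h
  have hfg : f.comp g = MulActionHom.id G := hom_ext hg
  have := congrArg (M.res g) (key (M.res f y))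
  rwa [← M.res_comp, ← M.res_comp, hfg, M.res_id, M.res_id] at this

theorem ext_sum {X Y : FinGSet G} {c c' : M.obj (X.sum Y)}
    (h1 : M.res (inl X Y) c = M.res (inl X Y) c') (h2 : M.res (inr X Y) c = M.res (inr X Y) c') :
    c = c' :=
  (M.additive X Y).1 (Prod.ext h1 h2)

variable (M) in
theorem exists_pair {X Y : FinGSet G} (a : M.obj X) (b : M.obj Y) :
    ∃ c : M.obj (X.sum Y), M.res (inl X Y) c = a ∧ M.res (inr X Y) c = b := by
  obtain ⟨c, hc⟩ := (M.additive X Y).2 (a, b)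
  exact ⟨c, congrArg Prod.fst hc, congrArg Prod.snd hc⟩

/-- The element of `M(X ⊔ Y)` with given components. -/
noncomputable def pair {X Y : FinGSet G} (a : M.obj X) (b : M.obj Y) : M.obj (X.sum Y) :=
  (M.exists_pair a b).choose

theorem res_inl_pair {X Y : FinGSet G} (a : M.obj X) (b : M.obj Y) :
    M.res (inl X Y) (pair a b) = a := (M.exists_pair a b).choose_spec.1

theorem res_inr_pair {X Y : FinGSet G} (a : M.obj X) (b : M.obj Y) :
    M.res (inr X Y) (pair a b) = b := (M.exists_pair a b).choose_spec.2

theorem pair_eq {X Y : FinGSet G} (c : M.obj (X.sum Y)) :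
    pair (M.res (inl X Y) c) (M.res (inr X Y) c) = c :=
  ext_sum (res_inl_pair _ _) (res_inr_pair _ _)

/-- The operation on `M(X)` given by the fold map. -/
noncomputable def op {X : FinGSet G} (a b : M.obj X) : M.obj X :=
  M.push (fold X) (PolyCat.mem_fold X) (pair a b)

variable (M) in
/-- The neutral element. -/
noncomputable def unit (X : FinGSet G) : M.obj X :=
  M.push (fromEmpty X) (PolyCat.mem_fromEmpty X) M.pt

theorem push_sumMap {X Y X' Y' : FinGSet G} (f : X →[G] X') (g : Y →[G] Y') (hf : O.Mem f)
    (hg : O.Mem g) (w : M.obj (X.sum Y)) :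
    M.push (sumMap f g) (mem_sumMap hf hg) w =
      pair (M.push f hf (M.res (inl X Y) w)) (M.push g hg (M.res (inr X Y) w)) := by
  refine ext_sum ?_ ?_
  · rw [res_inl_pair, M.res_push (isPullbackSquare_inl f g)]
  · rw [res_inr_pair, M.res_push (isPullbackSquare_inr f g)]

theorem mem_comp_injective {X Y Z : FinGSet G} {f : Y →[G] Z} {i : X →[G] Y} (hf : O.Mem f)
    (hi : Function.Injective i) : O.Mem (f.comp i) :=
  IndexingSystem.mem_comp hf (IndexingSystem.mem_of_injective i hi)

/-- Up to the isomorphism X ⊔ Y → Z, the map `f` is the fold map after the disjoint union of its two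
restrictions. -/
theorem push_coprod {X Y Z W : FinGSet G} {i : X →[G] Z} {j : Y →[G] Z} (h : IsCoprod i j)
    (f : Z →[G] W) (hf : O.Mem f) (z : M.obj Z) :
    M.push f hf z = op (M.push (f.comp i) (mem_comp_injective hf h.inj_left) (M.res i z))
      (M.push (f.comp j) (mem_comp_injective hf h.inj_right) (M.res j z)) := by
  have hs : O.Mem (sumDesc i j) := IndexingSystem.mem_of_injective _ h.bijective.1
  have e : f.comp (sumDesc i j) = (fold W).comp (sumMap (f.comp i) (f.comp j)) :=
    hom_ext (by rintro (x | x) <;> rfl)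
  have hm := mem_sumMap (mem_comp_injective hf h.inj_left) (mem_comp_injective hf h.inj_right)
  conv_lhs => rw [← push_res_of_bijective h.bijective hs z, ← M.push_comp]
  rw [push_congr e _ (IndexingSystem.mem_comp (PolyCat.mem_fold W) hm),
    M.push_comp _ _ (PolyCat.mem_fold W) hm, push_sumMap, ← M.res_comp, ← M.res_comp]
  rfl

theorem op_eq {X : FinGSet G} (c : M.obj (X.sum X)) :
    M.push (fold X) (PolyCat.mem_fold X) c = op (M.res (inl X X) c) (M.res (inr X X) c) := by
  rw [op, pair_eq]

theorem op_comm {X : FinGSet G} (a b : M.obj X) : op a b = op b a := by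
  have h : IsCoprod (inr X X) (inl X X) :=
    ⟨Sum.inr_injective, Sum.inl_injective, fun _ _ => Sum.inr_ne_inl,
      fun z => ((isCoprod_sum X X).cover z).symm⟩
  conv_lhs => rw [op, push_coprod h]
  rw [res_inl_pair, res_inr_pair]
  exact congrArg₂ op (M.push_id b) (M.push_id a)

/-- X ⊔ ∅ → X is an isomorphism; splitting the operation along it gives the unit law. -/
theorem op_unit {X : FinGSet G} (a : M.obj X) : op a (M.unit X) = a := by
  have hb : Function.Bijective (sumDesc (MulActionHom.id G : X →[G] X) (fromEmpty X)) :=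
    IsCoprod.bijective ⟨fun _ _ h => h, fun x => PEmpty.elim x, fun _ y => PEmpty.elim y,
      fun z => Or.inl ⟨z, rfl⟩⟩
  have hm : O.Mem (sumDesc (MulActionHom.id G : X →[G] X) (fromEmpty X)) :=
    IndexingSystem.mem_of_injective _ hb.1
  have := push_res_of_bijective hb hm a
  rw [push_coprod (isCoprod_sum X empty), ← M.res_comp] at this
  refine Eq.trans (congrArg₂ op ?_ ?_) this
  · exact ((M.push_id _).trans (M.res_id a)).symm
  · exact congrArg _ (M.eq_pt _).symm

/-- The operation along X ⊔ X ⊔ X → X is split in two ways: as (first two) ⊔ last and as first ⊔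
(last two). -/
theorem op_assoc {X : FinGSet G} (a b c : M.obj X) : op (op a b) c = op a (op b c) := by
  let f : (X.sum X).sum X →[G] X := sumDesc (fold X) (MulActionHom.id G)
  have hf : O.Mem f := mem_sumDesc (PolyCat.mem_fold X) (PolyCat.mem_id X)
  let z : M.obj ((X.sum X).sum X) := pair (pair a b) c
  have h : IsCoprod ((inl (X.sum X) X).comp (inl X X)) (sumMap (inr X X) (MulActionHom.id G)) := by
    refine ⟨fun x y h => Sum.inl_injective (Sum.inl_injective h), ?_, ?_, ?_⟩
    · rintro (x | x) (y | y) h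
      · exact congrArg Sum.inl (Sum.inr_injective (Sum.inl_injective h))
      · exact (Sum.inl_ne_inr h).elim
      · exact (Sum.inr_ne_inl h).elim
      · exact congrArg Sum.inr (Sum.inr_injective h)
    · rintro x (y | y) h
      · exact (Sum.inl_ne_inr (Sum.inl_injective h)).elim
      · exact (Sum.inl_ne_inr h).elim
    · rintro ((x | x) | x)
      · exact Or.inl ⟨x, rfl⟩
      · exact Or.inr ⟨Sum.inl x, rfl⟩
      · exact Or.inr ⟨Sum.inr x, rfl⟩
  have e1 := push_coprod (isCoprod_sum (X.sum X) X) f hf z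
  have e2 := push_coprod h f hf z
  have ef : f.comp (sumMap (inr X X) (MulActionHom.id G)) = fold X :=
    hom_ext (by rintro (x | x) <;> rfl)
  have ez : M.res (sumMap (inr X X) (MulActionHom.id G)) z = pair b c := by
    refine ext_sum ?_ ?_
    · rw [← M.res_comp, res_inl_pair]
      change M.res ((inl (X.sum X) X).comp (inr X X)) z = b
      rw [M.res_comp, res_inl_pair, res_inr_pair]
    · rw [← M.res_comp, res_inr_pair]
      exact res_inr_pair _ _
  rw [res_inl_pair, res_inr_pair] at e1
  rw [push_congr ef _ (PolyCat.mem_fold X), ez, M.res_comp, res_inl_pair, res_inl_pair] at e2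
  refine Eq.trans (congrArg₂ op rfl ?_) (e1.symm.trans (e2.trans (congrArg₂ op ?_ rfl)))
  · exact (M.push_id c).symm
  · exact M.push_id a

theorem res_op {X Y : FinGSet G} (f : X →[G] Y) (a b : M.obj Y) :
    M.res f (op a b) = op (M.res f a) (M.res f b) := by
  rw [op, M.res_push (isPullbackSquare_fold f), op_eq, ← M.res_comp, ← M.res_comp]
  change op (M.res ((inl Y Y).comp f) _) (M.res ((inr Y Y).comp f) _) = _
  rw [M.res_comp, M.res_comp, res_inl_pair, res_inr_pair]

theorem push_op {X Y : FinGSet G} (f : X →[G] Y) (hf : O.Mem f) (a b : M.obj X) :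
    M.push f hf (op a b) = op (M.push f hf a) (M.push f hf b) := by
  rw [op, ← M.push_comp, push_coprod (isCoprod_sum X X), res_inl_pair, res_inr_pair]
  rfl

theorem res_unit {X Y : FinGSet G} (f : X →[G] Y) : M.res f (M.unit Y) = M.unit X := by
  have H : IsPullbackSquare (fromEmpty X) (MulActionHom.id G) f (fromEmpty Y) :=
    ⟨fun p => PEmpty.elim p, fun _ y => PEmpty.elim y⟩
  rw [unit, M.res_push H, M.res_id]
  rfl

theorem push_unit {X Y : FinGSet G} (f : X →[G] Y) (hf : O.Mem f) :
    M.push f hf (M.unit X) = M.unit Y := by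
  rw [unit, ← M.push_comp]
  exact push_congr (hom_ext fun x => PEmpty.elim x) _ _ _

noncomputable instance commMonoid (X : FinGSet G) : CommMonoid (M.obj X) where
  mul := op
  mul_assoc := op_assoc
  one := M.unit X
  one_mul a := (op_comm _ _).trans (op_unit a)
  mul_one := op_unit
  mul_comm := op_comm

/-- The operation along `f` is a product over a decomposition of the source. -/
theorem push_eq_prod {ι : Type*} [Fintype ι] {A B : FinGSet G} {X : ι → FinGSet G}
    {j : ∀ i, X i →[G] A} (hj : IsCover j) (f : A →[G] B) (hf : O.Mem f) (z : M.obj A) :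
    M.push f hf z =
      ∏ i, M.push (f.comp (j i)) (mem_comp_injective hf (hj.inj i)) (M.res (j i) z) := by
  classical
  -- Partial unions are represented by any injective `k` whose image is the union of the pieces in
  -- `s`, so no union has to be constructed.
  have key : ∀ (s : Finset ι) (Z : FinGSet G) (k : Z →[G] A) (hk : Function.Injective k),
      (∀ a, (∃ z, k z = a) ↔ ∃ i ∈ s, ∃ x, j i x = a) →
      M.push (f.comp k) (mem_comp_injective hf hk) (M.res k z) =
        ∏ i ∈ s, M.push (f.comp (j i)) (mem_comp_injective hf (hj.inj i)) (M.res (j i) z) := by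
    intro s
    induction s using Finset.induction with
    | empty =>
      intro Z k hk hZ
      have hZ : ∀ z : Z, False := fun z => by
        obtain ⟨i, hi, -⟩ := (hZ (k z)).1 ⟨z, rfl⟩
        simp at hi
      have hb : Function.Bijective (fromEmpty Z) :=
        ⟨fun x => PEmpty.elim x, fun z => (hZ z).elim⟩
      rw [Finset.prod_empty, ← push_res_of_bijective hb (PolyCat.mem_fromEmpty Z) (M.res k z),
        M.eq_pt (M.res (fromEmpty Z) _)]
      exact push_unit _ _
    | insert i s his ih =>
      intro Z k hk hZ
      obtain ⟨m, hm⟩ := exists_lift k hk (j i) fun x =>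
        (hZ (j i x)).2 ⟨i, Finset.mem_insert_self i s, x, rfl⟩
      have hm' : k.comp m = j i := hom_ext hm
      have hmi : Function.Injective m := fun x y h => hj.inj i (by rw [← hm, ← hm, h])
      -- Remove the piece `i` from `Z`; by disjointness the complement is covered by the pieces in
      -- the smaller `s`.
      obtain ⟨S, hS, hc, hmem⟩ := isCoprod_compl m hmi
      have := ih (sub S hS) (k.comp (sub.incl S hS)) (hk.comp Subtype.val_injective) (by
        intro a
        constructor
        · rintro ⟨z, hz⟩
          obtain ⟨i', hi', x, hx⟩ := (hZ a).1 ⟨z.1, hz⟩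
          rcases Finset.mem_insert.1 hi' with rfl | h
          · refine ((hmem z.1).1 z.2 x (hk ?_)).elim
            rw [hm, hx]
            exact hz.symm
          · exact ⟨i', h, x, hx⟩
        · rintro ⟨i', hi', x, hx⟩
          obtain ⟨z, hz⟩ := (hZ a).2 ⟨i', Finset.mem_insert_of_mem hi', x, hx⟩
          refine ⟨⟨z, (hmem z).2 fun y hy => his ?_⟩, hz⟩
          rw [hj.disj i i' y x (by rw [← hm, hy, hz, hx])]
          exact hi')
      rw [Finset.prod_insert his, ← this, push_coprod hc]
      refine congrArg₂ op ?_ ?_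
      · rw [← M.res_comp]
        refine (congrArg _ (congrArg (fun t => M.res t z) hm')).trans ?_
        exact push_congr (f := (f.comp k).comp m) (hom_ext fun x => congrArg f (hm x)) _ _ _
      · rw [← M.res_comp]
        rfl
  have := key Finset.univ A (MulActionHom.id G) (fun _ _ h => h) (fun a => by
    simpa using hj.cover a)
  rw [← this, M.res_id]
  rfl

end SemiMackey

/-! ### Orbit decomposition over the orbit of a point -/

namespace FinGSet

variable {G : Type u} [Group G] [Finite G]

/-- The inclusion of `G/G_a` in the part of `g : A → B` over the orbit of `b = g(a)`. -/
def fiberMap {A B : FinGSet G} (g : A →[G] B) {b : B} (a : {a : A // g a = b}) :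
    orbit (MulAction.stabilizer G a.1) →[G] pullback (ofPoint b) g where
  toFun q := ⟨(stabMap g a q, ofPoint a.1 q), DFunLike.congr_fun (ofPoint_stabMap g a) q⟩
  map_smul' x q := Subtype.ext (Prod.ext (map_smul (stabMap g a) x q)
    (map_smul (ofPoint a.1) x q))

/-- A point of the fibre product can be translated into the fibre over `b`. Thus the orbits of the
fibre product correspond to the orbits that meet this fibre, and each is a copy of the orbit of its
representative. -/
theorem isCover_fiberMap {A B : FinGSet G} (g : A →[G] B) {b : B} {s : Finset {a : A // g a = b}}
    (hs : ∀ a : {a : A // g a = b}, ∃! a', a' ∈ s ∧ a'.1 ∈ MulAction.orbit G a.1) :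
    IsCover fun a : s => fiberMap g a.1 where
  inj a x y h := ofPoint_injective _ (congrArg (fun z => z.1.2) h)
  disj a a' x y h := by
    have h : ofPoint a.1.1 x = ofPoint a'.1.1 y := congrArg (fun z => z.1.2) h
    obtain ⟨c, rfl⟩ := exists_smul_one x
    obtain ⟨d, rfl⟩ := exists_smul_one y
    rw [map_smul, map_smul, ofPoint_one, ofPoint_one] at h
    refine Subtype.ext ((hs a.1).unique ⟨a.2, MulAction.mem_orbit_self _⟩ ⟨a'.2, ?_⟩)
    exact ⟨d⁻¹ * c, by simp only [mul_smul, h, inv_smul_smul]⟩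
  cover := by
    rintro ⟨⟨q, a⟩, h⟩
    obtain ⟨c, rfl⟩ := exists_smul_one q
    have h : ofPoint b (c • one _) = g a := h
    rw [map_smul, ofPoint_one] at h
    obtain ⟨a', ⟨ha', d, hd⟩, -⟩ := hs ⟨c⁻¹ • a, by rw [map_smul, ← h, inv_smul_smul]⟩
    have hd : d • c⁻¹ • a = a'.1 := hd
    have hdb : d • b = b := by
      have := a'.2
      rwa [← hd, map_smul, map_smul, ← h, inv_smul_smul] at this
    refine ⟨⟨a', ha'⟩, (c * d⁻¹) • one _, Subtype.ext (Prod.ext ?_ ?_)⟩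
    · change stabMap g a' _ = _
      apply ofPoint_injective b
      rw [map_smul, map_smul, map_smul, stabMap_one, ofPoint_one, mul_smul]
      congr 1
      rw [inv_smul_eq_iff, hdb]
    · change ofPoint a'.1 _ = a
      rw [map_smul, ofPoint_one, ← hd, mul_smul, inv_smul_smul, smul_inv_smul]

end FinGSet

/-! ## The Green functor with norms underlying an `O`-Tambara functor -/

namespace PolyCat

variable {G : Type u} [Group G] [Finite G] {O : IndexingSystem G}

/-- Testing the universal property on maps from a point gives bijectivity; conversely the inverse
bijection defines the pairing. -/
theorem nonempty_isLimit_binaryFan {P A B : Type w} (f : P ⟶ A) (g : P ⟶ B) :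
    Nonempty (Limits.IsLimit (Limits.BinaryFan.mk f g)) ↔
      Function.Bijective fun c : P => (f c, g c) := by
  constructor
  · rintro ⟨h⟩
    constructor
    · intro c c' hc
      have hc1 : f c = f c' := congrArg Prod.fst hc
      have hc2 : g c = g c' := congrArg Prod.snd hc
      have : (TypeCat.ofHom fun _ : PUnit.{w + 1} => c) = TypeCat.ofHom fun _ => c' := by
        refine Limits.BinaryFan.IsLimit.hom_ext h ?_ ?_
        · ext
          exact hc1
        · ext
          exact hc2
      exact ConcreteCategory.congr_hom this PUnit.unit
    · rintro ⟨a, b⟩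
      obtain ⟨l, h1, h2⟩ := Limits.BinaryFan.IsLimit.lift' h
        (TypeCat.ofHom fun _ : PUnit.{w + 1} => a) (TypeCat.ofHom fun _ => b)
      exact ⟨l PUnit.unit, Prod.ext (ConcreteCategory.congr_hom h1 PUnit.unit)
        (ConcreteCategory.congr_hom h2 PUnit.unit)⟩
  · intro h
    choose l hl using h.2
    refine ⟨Limits.BinaryFan.IsLimit.mk _ (fun a b => TypeCat.ofHom fun t => l (a t, b t))
      (fun a b => ?_) (fun a b => ?_) fun a b m hm1 hm2 => ?_⟩
    · ext t
      exact congrArg Prod.fst (hl (a t, b t))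
    · ext t
      exact congrArg Prod.snd (hl (a t, b t))
    · ext t
      refine h.1 ((Prod.ext ?_ ?_ : _ = (a t, b t)).trans (hl (a t, b t)).symm)
      · exact ConcreteCategory.congr_hom hm1 t
      · exact ConcreteCategory.congr_hom hm2 t

theorem bijective_of_preservesFiniteProducts (F : PolyCat O ⥤ Type w)
    [Limits.PreservesFiniteProducts F] (X Y : FinGSet G) :
    Function.Bijective fun c : F.obj ⟨X.sum Y⟩ =>
      (F.map (R O (inl X Y)) c, F.map (R O (inr X Y)) c) :=
  (nonempty_isLimit_binaryFan _ _).1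
    ⟨Limits.mapIsLimitOfPreservesOfIsLimit F _ _ (isLimitSum X Y)⟩

theorem unique_of_preservesFiniteProducts (F : PolyCat O ⥤ Type w)
    [Limits.PreservesFiniteProducts F] : Nonempty (Unique (F.obj ⟨empty⟩)) :=
  ⟨Limits.Types.isTerminalEquivUnique _
    (Limits.IsTerminal.isTerminalObj F _ isTerminalEmpty)⟩

theorem preservesFiniteProducts_of_bijective (F : PolyCat O ⥤ Type w)
    (h : ∀ X Y : FinGSet G, Function.Bijective fun c : F.obj ⟨X.sum Y⟩ =>
      (F.map (R O (inl X Y)) c, F.map (R O (inr X Y)) c))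
    (h' : Unique (F.obj ⟨empty⟩)) : Limits.PreservesFiniteProducts F := by
  have h1 : ∀ X Y : PolyCat O, Limits.PreservesLimit (Limits.pair X Y) F := by
    intro X Y
    refine Limits.preservesLimit_of_preserves_limit_cone (isLimitSum X.set Y.set) ?_
    exact (Limits.isLimitMapConeBinaryFanEquiv F _ _).symm
      ((nonempty_isLimit_binaryFan _ _).2 (h X.set Y.set)).some
  have h2 : Limits.PreservesLimitsOfShape (Discrete Limits.WalkingPair) F :=
    ⟨fun {K} => Limits.preservesLimit_of_iso_diagram F (Limits.diagramIsoPair K).symm⟩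
  have h3 : Limits.PreservesLimit (Functor.empty.{0} (PolyCat O)) F := by
    refine Limits.preservesLimit_of_preserves_limit_cone isTerminalEmpty ?_
    exact (Limits.isLimitMapConeEmptyConeEquiv F _).symm
      ((Limits.Types.isTerminalEquivUnique _).symm h')
  have h4 := Limits.preservesLimitsOfShape_pempty_of_preservesTerminal F
  have h5 : Limits.HasBinaryProducts (PolyCat O) := by
    have : ∀ {X Y : PolyCat O}, Limits.HasLimit (Limits.pair X Y) :=
      fun {X Y} => ⟨⟨⟨_, isLimitSum X.set Y.set⟩⟩⟩
    exact Limits.hasBinaryProducts_of_hasLimit_pair _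
  have h6 : Limits.HasTerminal (PolyCat O) := isTerminalEmpty.hasTerminal
  have h7 := hasFiniteProducts_of_has_binary_and_terminal (C := PolyCat O)
  exact Limits.PreservesFiniteProducts.of_preserves_binary_and_terminal F

end PolyCat

/-! ### Ring structure on the values of a Tambara functor -/

namespace TambaraFunctor

open PolyCat

variable {G : Type u} [Group G] [Finite G] {O : IndexingSystem G}

section

variable (F : PolyCat O ⥤ Type w) [Limits.PreservesFiniteProducts F]

/-- The additive structure: transfers. -/
@[reducible]
noncomputable def addMackey : SemiMackey.{u, w} (IndexingSystem.complete G) where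
  obj X := F.obj ⟨X⟩
  res f x := F.map (R O f) x
  push f _ x := F.map (T O f) x
  res_id x := by rw [R_id, F.map_id]; rfl
  res_comp g f z := by rw [R_comp, F.map_comp]; rfl
  push_id x := by rw [T_id, F.map_id]; rfl
  push_comp g f _ _ x := by rw [T_comp, F.map_comp]; rfl
  res_push H _ y := by
    have := congrArg F.map (T_R O H)
    rw [F.map_comp, F.map_comp] at this
    exact ConcreteCategory.congr_hom this y
  additive := bijective_of_preservesFiniteProducts F
  pt := (unique_of_preservesFiniteProducts F).some.default
  eq_pt := (unique_of_preservesFiniteProducts F).some.uniq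

/-- The multiplicative structure: norms. -/
@[reducible]
noncomputable def mulMackey : SemiMackey.{u, w} O where
  obj X := F.obj ⟨X⟩
  res f x := F.map (R O f) x
  push f hf x := F.map (N f hf) x
  res_id x := by rw [R_id, F.map_id]; rfl
  res_comp g f z := by rw [R_comp, F.map_comp]; rfl
  push_id x := by rw [N_id, F.map_id]; rfl
  push_comp g f hg hf x := by rw [N_comp, F.map_comp]; rfl
  res_push H hg y := by
    have := congrArg F.map (N_R H hg)
    rw [F.map_comp, F.map_comp] at this
    exact ConcreteCategory.congr_hom this y
  additive := bijective_of_preservesFiniteProducts F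
  pt := (unique_of_preservesFiniteProducts F).some.default
  eq_pt := (unique_of_preservesFiniteProducts F).some.uniq

variable {F}

/-- The relation `T_N_fold`, evaluated at the element of F(X ⊔ X') with components `x` and `y`. -/
theorem mul_tr_tr {X X' Y : FinGSet G} (p : X →[G] Y) (q : X' →[G] Y) (x : F.obj ⟨X⟩)
    (y : F.obj ⟨X'⟩) :
    (mulMackey F).op (F.map (T O p) x) (F.map (T O q) y) =
      F.map (T O (p.comp (pullback.fst p q)))
        ((mulMackey F).op (F.map (R O (pullback.fst p q)) x)
          (F.map (R O (pullback.snd p q)) y)) := by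
  have e := congrArg F.map (T_N_fold O p q)
  rw [F.map_comp, F.map_comp, F.map_comp] at e
  have e := ConcreteCategory.congr_hom e ((addMackey F).pair x y)
  have e1 := (addMackey F).push_sumMap p q (IndexingSystem.mem_complete _)
    (IndexingSystem.mem_complete _) ((addMackey F).pair x y)
  rw [SemiMackey.res_inl_pair, SemiMackey.res_inr_pair] at e1
  refine Eq.trans ?_ (e.trans ?_)
  · exact congrArg (F.map (N (fold Y) (mem_fold Y))) e1.symm
  · refine congrArg (F.map (T O (p.comp (pullback.fst p q)))) ?_
    refine ((mulMackey F).op_eq _).trans ?_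
    refine congrArg₂ (mulMackey F).op ?_ ?_
    · refine ((mulMackey F).res_comp (sumMap (pullback.fst p q) (pullback.snd p q)) (inl _ _)
        _).symm.trans (((mulMackey F).res_comp (inl X X') (pullback.fst p q) _).trans ?_)
      exact congrArg _ (SemiMackey.res_inl_pair (M := mulMackey F) x y)
    · refine ((mulMackey F).res_comp (sumMap (pullback.fst p q) (pullback.snd p q)) (inr _ _)
        _).symm.trans (((mulMackey F).res_comp (inr X X') (pullback.snd p q) _).trans ?_)
      exact congrArg _ (SemiMackey.res_inr_pair (M := mulMackey F) x y)

/-- The product of two transfers with the first one along the identity. -/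
theorem mul_tr {X Y : FinGSet G} (f : X →[G] Y) (a : F.obj ⟨Y⟩) (b : F.obj ⟨X⟩) :
    (mulMackey F).op a (F.map (T O f) b) =
      F.map (T O f) ((mulMackey F).op (F.map (R O f) a) b) := by
  have e := mul_tr_tr (MulActionHom.id G) f a b
  have hc : (MulActionHom.id G).comp (pullback.fst (MulActionHom.id G) f) =
      f.comp (pullback.snd (MulActionHom.id G) f) := hom_ext fun p => p.2
  -- The fibre product of the identity and `f` is the graph of `f`, so it projects isomorphically
  -- onto the source of `f`.
  have hb : Function.Bijective (pullback.snd (MulActionHom.id G) f) := by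
    refine ⟨fun x y h => ?_, fun x => ⟨⟨(f x, x), rfl⟩, rfl⟩⟩
    exact (isPullbackSquare_pullback _ _).inj (x.2.trans ((congrArg f h).trans y.2.symm)) h
  have e2 : F.map (R O (pullback.fst (MulActionHom.id G) f)) a =
      F.map (R O (pullback.snd (MulActionHom.id G) f)) (F.map (R O f) a) := by
    refine Eq.trans ?_ ((mulMackey F).res_comp f (pullback.snd (MulActionHom.id G) f) a)
    exact congrArg (fun k => F.map (R O k) a) hc
  rw [e2, ← (mulMackey F).res_op, hc, T_id, F.map_id] at e
  refine e.trans (((addMackey F).push_comp f (pullback.snd (MulActionHom.id G) f)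
    (IndexingSystem.mem_complete _) (IndexingSystem.mem_complete _) _).trans ?_)
  exact congrArg _ ((addMackey F).push_res_of_bijective hb (IndexingSystem.mem_complete _) _)

/-- A sum is a transfer along the fold map, so distributivity is Frobenius reciprocity for that map.
-/
theorem mul_add {X : FinGSet G} (a b c : F.obj ⟨X⟩) :
    (mulMackey F).op a ((addMackey F).op b c) =
      (addMackey F).op ((mulMackey F).op a b) ((mulMackey F).op a c) := by
  refine (mul_tr (fold X) a _).trans (((addMackey F).op_eq _).trans ?_)
  refine congrArg₂ (addMackey F).op ?_ ?_
  · refine ((mulMackey F).res_op (inl X X) _ _).trans (congrArg₂ _ ?_ ?_)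
    · exact ((mulMackey F).res_comp (fold X) (inl X X) a).symm.trans ((mulMackey F).res_id a)
    · exact (addMackey F).res_inl_pair b c
  · refine ((mulMackey F).res_op (inr X X) _ _).trans (congrArg₂ _ ?_ ?_)
    · exact ((mulMackey F).res_comp (fold X) (inr X X) a).symm.trans ((mulMackey F).res_id a)
    · exact (addMackey F).res_inr_pair b c

/-- Frobenius reciprocity along ∅ → X, whose source has a one-point value. -/
theorem mul_zero {X : FinGSet G} (a : F.obj ⟨X⟩) :
    (mulMackey F).op a ((addMackey F).unit X) = (addMackey F).unit X :=
  (mul_tr (fromEmpty X) a _).trans (congrArg _ ((addMackey F).eq_pt _))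

theorem isSum_op {X : FinGSet G} (a b : F.obj ⟨X⟩) : IsSum F a b ((addMackey F).op a b) :=
  ⟨(addMackey F).pair a b, (addMackey F).res_inl_pair a b, (addMackey F).res_inr_pair a b, rfl⟩

theorem isProd_op {X : FinGSet G} (a b : F.obj ⟨X⟩) : IsProd F a b ((mulMackey F).op a b) :=
  ⟨(mulMackey F).pair a b, (mulMackey F).res_inl_pair a b, (mulMackey F).res_inr_pair a b, rfl⟩

/-- The witness over X ⊔ X is determined by its components. Two additions are therefore compared by
checking `IsSum` alone. -/
theorem IsSum.eq {X : FinGSet G} {a b s : F.obj ⟨X⟩} (h : IsSum F a b s) :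
    s = (addMackey F).op a b := by
  obtain ⟨c, rfl, rfl, rfl⟩ := h
  exact (addMackey F).op_eq c

theorem IsProd.eq {X : FinGSet G} {a b s : F.obj ⟨X⟩} (h : IsProd F a b s) :
    s = (mulMackey F).op a b := by
  obtain ⟨c, rfl, rfl, rfl⟩ := h
  exact (mulMackey F).op_eq c

theorem IsZero.eq {X : FinGSet G} {z : F.obj ⟨X⟩} (h : IsZero F z) :
    z = (addMackey F).unit X := by
  obtain ⟨e, rfl⟩ := h
  exact congrArg _ ((addMackey F).eq_pt e)

theorem IsOne.eq {X : FinGSet G} {z : F.obj ⟨X⟩} (h : IsOne F z) :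
    z = (mulMackey F).unit X := by
  obtain ⟨e, rfl⟩ := h
  exact congrArg _ ((mulMackey F).eq_pt e)

variable (F) in
/-- The ring structure on the values. -/
@[reducible]
noncomputable def commRing (h : ∀ (X : FinGSet G) (a : F.obj ⟨X⟩), ∃ b z, IsZero F z ∧ IsSum F a b z)
    (X : FinGSet G) : CommRing (F.obj ⟨X⟩) :=
  letI : Zero (F.obj ⟨X⟩) := ⟨(addMackey F).unit X⟩
  letI : Add (F.obj ⟨X⟩) := ⟨(addMackey F).op⟩
  letI : Neg (F.obj ⟨X⟩) := ⟨fun a => (h X a).choose⟩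
  { SemiMackey.commMonoid (M := mulMackey F) X with
    add_assoc := (addMackey F).op_assoc
    zero_add := fun a => ((addMackey F).op_comm _ _).trans ((addMackey F).op_unit a)
    add_zero := (addMackey F).op_unit
    add_comm := (addMackey F).op_comm
    nsmul := nsmulRec
    zsmul := zsmulRec
    neg_add_cancel := fun a => by
      obtain ⟨z, hz, hs⟩ := (h X a).choose_spec
      refine ((addMackey F).op_comm _ _).trans ?_
      exact (IsSum.eq hs).symm.trans (IsZero.eq hz)
    left_distrib := mul_add
    right_distrib := fun a b c => by
      refine ((mulMackey F).op_comm _ _).trans ((mul_add _ _ _).trans ?_)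
      exact congrArg₂ _ ((mulMackey F).op_comm _ _) ((mulMackey F).op_comm _ _)
    zero_mul := fun a => ((mulMackey F).op_comm _ _).trans (mul_zero a)
    mul_zero := mul_zero }

variable (F) in
/-- The underlying Green functor. -/
noncomputable def green (h : ∀ (X : FinGSet G) (a : F.obj ⟨X⟩), ∃ b z, IsZero F z ∧ IsSum F a b z) :
    GreenFunctor.{u, w} G where
  obj X := F.obj ⟨X⟩
  ring X := commRing F h X
  res {X Y} f :=
    letI := commRing F h X
    letI := commRing F h Y
    { toFun := fun x => F.map (R O f) x
      map_one' := (mulMackey F).res_unit f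
      map_mul' := (mulMackey F).res_op f
      map_zero' := (addMackey F).res_unit f
      map_add' := (addMackey F).res_op f }
  tr {X Y} f :=
    letI := commRing F h X
    letI := commRing F h Y
    { toFun := fun x => F.map (T O f) x
      map_zero' := (addMackey F).push_unit f (IndexingSystem.mem_complete _)
      map_add' := (addMackey F).push_op f (IndexingSystem.mem_complete _) }
  res_id := (addMackey F).res_id
  res_comp := (addMackey F).res_comp
  tr_id := (addMackey F).push_id
  tr_comp g f := (addMackey F).push_comp g f (IndexingSystem.mem_complete _)
    (IndexingSystem.mem_complete _)
  res_tr _ _ _ _ H := (addMackey F).res_push H (IndexingSystem.mem_complete _)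
  additive := (addMackey F).additive
  additive_empty := ⟨fun a b => ((addMackey F).eq_pt a).trans ((addMackey F).eq_pt b).symm⟩
  frobenius := mul_tr

variable (h : ∀ (X : FinGSet G) (a : F.obj ⟨X⟩), ∃ b z, IsZero F z ∧ IsSum F a b z)

/-- The norm along a map in `Set_O^G`. -/
noncomputable def normHom {X Y : FinGSet G} (f : X →[G] Y) (hf : O.Mem f) :
    (green F h).obj X →* (green F h).obj Y where
  toFun x := F.map (N f hf) x
  map_one' := (mulMackey F).push_unit f hf
  map_mul' := (mulMackey F).push_op f hf

end

end TambaraFunctor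

/-! ### Norm axioms and functoriality of the underlying Green functor -/

namespace TambaraFunctor

open PolyCat

variable {G : Type u} [Group G] [Finite G] {O : IndexingSystem G}

section

variable {F : PolyCat O ⥤ Type w} [Limits.PreservesFiniteProducts F]
  (h : ∀ (X : FinGSet G) (a : F.obj ⟨X⟩), ∃ b z, IsZero F z ∧ IsSum F a b z)

/-- Base change along the orbit of `b` replaces `g` by a projection to an orbit, whose source is the
union of the orbits of the representatives; the norm is then a product over these. -/
theorem isNorm_map {A B : FinGSet G} (g : A →[G] B) (hg : O.Mem g) (x : F.obj ⟨A⟩) :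
    GreenFunctor.IsNorm (M := green F h) (fun f hf => normHom h f hf) g hg x (F.map (N g hg) x) := by
  intro b s hs
  let (X : FinGSet G) : CommMonoid (F.obj ⟨X⟩) := SemiMackey.commMonoid (M := mulMackey F) X
  refine ((mulMackey F).res_push (isPullbackSquare_pullback (ofPoint b) g) hg x).trans ?_
  refine (SemiMackey.push_eq_prod (M := mulMackey F) (isCover_fiberMap g hs)
    (pullback.fst (ofPoint b) g) (mem_pullback_fst _ hg) _).trans ?_
  refine Eq.trans ?_ (Finset.prod_coe_sort s _)
  refine Finset.prod_congr rfl fun a _ => ?_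
  refine congrArg ((mulMackey F).push (stabMap g a.1) (mem_stabMap hg a.1)) ?_
  exact ((mulMackey F).res_comp (pullback.snd (ofPoint b) g) (fiberMap g a.1) x).symm

/-- The underlying Green functor with norms. -/
noncomputable def normedGreen : NormedGreenFunctor.{u, w} O where
  toGreenFunctor := green F h
  norm f hf := normHom h f hf
  norm_id := (mulMackey F).push_id
  norm_comp := (mulMackey F).push_comp
  res_norm k f hf x := by
    have := (mulMackey F).res_push (isPullbackSquare_pullback k f) hf x
    change GreenFunctor.IsNorm (M := green F h) (fun f hf => normHom h f hf) _ _ _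
      ((mulMackey F).res k ((mulMackey F).push f hf x))
    rw [this]
    exact isNorm_map h _ _ _
  norm_add f hf a b c ha hb := by
    refine ⟨_, isNorm_map h _ _ _, ?_⟩
    -- The sum is the transfer of `c` along the fold map, so its norm is given by the exponential
    -- relation.
    have hc : (addMackey F).op a b = F.map (T O (fold _)) c := by
      rw [← ha, ← hb]
      exact ((addMackey F).op_eq c).symm
    change F.map (N f hf) ((addMackey F).op a b) = _
    rw [hc]
    have := congrArg F.map (T_N (fold _) f hf)
    rw [F.map_comp, F.map_comp, F.map_comp] at this
    exact ConcreteCategory.congr_hom this c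
  norm_tr f hf q a := by
    refine ⟨_, isNorm_map h _ _ _, ?_⟩
    have := congrArg F.map (T_N q f hf)
    rw [F.map_comp, F.map_comp, F.map_comp] at this
    exact ConcreteCategory.congr_hom this a

end

/-- The Green functor with norms underlying a Tambara functor. -/
noncomputable def toNormedGreen (F : TambaraFunctor.{u, w} O) : NormedGreenFunctor.{u, w} O :=
  haveI := F.property.1
  normedGreen F.property.2

/-- The identification of the Green functor with norms underlying a Tambara functor. -/
noncomputable def underlying (F : TambaraFunctor.{u, w} O) : Underlying F (toNormedGreen F) :=
  haveI := F.property.1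
  { equiv := fun _ => Equiv.refl _
    zero := fun _ => ⟨_, rfl⟩
    one := fun _ => ⟨_, rfl⟩
    add := fun _ a b => isSum_op a b
    mul := fun _ a b => isProd_op a b
    res := fun _ _ => rfl
    tr := fun _ _ => rfl
    norm := fun _ _ _ => rfl }

theorem naturality_apply {F F' : PolyCat O ⥤ Type w} (φ : F ⟶ F') {X Y : PolyCat O} (f : X ⟶ Y)
    (x : F.obj X) : φ.app Y (F.map f x) = F'.map f (φ.app X x) :=
  ConcreteCategory.congr_hom (φ.naturality f) x

section

variable {F F' : PolyCat O ⥤ Type w} [Limits.PreservesFiniteProducts F]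
  [Limits.PreservesFiniteProducts F'] (φ : F ⟶ F')

/-- Naturality preserves the relation `IsSum`, which determines the sum. -/
theorem app_add {X : FinGSet G} (a b : F.obj ⟨X⟩) : φ.app ⟨X⟩ ((addMackey F).op a b) =
    (addMackey F').op (φ.app ⟨X⟩ a) (φ.app ⟨X⟩ b) := by
  obtain ⟨c, h1, h2, h3⟩ := isSum_op a b
  exact IsSum.eq ⟨φ.app _ c, by rw [← naturality_apply, h1], by rw [← naturality_apply, h2],
    by rw [← naturality_apply, h3]⟩

theorem app_mul {X : FinGSet G} (a b : F.obj ⟨X⟩) : φ.app ⟨X⟩ ((mulMackey F).op a b) =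
    (mulMackey F').op (φ.app ⟨X⟩ a) (φ.app ⟨X⟩ b) := by
  obtain ⟨c, h1, h2, h3⟩ := isProd_op a b
  exact IsProd.eq ⟨φ.app _ c, by rw [← naturality_apply, h1], by rw [← naturality_apply, h2],
    by rw [← naturality_apply, h3]⟩

theorem app_zero (X : FinGSet G) : φ.app ⟨X⟩ ((addMackey F).unit X) = (addMackey F').unit X :=
  IsZero.eq ⟨φ.app _ (addMackey F).pt, (naturality_apply φ _ _).symm⟩

theorem app_one (X : FinGSet G) : φ.app ⟨X⟩ ((mulMackey F).unit X) = (mulMackey F').unit X :=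
  IsOne.eq ⟨φ.app _ (mulMackey F).pt, (naturality_apply φ _ _).symm⟩

end

/-- The map of Green functors with norms underlying a map of Tambara functors. -/
noncomputable def mapHom {F F' : TambaraFunctor.{u, w} O} (φ : F ⟶ F') :
    NormedGreenFunctor.Hom (toNormedGreen F) (toNormedGreen F') :=
  haveI := F.property.1
  haveI := F'.property.1
  { app := fun X =>
      { toFun := fun x => φ.hom.app ⟨X⟩ x
        map_one' := app_one φ.hom X
        map_mul' := app_mul φ.hom
        map_zero' := app_zero φ.hom X
        map_add' := app_add φ.hom }
    app_res := fun f y => naturality_apply φ.hom (R O f) y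
    app_tr := fun f x => naturality_apply φ.hom (T O f) x
    app_norm := fun f hf x => naturality_apply φ.hom (N f hf) x }

variable (O) in
/-- The functor from Tambara functors to Green functors with norms. -/
noncomputable def toNormedGreenFunctor :
    TambaraFunctor.{u, w} O ⥤ NormedGreenFunctor.{u, w} O where
  obj := toNormedGreen
  map := mapHom
  map_id _ := rfl
  map_comp _ _ := rfl

end TambaraFunctor

/-! ## Elements of Green functors are detected on orbits -/

namespace GreenFunctor

section

variable {G : Type u} [Group G] {M : GreenFunctor.{u, w} G}

theorem res_congr {X Y : FinGSet G} {f f' : X →[G] Y} (h : f = f') (x : M.obj Y) :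
    M.res f x = M.res f' x := by rw [h]

theorem res_injective_of_bijective {X Y : FinGSet G} {f : X →[G] Y} (hf : Function.Bijective f) :
    Function.Injective (M.res f) := by
  obtain ⟨g, -, -, hg⟩ := exists_inverse f hf
  intro a b hab
  have := congrArg (M.res g) hab
  rwa [← M.res_comp, ← M.res_comp, hom_ext (f := f.comp g) (g := MulActionHom.id G) hg, M.res_id,
    M.res_id] at this

theorem res_tr_of_injective {X Y : FinGSet G} {f : X →[G] Y} (hf : Function.Injective f)
    (x : M.obj X) : M.res f (M.tr f x) = x := by
  rw [M.res_tr _ _ _ _ (isPullbackSquare_of_injective f hf), M.tr_id, M.res_id]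

theorem tr_res_of_bijective {X Y : FinGSet G} {f : X →[G] Y} (hf : Function.Bijective f)
    (y : M.obj Y) : M.tr f (M.res f y) = y :=
  res_injective_of_bijective hf (res_tr_of_injective hf.1 _)

theorem subsingleton_of_isEmpty (X : FinGSet G) [IsEmpty X] : Subsingleton (M.obj X) := by
  have hb : Function.Bijective (fromEmpty X) :=
    ⟨fun x => PEmpty.elim x, fun x => isEmptyElim x⟩
  have := M.additive_empty
  exact (res_injective_of_bijective (M := M) hb).subsingleton

theorem ext_coprod {X Y Z : FinGSet G} {i : X →[G] Z} {j : Y →[G] Z} (h : IsCoprod i j)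
    {z z' : M.obj Z} (h1 : M.res i z = M.res i z') (h2 : M.res j z = M.res j z') : z = z' := by
  refine res_injective_of_bijective h.bijective ((M.additive X Y).1 (Prod.ext ?_ ?_))
  · change M.res _ (M.res _ _) = M.res _ (M.res _ _)
    rw [← M.res_comp, ← M.res_comp]
    exact h1
  · change M.res _ (M.res _ _) = M.res _ (M.res _ _)
    rw [← M.res_comp, ← M.res_comp]
    exact h2

end

variable {G : Type u} [Group G] [Finite G] {M : GreenFunctor.{u, w} G}

/-- Induction on the cardinality of `X`, splitting off one orbit. -/
theorem ext_orbit {X : FinGSet G} {z z' : M.obj X}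
    (h : ∀ (L : Subgroup G) (k : (orbit L : FinGSet G) →[G] X), M.res k z = M.res k z') :
    z = z' := by
  induction hn : Nat.card X using Nat.strong_induction_on generalizing X with
  | _ n ih =>
  rcases isEmpty_or_nonempty X with hX | ⟨⟨x⟩⟩
  · exact (subsingleton_of_isEmpty X).elim _ _
  · obtain ⟨S, hS, hc, hmem⟩ := isCoprod_compl (ofPoint x) (ofPoint_injective x)
    refine ext_coprod hc (h _ _) (ih (Nat.card (sub S hS)) ?_ (fun L k => ?_) rfl)
    · rw [← hn]
      -- The complement is smaller because it misses `x`.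
      refine Finite.card_subtype_lt (x := x) fun hx => ?_
      exact (hmem _).1 hx (one _) (ofPoint_one _)
    · rw [← M.res_comp, ← M.res_comp]
      exact h _ _

theorem ext_ofPoint {X : FinGSet G} {z z' : M.obj X}
    (h : ∀ x : X, M.res (ofPoint x) z = M.res (ofPoint x) z') : z = z' := by
  refine ext_orbit fun L k => ?_
  obtain ⟨m, hm⟩ := exists_factor_ofPoint k (k (one L)) (MulAction.mem_orbit_self _)
  rw [hm, M.res_comp, M.res_comp, h]

end GreenFunctor

/-! ### Orbit representatives in a fibre -/

namespace FinGSet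

variable {G : Type u} [Group G]

/-- Representatives of the orbits in a fibre exist. -/
theorem exists_representatives {A B : FinGSet G} (g : A →[G] B) (b : B) :
    ∃ s : Finset {a : A // g a = b},
      ∀ a : {a : A // g a = b}, ∃! a', a' ∈ s ∧ a'.1 ∈ MulAction.orbit G a.1 := by
  classical
  have := Fintype.ofFinite {a : A // g a = b}
  let r : Setoid {a : A // g a = b} := (MulAction.orbitRel G A).comap Subtype.val
  refine ⟨Finset.univ.image fun q : Quotient r => q.out, fun a => ⟨(Quotient.mk r a).out, ⟨?_, ?_⟩, ?_⟩⟩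
  · exact Finset.mem_image_of_mem _ (Finset.mem_univ _)
  · exact Quotient.mk_out (s := r) a
  · rintro a' ⟨h1, h2⟩
    obtain ⟨q, -, rfl⟩ := Finset.mem_image.1 h1
    congr 1
    refine (Quotient.out_eq q).symm.trans (Quotient.sound (s := r) ?_)
    exact h2

end FinGSet

/-! ### Full faithfulness -/

namespace TambaraFunctor

open PolyCat

variable {G : Type u} [Group G] [Finite G] {O : IndexingSystem G}

/-- Restricted to the orbit of a point, both sides are given by the same product formula in norms
between orbits, with which φ commutes. -/
theorem app_map_norm {F F' : TambaraFunctor.{u, w} O}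
    (φ : NormedGreenFunctor.Hom (toNormedGreen F) (toNormedGreen F')) {A B : FinGSet G}
    (g : A →[G] B) (hg : O.Mem g) (x : (toNormedGreen F).obj A) :
    φ.app B (F.obj.map (N g hg) x) = F'.obj.map (N g hg) (φ.app A x) := by
  have := F.property.1
  have := F'.property.1
  refine GreenFunctor.ext_ofPoint (M := (toNormedGreen F').toGreenFunctor) fun b => ?_
  obtain ⟨s, hs⟩ := exists_representatives g b
  have e1 := isNorm_map F.property.2 g hg x b s hs
  have e2 := isNorm_map F'.property.2 g hg (φ.app A x) b s hs
  refine (φ.app_res (ofPoint b) _).symm.trans ((congrArg (φ.app _) e1).trans (Eq.trans ?_ e2.symm))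
  refine (map_prod (φ.app _) _ s).trans (Finset.prod_congr rfl fun a _ => ?_)
  refine (φ.app_norm (stabMap g a) (mem_stabMap hg a) _).trans ?_
  exact congrArg ((toNormedGreen F').norm (stabMap g a) (mem_stabMap hg a)) (φ.app_res (ofPoint a.1) x)

instance : (toNormedGreenFunctor.{u, w} O).Faithful where
  map_injective {F F'} φ ψ h := by
    ext X x
    exact congrArg (fun φ : NormedGreenFunctor.Hom _ _ => φ.app X.set x) h

/-- Each morphism is T N R, so naturality splits into compatibility with restrictions, arbitrary
norms and transfers. -/
instance : (toNormedGreenFunctor.{u, w} O).Full where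
  map_surjective {F F'} φ := by
    refine ⟨⟨{ app := fun X => TypeCat.ofHom fun x => NormedGreenFunctor.Hom.app φ X.set x
               naturality := fun X Y f => ?_ }⟩, rfl⟩
    obtain ⟨P, rfl⟩ := exists_eq f
    rw [homMk_eq, F.obj.map_comp, F.obj.map_comp, F'.obj.map_comp, F'.obj.map_comp]
    ext x
    refine (NormedGreenFunctor.Hom.app_tr φ P.t _).trans ?_
    refine congrArg (F'.obj.map (T O P.t)) ((app_map_norm φ P.n P.mem _).trans ?_)
    exact congrArg (F'.obj.map (N P.n P.mem)) (NormedGreenFunctor.Hom.app_res φ P.r x)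

end TambaraFunctor

/-! ## Decompositions of fibres into orbits -/

namespace FinGSet

variable {G : Type u} [Group G] [Finite G]

/-- A decomposition of the fibre product of `g : A → B` and `k : G/L → B` into orbits. -/
structure NormCover {A B : FinGSet G} (g : A →[G] B) {L : Subgroup G}
    (k : (orbit L : FinGSet G) →[G] B) where
  ι : Type u
  [fintype : Fintype ι]
  H : ι → Subgroup G
  u : ∀ i, (orbit (H i) : FinGSet G) →[G] A
  v : ∀ i, (orbit (H i) : FinGSet G) →[G] orbit L
  comm : ∀ i h, g (u i h) = k (v i h)
  inj : ∀ i h h', u i h = u i h' → v i h = v i h' → h = h'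
  disj : ∀ i j h h', u i h = u j h' → v i h = v j h' → i = j
  cover : ∀ a l, g a = k l → ∃ i h, u i h = a ∧ v i h = l

attribute [instance] NormCover.fintype

theorem exists_orbit_cover (P : FinGSet G) : ∃ (ι : Type u) (_ : Fintype ι) (H : ι → Subgroup G)
    (j : ∀ i, (orbit (H i) : FinGSet G) →[G] P), IsCover j := by
  let r : Setoid P := MulAction.orbitRel G P
  refine ⟨Quotient r, Fintype.ofFinite _, fun q => MulAction.stabilizer G q.out,
    fun q => ofPoint q.out, fun q => ofPoint_injective _, ?_, ?_⟩
  · intro q q' x y h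
    obtain ⟨a, rfl⟩ := exists_smul_one x
    obtain ⟨b, rfl⟩ := exists_smul_one y
    rw [map_smul, map_smul, ofPoint_one, ofPoint_one] at h
    rw [← Quotient.out_eq q, ← Quotient.out_eq q']
    refine Quotient.sound (s := r) ⟨a⁻¹ * b, ?_⟩
    simp only [mul_smul, ← h, inv_smul_smul]
  · intro p
    obtain ⟨a, ha⟩ := Setoid.symm' r (Quotient.mk_out (s := r) p)
    exact ⟨Quotient.mk r p, a • one _, by rw [map_smul, ofPoint_one]; exact ha⟩

namespace NormCover

variable {A B : FinGSet G} {g : A →[G] B} {L : Subgroup G} {k : (orbit L : FinGSet G) →[G] B}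

theorem mem_v {O : IndexingSystem G} (C : NormCover g k) (hg : O.Mem g) (i : C.ι) :
    O.Mem (C.v i) :=
  IndexingSystem.mem_of_square hg k _ (C.u i) (C.comm i) fun h h' e e' => C.inj i h h' e' e

/-- The decomposition given by a decomposition of the fibre product. -/
def ofCover {ι : Type u} [Fintype ι] {H : ι → Subgroup G}
    {j : ∀ i, (orbit (H i) : FinGSet G) →[G] pullback k g} (hj : IsCover j) : NormCover g k where
  ι := ι
  H := H
  u i := (pullback.snd k g).comp (j i)
  v i := (pullback.fst k g).comp (j i)
  comm i h := (j i h).2.symm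
  inj i _ _ e e' := hj.inj i (Subtype.ext (Prod.ext e' e))
  disj i i' x y e e' := hj.disj i i' x y (Subtype.ext (Prod.ext e' e))
  cover a l h := by
    obtain ⟨i, x, hx⟩ := hj.cover ⟨(l, a), h.symm⟩
    exact ⟨i, x, congrArg (fun z => z.1.2) hx, congrArg (fun z => z.1.1) hx⟩

variable (g k) in
theorem nonempty : Nonempty (NormCover g k) := by
  obtain ⟨ι, _, H, j, hj⟩ := exists_orbit_cover (pullback k g)
  exact ⟨ofCover hj⟩

variable (g k) in
/-- A chosen decomposition. -/
noncomputable def some : NormCover g k := (nonempty g k).some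

/-- Decompositions of two summands of the source. -/
def sum {A₁ A₂ : FinGSet G} {i₁ : A₁ →[G] A} {i₂ : A₂ →[G] A} (h : IsCoprod i₁ i₂)
    (C₁ : NormCover (g.comp i₁) k) (C₂ : NormCover (g.comp i₂) k) : NormCover g k where
  ι := C₁.ι ⊕ C₂.ι
  H := Sum.elim C₁.H C₂.H
  u := Sum.rec (fun i => i₁.comp (C₁.u i)) fun i => i₂.comp (C₂.u i)
  v := Sum.rec (fun i => C₁.v i) fun i => C₂.v i
  comm := by
    rintro (i | i) x
    · exact C₁.comm i x
    · exact C₂.comm i x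
  inj := by
    rintro (i | i) x y e e'
    · exact C₁.inj i x y (h.inj_left e) e'
    · exact C₂.inj i x y (h.inj_right e) e'
  disj := by
    rintro (i | i) (j | j) x y e e'
    · exact congrArg Sum.inl (C₁.disj i j x y (h.inj_left e) e')
    · exact (h.disj _ _ e).elim
    · exact (h.disj _ _ e.symm).elim
    · exact congrArg Sum.inr (C₂.disj i j x y (h.inj_right e) e')
  cover a l e := by
    rcases h.cover a with ⟨a, rfl⟩ | ⟨a, rfl⟩
    · obtain ⟨i, x, rfl, rfl⟩ := C₁.cover a l e
      exact ⟨Sum.inl i, x, rfl, rfl⟩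
    · obtain ⟨i, x, rfl, rfl⟩ := C₂.cover a l e
      exact ⟨Sum.inr i, x, rfl, rfl⟩

/-- Decomposition after base change. -/
def refine (C : NormCover g k) {L' : Subgroup G} {m : (orbit L' : FinGSet G) →[G] orbit L}
    (D : ∀ i, NormCover (C.v i) m) : NormCover g (k.comp m) where
  ι := Σ i, (D i).ι
  H i := (D i.1).H i.2
  u i := (C.u i.1).comp ((D i.1).u i.2)
  v i := (D i.1).v i.2
  comm i x := (C.comm i.1 _).trans (congrArg k ((D i.1).comm i.2 x))
  inj i x y e e' := (D i.1).inj i.2 x y (C.inj i.1 _ _ e (by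
    rw [(D i.1).comm, (D i.1).comm, e'])) e'
  disj := by
    rintro ⟨i, i'⟩ ⟨j, j'⟩ x y e e'
    have h : C.v i ((D i).u i' x) = C.v j ((D j).u j' y) := by
      rw [(D i).comm, (D j).comm, e']
    obtain rfl : i = j := C.disj i j _ _ e h
    obtain rfl : i' = j' := (D i).disj i' j' x y (C.inj i _ _ e h) e'
    rfl
  cover a l e := by
    obtain ⟨i, x, rfl, hx⟩ := C.cover a (m l) e
    obtain ⟨i', y, rfl, rfl⟩ := (D i).cover x l hx
    exact ⟨⟨i, i'⟩, y, rfl, rfl⟩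

/-- Decomposition for a composite map. -/
def comp {A' : FinGSet G} {f : A' →[G] A} (C : NormCover g k) (D : ∀ i, NormCover f (C.u i)) :
    NormCover (g.comp f) k where
  ι := Σ i, (D i).ι
  H i := (D i.1).H i.2
  u i := (D i.1).u i.2
  v i := (C.v i.1).comp ((D i.1).v i.2)
  comm i x := (congrArg g ((D i.1).comm i.2 x)).trans (C.comm i.1 _)
  inj i x y e e' := (D i.1).inj i.2 x y e (C.inj i.1 _ _ (by
    rw [← (D i.1).comm, ← (D i.1).comm, e]) e')
  disj := by
    rintro ⟨i, i'⟩ ⟨j, j'⟩ x y e e'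
    have h : C.u i ((D i).v i' x) = C.u j ((D j).v j' y) := by
      rw [← (D i).comm, ← (D j).comm, e]
    obtain rfl : i = j := C.disj i j _ _ h e'
    obtain rfl : i' = j' := (D i).disj i' j' x y e (C.inj i _ _ h e')
    rfl
  cover a l e := by
    obtain ⟨i, x, hx, rfl⟩ := C.cover (f a) l e
    obtain ⟨i', y, rfl, rfl⟩ := (D i).cover a x hx.symm
    exact ⟨⟨i, i'⟩, y, rfl, rfl⟩

/-- Decomposition along a pullback square. -/
def ofSquare {P X : FinGSet G} {p : P →[G] X} {q : P →[G] A} {f : X →[G] B}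
    (S : IsPullbackSquare p q f g) {m : (orbit L : FinGSet G) →[G] X} (C : NormCover p m) :
    NormCover g (f.comp m) where
  ι := C.ι
  H := C.H
  u i := q.comp (C.u i)
  v := C.v
  comm i x := (S.1 _).symm.trans (congrArg f (C.comm i x))
  inj i x y e e' := C.inj i x y (S.inj (by rw [C.comm, C.comm, e']) e) e'
  disj i j x y e e' := C.disj i j x y (S.inj (by rw [C.comm, C.comm, e']) e) e'
  cover a l e := by
    obtain ⟨z, ⟨hz, rfl⟩, -⟩ := S.2 (m l) a e.symm
    obtain ⟨i, x, rfl, rfl⟩ := C.cover z l hz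
    exact ⟨i, x, rfl, rfl⟩

/-- The trivial decomposition for a map of orbits. -/
def single {H : Subgroup G} (f : (orbit H : FinGSet G) →[G] orbit L) :
    NormCover f (MulActionHom.id G) where
  ι := PUnit
  H _ := H
  u _ := MulActionHom.id G
  v _ := f
  comm _ _ := rfl
  inj _ _ _ e _ := e
  disj _ _ _ _ _ _ := rfl
  cover a _ e := ⟨⟨⟩, a, rfl, e⟩

/-- Decompositions are unique up to isomorphism. -/
theorem exists_equiv (C C' : NormCover g k) : ∃ (e : C.ι ≃ C'.ι)
    (θ : ∀ i, (orbit (C.H i) : FinGSet G) →[G] orbit (C'.H (e i))),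
    (∀ i, Function.Bijective (θ i)) ∧ (∀ i, (C'.u (e i)).comp (θ i) = C.u i) ∧
      ∀ i, (C'.v (e i)).comp (θ i) = C.v i := by
  choose e x hu hv using fun i => C'.cover (C.u i (one _)) (C.v i (one _)) (C.comm i (one _))
  have key : ∀ i (h : (orbit (C.H i) : FinGSet G)), ∃ y, C'.u (e i) y = C.u i h ∧
      C'.v (e i) y = C.v i h := by
    intro i h
    obtain ⟨a, rfl⟩ := exists_smul_one h
    exact ⟨a • x i, by rw [map_smul, map_smul, hu], by rw [map_smul, map_smul, hv]⟩
  choose θ hθu hθv using key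
  have he : Function.Bijective e := by
    constructor
    · intro i j hij
      -- The index is generalised so that the point `x i` can be moved to the piece `e j` without a
      -- cast; there it is a translate of `x j`, so the pieces `i` and `j` of `C` meet.
      have : ∀ i' (hi : e i = i'), ∃ y, C'.u i' y = C.u i (one _) ∧
          C'.v i' y = C.v i (one _) := by
        rintro _ rfl
        exact ⟨x i, hu i, hv i⟩
      obtain ⟨y, h1, h2⟩ := this _ hij
      obtain ⟨a, ha⟩ := exists_smul_eq (x j) y
      refine C.disj i j (one _) (a • one _) ?_ ?_
      · rw [← h1, ha, map_smul, map_smul, hu]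
      · rw [← h2, ha, map_smul, map_smul, hv]
    · intro j
      obtain ⟨i, y, h1, h2⟩ := C.cover (C'.u j (one _)) (C'.v j (one _)) (C'.comm j (one _))
      exact ⟨i, C'.disj _ _ (θ i y) (one _) ((hθu i y).trans h1) ((hθv i y).trans h2)⟩
  have hs : ∀ i (a : G) h, θ i (a • h) = a • θ i h := fun i a h =>
    C'.inj (e i) _ _ (by rw [hθu, map_smul, map_smul, hθu]) (by rw [hθv, map_smul, map_smul, hθv])
  refine ⟨Equiv.ofBijective e he, fun i => ⟨θ i, hs i⟩, fun i => ⟨?_, ?_⟩,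
    fun i => hom_ext (hθu i), fun i => hom_ext (hθv i)⟩
  · intro h h' e'
    have e' : θ i h = θ i h' := e'
    exact C.inj i h h' (by rw [← hθu, e', hθu]) (by rw [← hθv, e', hθv])
  · exact surjective_of_orbit _

end NormCover

end FinGSet

/-! ## Norms along arbitrary maps -/

namespace NormedGreenFunctor

variable {G : Type u} [Group G] [Finite G] {O : IndexingSystem G} {M : NormedGreenFunctor.{u, w} O}

theorem norm_congr {H K : Subgroup G} {f f' : (orbit H : FinGSet G) →[G] orbit K} (h : f = f')
    (hf : O.Mem f) (hf' : O.Mem f') (x : M.obj (orbit H)) : M.norm f hf x = M.norm f' hf' x := by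
  subst h
  rfl

/-- Stabilizers agree with given subgroups only propositionally; after substitution `f` fixes the
base coset, hence is the identity. -/
theorem norm_res_of_eq {H K : Subgroup G} (h : H = K) (f : (orbit H : FinGSet G) →[G] orbit K)
    (hf : O.Mem f) (h1 : f (one H) = one K) (x : M.obj (orbit K)) :
    M.norm f hf (M.res f x) = x := by
  subst h
  have : f = MulActionHom.id G := orbit_hom_ext h1
  subst this
  rw [M.res_id]
  exact M.norm_id x

/-- The fibre product of a bijective `f` with itself is the diagonal, so the double coset formula
has a single factor, and that factor is a norm along an identity. -/
theorem res_norm_of_bijective {H K : Subgroup G} {f : (orbit H : FinGSet G) →[G] orbit K}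
    (hb : Function.Bijective f) (hf : O.Mem f) (x : M.obj (orbit H)) :
    M.res f (M.norm f hf x) = x := by
  let P : FinGSet G := pullback f f
  let a : {a : P // pullback.fst f f a = one H} := ⟨⟨(one H, one H), rfl⟩, rfl⟩
  have hP : ∀ p q : P, pullback.fst f f p = pullback.fst f f q → p = q := fun p q h =>
    (isPullbackSquare_pullback f f).inj h
      (hb.1 (p.2.symm.trans ((congrArg f h).trans q.2)))
  have e := M.res_norm f f hf x (one H) {a} (by
    intro a'
    have : a' = a := Subtype.ext (hP _ _ (a'.2.trans a.2.symm))
    rw [this]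
    exact ⟨a, ⟨Finset.mem_singleton_self _, MulAction.mem_orbit_self _⟩,
      fun b hb => Finset.mem_singleton.1 hb.1⟩)
  rw [Finset.prod_singleton] at e
  refine GreenFunctor.res_injective_of_bijective (ofPoint_orbit_bijective (one H)) (e.trans ?_)
  -- The projection to the first factor is injective, so it preserves stabilizers.
  have hs : MulAction.stabilizer G a.1 = MulAction.stabilizer G (one H) := by
    refine le_antisymm ?_ fun γ hγ => ?_
    · exact IndexingSystem.stabilizer_le (pullback.fst f f) a.1
    · exact hP _ _ hγ
  have hc : (pullback.snd f f).comp (ofPoint a.1) =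
      (ofPoint (one H)).comp (stabMap (pullback.fst f f) a) := by
    apply orbit_hom_ext
    change pullback.snd f f (ofPoint a.1 (one _)) = ofPoint (one H) (one _)
    rw [ofPoint_one, ofPoint_one]
    rfl
  rw [← M.res_comp, hc, M.res_comp]
  exact norm_res_of_eq hs _ _ rfl _

theorem norm_res_of_bijective {H K : Subgroup G} {f : (orbit H : FinGSet G) →[G] orbit K}
    (hb : Function.Bijective f) (hf : O.Mem f) (x : M.obj (orbit K)) :
    M.norm f hf (M.res f x) = x :=
  GreenFunctor.res_injective_of_bijective hb (res_norm_of_bijective hb hf _)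

section

variable {A B : FinGSet G} {g : A →[G] B} {L : Subgroup G} {k : (orbit L : FinGSet G) →[G] B}

/-- The product of norms defined by a decomposition. -/
noncomputable def val (C : NormCover g k) (hg : O.Mem g) (x : M.obj A) : M.obj (orbit L) :=
  ∏ i, M.norm (C.v i) (C.mem_v hg i) (M.res (C.u i) x)

/-- Two decompositions differ by isomorphisms of orbits, along which norm and restriction are
mutually inverse. -/
theorem val_eq (C C' : NormCover g k) (hg : O.Mem g) (x : M.obj A) :
    val C hg x = val C' hg x := by
  obtain ⟨e, θ, hθ, hu, hv⟩ := C.exists_equiv C'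
  refine Fintype.prod_equiv e _ _ fun i => ?_
  have hm : O.Mem (θ i) := IndexingSystem.mem_of_injective _ (hθ i).1
  rw [norm_congr (hv i).symm _ (IndexingSystem.mem_comp (C'.mem_v hg _) hm), ← hu i, M.res_comp,
    M.norm_comp _ _ (C'.mem_v hg _) hm, norm_res_of_bijective (hθ i)]

/-- The axiom expresses the double coset formula by stabilizers of chosen points; this frees it from
that choice. -/
theorem res_norm_eq_val {H K : Subgroup G} {f : (orbit H : FinGSet G) →[G] orbit K}
    {k : (orbit L : FinGSet G) →[G] orbit K} (C : NormCover f k) (hf : O.Mem f)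
    (x : M.obj (orbit H)) : M.res k (M.norm f hf x) = val C hf x := by
  obtain ⟨s, hs⟩ := exists_representatives (pullback.fst k f) (one L)
  have e := M.res_norm k f hf x (one L) s hs
  have hb := ofPoint_orbit_bijective (one L)
  have hm : O.Mem (ofPoint (one L)) := IndexingSystem.mem_of_injective _ hb.1
  have hj : IsCover fun a : s => ofPoint a.1.1 := by
    have h := isCover_fiberMap (pullback.fst k f) hs
    refine ⟨fun a => ofPoint_injective _, fun a a' x y hxy => h.disj a a' x y ?_, fun p => ?_⟩
    · refine (isPullbackSquare_pullback (ofPoint (one L)) (pullback.fst k f)).inj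
        (hb.1 ?_) hxy
      have h1 := DFunLike.congr_fun (ofPoint_stabMap (pullback.fst k f) a.1) x
      have h2 := DFunLike.congr_fun (ofPoint_stabMap (pullback.fst k f) a'.1) y
      exact h1.trans ((congrArg (pullback.fst k f) hxy).trans h2.symm)
    · obtain ⟨q, hq⟩ := hb.2 (pullback.fst k f p)
      obtain ⟨a, y, hy⟩ := h.cover ⟨(q, p), hq⟩
      exact ⟨a, y, congrArg (fun z => z.1.2) hy⟩
  -- The axiom only gives the restriction along the isomorphism from the orbit of the base coset to
  -- G/L; taking the norm along this isomorphism undoes that restriction.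
  rw [val_eq C (NormCover.ofCover hj), ← norm_res_of_bijective hb hm (M.res k (M.norm f hf x)), e,
    map_prod, val]
  refine (Finset.prod_coe_sort s _).symm.trans (Finset.prod_congr rfl fun a _ => ?_)
  rw [← M.norm_comp, ← M.res_comp]
  exact norm_congr (ofPoint_stabMap (pullback.fst k f) a.1) _ _ _

/-- The double coset formula for each factor gives a decomposition that refines the base change of
`C`. -/
theorem res_val (C : NormCover g k) (hg : O.Mem g) {L' : Subgroup G}
    (m : (orbit L' : FinGSet G) →[G] orbit L) (C' : NormCover g (k.comp m)) (x : M.obj A) :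
    M.res m (val C hg x) = val C' hg x := by
  let D := fun i => NormCover.some (C.v i) m
  rw [val_eq C' (C.refine D), val, map_prod, val]
  refine Eq.trans ?_ (Fintype.prod_sigma _).symm
  refine Finset.prod_congr rfl fun i _ => ?_
  rw [res_norm_eq_val (D i)]
  refine Finset.prod_congr rfl fun j _ => ?_
  rw [← M.res_comp]
  rfl

end

/-- Values prescribed on the orbits of `B` glue by additivity, and `res_val` propagates them to all
maps from orbits. -/
theorem exists_normExt {A B : FinGSet G} (g : A →[G] B) (hg : O.Mem g) (x : M.obj A) :
    ∃ y : M.obj B, ∀ (L : Subgroup G) (k : (orbit L : FinGSet G) →[G] B) (C : NormCover g k),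
      M.res k y = val C hg x := by
  classical
  obtain ⟨ι, _, H, j, hj⟩ := exists_orbit_cover B
  let D := fun i => NormCover.some g (j i)
  -- The sum of the transfers from the orbits has the prescribed restrictions: an orbit returns its
  -- own term, and distinct orbits have empty fibre product.
  refine ⟨∑ i, M.tr (j i) (val (D i) hg x), fun L k C => ?_⟩
  obtain ⟨i, y, hy⟩ := hj.cover (k (one L))
  obtain ⟨m, hm⟩ := exists_lift (j i) (hj.inj i) k (by
    intro q
    obtain ⟨a, rfl⟩ := exists_smul_one q
    exact ⟨a • y, by rw [map_smul, map_smul, hy]⟩)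
  obtain rfl : k = (j i).comp m := hom_ext fun q => (hm q).symm
  have key : M.res (j i) (∑ i, M.tr (j i) (val (D i) hg x)) = val (D i) hg x := by
    rw [map_sum, Finset.sum_eq_single i]
    · exact GreenFunctor.res_tr_of_injective (hj.inj i) _
    · intro i' _ hi'
      have S := isPullbackSquare_pullback (j i) (j i')
      rw [M.res_tr _ _ _ _ S]
      have : IsEmpty (pullback (j i) (j i')) :=
        ⟨fun p => hi' (hj.disj i i' _ _ p.2).symm⟩
      rw [(GreenFunctor.subsingleton_of_isEmpty (M := M.toGreenFunctor)
        (pullback (j i) (j i'))).elim (M.res _ _) 0, map_zero]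
    · exact fun h => (h (Finset.mem_univ i)).elim
  rw [M.res_comp, key]
  exact res_val (D i) hg m C x

/-- The norm along an arbitrary map in `Set_O^G`. -/
noncomputable def normExt {A B : FinGSet G} (g : A →[G] B) (hg : O.Mem g) : M.obj A →* M.obj B :=
  have key : ∀ {y y' : M.obj B}, (∀ (L : Subgroup G) (k : (orbit L : FinGSet G) →[G] B)
      (_ : NormCover g k), M.res k y = M.res k y') → y = y' :=
    fun h => GreenFunctor.ext_orbit fun L k => h L k (NormCover.some g k)
  { toFun := fun x => (exists_normExt g hg x).choose
    map_one' := key fun L k C => by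
      rw [(exists_normExt g hg _).choose_spec L k C]
      simp [val]
    map_mul' := fun x y => key fun L k C => by
      rw [(exists_normExt g hg _).choose_spec L k C, map_mul,
        (exists_normExt g hg _).choose_spec L k C, (exists_normExt g hg _).choose_spec L k C]
      simp [val, Finset.prod_mul_distrib] }

theorem res_normExt {A B : FinGSet G} {g : A →[G] B} (hg : O.Mem g) {L : Subgroup G}
    {k : (orbit L : FinGSet G) →[G] B} (C : NormCover g k) (x : M.obj A) :
    M.res k (normExt g hg x) = val C hg x :=
  (exists_normExt g hg x).choose_spec L k C

/-- One convenient decomposition per map `k` suffices, by independence of the choice. -/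
theorem eq_normExt {A B : FinGSet G} {g : A →[G] B} (hg : O.Mem g) {x : M.obj A} {y : M.obj B}
    (h : ∀ (L : Subgroup G) (k : (orbit L : FinGSet G) →[G] B),
      ∃ C : NormCover g k, M.res k y = val C hg x) : y = normExt g hg x :=
  GreenFunctor.ext_orbit fun L k => by
    obtain ⟨C, hC⟩ := h L k
    rw [hC, res_normExt hg C]

theorem normExt_orbit {H K : Subgroup G} (f : (orbit H : FinGSet G) →[G] orbit K) (hf : O.Mem f)
    (x : M.obj (orbit H)) : normExt f hf x = M.norm f hf x :=
  (eq_normExt hf fun _ k => ⟨NormCover.some f k, res_norm_eq_val _ hf x⟩).symm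

/-- Decomposing the source of `f` over each piece of a decomposition for `g` turns the iterated
product into a single one. -/
theorem normExt_comp {A B C : FinGSet G} (g : B →[G] C) (f : A →[G] B) (hg : O.Mem g)
    (hf : O.Mem f) (x : M.obj A) :
    normExt (g.comp f) (IndexingSystem.mem_comp hg hf) x = normExt g hg (normExt f hf x) := by
  refine (eq_normExt _ fun L k => ?_).symm
  let E := NormCover.some g k
  let D := fun i => NormCover.some f (E.u i)
  refine ⟨E.comp D, ?_⟩
  rw [res_normExt hg E, val, val]
  refine Eq.trans ?_ (Fintype.prod_sigma _).symm
  refine Finset.prod_congr rfl fun i _ => ?_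
  rw [res_normExt hf (D i), val, map_prod]
  refine Finset.prod_congr rfl fun j _ => ?_
  exact (M.norm_comp _ _ _ _ _).symm

theorem res_normExt_square {P X Y Z : FinGSet G} {k : P →[G] X} {h : P →[G] Y} {f : X →[G] Z}
    {g : Y →[G] Z} (S : IsPullbackSquare k h f g) (hg : O.Mem g) (y : M.obj Y) :
    M.res f (normExt g hg y) = normExt k (S.mem_left hg) (M.res h y) := by
  refine eq_normExt _ fun L m => ⟨NormCover.some k m, ?_⟩
  rw [← M.res_comp, res_normExt hg (NormCover.ofSquare S (NormCover.some k m)), val, val]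
  refine Finset.prod_congr rfl fun i _ => ?_
  rw [← M.res_comp]
  rfl

theorem normExt_coprod {A₁ A₂ A B : FinGSet G} {i : A₁ →[G] A} {j : A₂ →[G] A} (h : IsCoprod i j)
    (g : A →[G] B) (hg : O.Mem g) (x : M.obj A) :
    normExt g hg x =
      normExt (g.comp i) (SemiMackey.mem_comp_injective hg h.inj_left) (M.res i x) *
        normExt (g.comp j) (SemiMackey.mem_comp_injective hg h.inj_right) (M.res j x) := by
  refine (eq_normExt _ fun L k => ?_).symm
  let C₁ := NormCover.some (g.comp i) k
  let C₂ := NormCover.some (g.comp j) k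
  refine ⟨NormCover.sum h C₁ C₂, ?_⟩
  rw [map_mul, res_normExt _ C₁, res_normExt _ C₂, val, val, val]
  refine Eq.trans ?_ (Fintype.prod_sum_type (α₁ := C₁.ι) (α₂ := C₂.ι) _).symm
  congr 1
  · refine Finset.prod_congr rfl fun i _ => ?_
    rw [← M.res_comp]
    rfl
  · refine Finset.prod_congr rfl fun i _ => ?_
    rw [← M.res_comp]
    rfl

theorem normExt_id {X : FinGSet G} (x : M.obj X) : normExt (MulActionHom.id G) (PolyCat.mem_id X) x = x := by
  refine (eq_normExt _ fun L k => ?_).symm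
  -- The base change of an identity is an identity of an orbit, which has a decomposition with one
  -- piece.
  have S : IsPullbackSquare (MulActionHom.id G) k k (MulActionHom.id G) :=
    ⟨fun _ => rfl, fun l _ h => ⟨l, ⟨rfl, h⟩, fun _ hp => hp.1⟩⟩
  refine ⟨NormCover.ofSquare S (NormCover.single _), ?_⟩
  rw [val]
  refine Eq.trans ?_ (Fintype.prod_unique (ι := PUnit) _).symm
  exact (M.norm_id _).symm

/-- The product formula over point representatives, in which the axioms are phrased, characterises
the glued norm. -/
theorem isNorm_iff {A B : FinGSet G} (g : A →[G] B) (hg : O.Mem g) (x : M.obj A) (y : M.obj B) :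
    GreenFunctor.IsNorm M.norm g hg x y ↔ y = normExt g hg x := by
  have key : ∀ (b : B) (s : Finset {a : A // g a = b}),
      (∀ a : {a : A // g a = b}, ∃! a', a' ∈ s ∧ a'.1 ∈ MulAction.orbit G a.1) →
      M.res (ofPoint b) (normExt g hg x) =
        ∏ a ∈ s, M.norm (stabMap g a) (mem_stabMap hg a) (M.res (ofPoint a.1) x) := by
    intro b s hs
    rw [res_normExt hg (NormCover.ofCover (isCover_fiberMap g hs))]
    exact Finset.prod_coe_sort s fun a =>
      M.norm (stabMap g a) (mem_stabMap hg a) (M.res (ofPoint a.1) x)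
  constructor
  · intro h
    refine GreenFunctor.ext_ofPoint fun b => ?_
    obtain ⟨s, hs⟩ := exists_representatives g b
    rw [h b s hs, key b s hs]
  · rintro rfl b s hs
    exact key b s hs

end NormedGreenFunctor

namespace NormedGreenFunctor

open PolyCat

variable {G : Type u} [Group G] [Finite G] {O : IndexingSystem G} {M : NormedGreenFunctor.{u, w} O}

/-! ## The action of polynomials -/

/-- The map `T_t N_n R_r` defined by a bispan. -/
noncomputable def actBispan {X Y : FinGSet G} (P : Bispan O X Y) (x : M.obj X) : M.obj Y :=
  M.tr P.t (normExt P.n P.mem (M.res P.r x))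

theorem actBispan_congr {X Y : FinGSet G} {P Q : Bispan O X Y} (h : P.Iso Q) (x : M.obj X) :
    actBispan P x = actBispan Q x := by
  obtain ⟨α, β, hα, hβ, h1, h2, h3⟩ := h
  have e1 : Q.r.comp α = P.r := hom_ext h1
  have e3 : Q.t.comp β = P.t := hom_ext h3
  have S : IsPullbackSquare P.n α β Q.n :=
    (isPullbackSquare_of_bijective hα hβ.1 h2).symm
  rw [actBispan, actBispan, ← e1, ← e3, M.res_comp, M.tr_comp]
  congr 1
  rw [← res_normExt_square S Q.mem]
  exact GreenFunctor.tr_res_of_bijective hβ _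

/-- The action of morphisms of the category of polynomials. -/
noncomputable def act {X Y : PolyCat O} (φ : X ⟶ Y) : M.obj X.set → M.obj Y.set :=
  Quotient.lift (fun P : Bispan O X.set Y.set => actBispan P) (fun _ _ h => funext fun x =>
    actBispan_congr h x) φ

theorem act_RNT {X A B Y : FinGSet G} (r : A →[G] X) (n : A →[G] B) (hn : O.Mem n) (t : B →[G] Y)
    (x : M.obj X) : act (R O r ≫ N n hn ≫ T O t) x = M.tr t (normExt n hn (M.res r x)) := by
  have := homMk_eq (⟨A, B, r, n, t, hn⟩ : Bispan O X Y)
  rw [← this]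
  rfl

theorem exists_RNT {X Y : PolyCat O} (φ : X ⟶ Y) : ∃ (A B : FinGSet G) (r : A →[G] X.set)
    (n : A →[G] B) (hn : O.Mem n) (t : B →[G] Y.set), φ = R O r ≫ N n hn ≫ T O t := by
  obtain ⟨P, rfl⟩ := exists_eq φ
  exact ⟨P.A, P.B, P.r, P.n, P.mem, P.t, homMk_eq P⟩

theorem act_comp_T {X : PolyCat O} {Y Z : FinGSet G} (φ : X ⟶ ⟨Y⟩) (f : Y →[G] Z)
    (x : M.obj X.set) : act (φ ≫ T O f) x = M.tr f (act φ x) := by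
  obtain ⟨A, B, r, n, hn, t, rfl⟩ := exists_RNT φ
  rw [Category.assoc, Category.assoc, ← T_comp]
  refine (act_RNT r n hn (f.comp t) x).trans ((M.tr_comp _ _ _).trans ?_)
  exact congrArg _ (act_RNT r n hn t x).symm

theorem act_R_comp {X Y : FinGSet G} {Z : PolyCat O} (f : Y →[G] X) (φ : ⟨Y⟩ ⟶ Z)
    (x : M.obj X) : act (R O f ≫ φ) x = act φ (M.res f x) := by
  obtain ⟨A, B, r, n, hn, t, rfl⟩ := exists_RNT φ
  rw [← Category.assoc, ← R_comp]
  refine (act_RNT (f.comp r) n hn t x).trans ?_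
  rw [M.res_comp]
  exact (act_RNT r n hn t _).symm

/-- The norm is moved past the restriction in φ by base change and then merged with the norm in φ.
-/
theorem act_N_comp {X Y : FinGSet G} {Z : PolyCat O} (g : X →[G] Y) (hg : O.Mem g) (φ : ⟨Y⟩ ⟶ Z)
    (x : M.obj X) : act (N g hg ≫ φ) x = act φ (normExt g hg x) := by
  obtain ⟨A, B, r, n, hn, t, rfl⟩ := exists_RNT φ
  have S := isPullbackSquare_pullback r g
  rw [← Category.assoc, N_R S, Category.assoc, ← Category.assoc (N _ _), ← N_comp]
  refine (act_RNT _ _ _ t x).trans ((congrArg (M.tr t) ?_).trans (act_RNT r n hn t _).symm)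
  rw [normExt_comp, res_normExt_square S]

theorem act_comp_R {X : PolyCat O} {Y Z : FinGSet G} (φ : X ⟶ ⟨Y⟩) (f : Z →[G] Y)
    (x : M.obj X.set) : act (φ ≫ R O f) x = M.res f (act φ x) := by
  obtain ⟨A, B, r, n, hn, t, rfl⟩ := exists_RNT φ
  have S := isPullbackSquare_pullback f t
  have S' := isPullbackSquare_pullback (pullback.snd f t) n
  have e : (R O r ≫ N n hn ≫ T O t) ≫ R O f = R O (r.comp (pullback.snd (pullback.snd f t) n)) ≫
      N (pullback.fst (pullback.snd f t) n) (S'.mem_left hn) ≫ T O (pullback.fst f t) := by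
    rw [Category.assoc, Category.assoc, T_R O S, ← Category.assoc (N _ _), N_R S', R_comp,
      Category.assoc, Category.assoc]
  rw [e]
  refine (act_RNT _ _ _ _ x).trans ?_
  rw [M.res_comp, ← res_normExt_square S' hn, ← M.res_tr _ _ _ _ S]
  exact congrArg _ (act_RNT r n hn t x).symm

theorem act_N {X Y : FinGSet G} (g : X →[G] Y) (hg : O.Mem g) (x : M.obj X) :
    act (N g hg) x = normExt g hg x := by
  refine (M.tr_id _).trans (congrArg (normExt g hg) (M.res_id x))

/-! ## Distributivity of norms over transfers -/

variable (M) in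
/-- The norm along `g` of a transfer along `p` is computed by the composite polynomial. -/
def Distributes {E A B : FinGSet G} (p : E →[G] A) (g : A →[G] B) (hg : O.Mem g) : Prop :=
  ∀ x : M.obj E, act (T O p ≫ N g hg) x = normExt g hg (M.tr p x)

theorem T_eq_R {X Y : FinGSet G} {f : X →[G] Y} {f' : Y →[G] X} (h : ∀ x, f' (f x) = x)
    (h' : ∀ y, f (f' y) = y) : T O f = R O f' := by
  have hf : Function.Injective f := fun a b e => by rw [← h a, e, h]
  have e1 := T_R O (isPullbackSquare_of_injective f hf)
  have e2 := R_comp O f f'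
  have e3 : f.comp f' = MulActionHom.id G := hom_ext h'
  rw [R_id, T_id, Category.comp_id] at e1
  rw [e3, R_id] at e2
  rw [← Category.comp_id (T O f), e2, ← Category.assoc, e1, Category.id_comp]

theorem tr_eq_res {X Y : FinGSet G} {f : X →[G] Y} {f' : Y →[G] X} (h : ∀ x, f' (f x) = x)
    (h' : ∀ y, f (f' y) = y) (x : M.obj X) : M.tr f x = M.res f' x := by
  have hb : Function.Bijective f := Function.bijective_iff_has_inverse.2 ⟨f', h, h'⟩
  refine GreenFunctor.res_injective_of_bijective hb ?_
  rw [GreenFunctor.res_tr_of_injective hb.1, ← M.res_comp,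
    GreenFunctor.res_congr (f' := MulActionHom.id G) (hom_ext h), M.res_id]

/-- The transfer along an isomorphism is the restriction along its inverse, so no exponential
diagram is needed. -/
theorem distributes_of_bijective {E A B : FinGSet G} {p : E →[G] A} (hp : Function.Bijective p)
    (g : A →[G] B) (hg : O.Mem g) : Distributes M p g hg := by
  obtain ⟨p', -, h1, h2⟩ := exists_inverse p hp
  intro x
  rw [T_eq_R h1 h2, act_R_comp, act_N, tr_eq_res h1 h2]

theorem Distributes.comp_bijective {E E' A B : FinGSet G} {p : E →[G] A} {g : A →[G] B}
    {hg : O.Mem g} (h : Distributes M p g hg) {e : E' →[G] E} (he : Function.Bijective e) :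
    Distributes M (p.comp e) g hg := by
  obtain ⟨e', -, h1, h2⟩ := exists_inverse e he
  intro x
  rw [T_comp, Category.assoc, T_eq_R h1 h2, act_R_comp, M.tr_comp, tr_eq_res h1 h2]
  exact h _

/-- Both sides satisfy base change along `k`; distributivity for the pulled back data gives the
relation after restriction to B'. -/
theorem Distributes.res {E A B A' B' : FinGSet G} {p : E →[G] A} {g : A →[G] B} (hg : O.Mem g)
    {g' : A' →[G] B'} {k' : A' →[G] A} {k : B' →[G] B} (S : IsPullbackSquare g' k' k g)
    (h : Distributes M (pullback.fst k' p) g' (S.mem_left hg)) (x : M.obj E) :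
    M.res k (act (T O p ≫ N g hg) x) = M.res k (normExt g hg (M.tr p x)) := by
  have S' := isPullbackSquare_pullback k' p
  rw [← act_comp_R, Category.assoc, N_R S, ← Category.assoc, T_R O S', Category.assoc, act_R_comp,
    res_normExt_square S, M.res_tr _ _ _ _ S']
  exact h _

/-- Base change along the identity of `B`, with `e` identifying the two sources. -/
theorem Distributes.of_bijective_left {E A B A' : FinGSet G} {p : E →[G] A} {g : A →[G] B}
    {hg : O.Mem g} {e : A' →[G] A} (he : Function.Bijective e)
    (h : Distributes M (pullback.fst e p) (g.comp e) (SemiMackey.mem_comp_injective hg he.1)) :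
    Distributes M p g hg := fun x => by
  have S : IsPullbackSquare (g.comp e) e (MulActionHom.id G) g :=
    (isPullbackSquare_of_bijective (h := g.comp e) (f := g) (g := MulActionHom.id G) he
      (fun _ _ h => h) fun _ => rfl).symm
  have := Distributes.res hg S h x
  rwa [M.res_id, M.res_id] at this

/-- Pasting in the norm direction: the first relation leaves a transfer along the base map of the
dependent product, which the norm along `f` then meets. -/
theorem Distributes.comp {E A B C : FinGSet G} {p : E →[G] A} {g : A →[G] B} {hg : O.Mem g}
    {f : B →[G] C} {hf : O.Mem f} (h : Distributes M p g hg)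
    (h' : Distributes M (depProd.base g p) f hf) :
    Distributes M p (f.comp g) (IndexingSystem.mem_comp hf hg) := by
  intro x
  rw [normExt_comp _ _ hf hg, ← h, N_comp _ _ hf hg, ← Category.assoc, T_N, Category.assoc, Category.assoc,
    act_R_comp, act_N_comp, h', act_RNT]

/-- Pasting in the transfer direction: after the exponential diagram of `q`, the transfer along `p`
is base changed along the evaluation map and meets a norm over the dependent product. -/
theorem Distributes.comp_left {E E' A B : FinGSet G} {q : E →[G] A} {p : E' →[G] E} {g : A →[G] B}
    {hg : O.Mem g} (h : Distributes M q g hg)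
    (h' : Distributes M (pullback.fst (depProd.eval g q) p)
      (pullback.snd g (depProd.base g q)) (mem_pullback_snd hg _)) :
    Distributes M (q.comp p) g hg := by
  intro x
  have S := isPullbackSquare_pullback (depProd.eval g q) p
  rw [M.tr_comp, ← h, T_comp, Category.assoc, T_N, ← Category.assoc, T_R O S, Category.assoc,
    act_R_comp, ← Category.assoc, act_comp_T, h', act_RNT, M.res_tr _ _ _ _ S]

/-- Every element is the sum of the transfers of its two components; the cross terms vanish because
the summands have empty fibre product. -/
theorem tr_coprod {X Y Z W : FinGSet G} {i : X →[G] Z} {j : Y →[G] Z} (h : IsCoprod i j)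
    (f : Z →[G] W) (z : M.obj Z) :
    M.tr f z = M.tr (f.comp i) (M.res i z) + M.tr (f.comp j) (M.res j z) := by
  have h1 : ∀ x, M.res i (M.tr j x) = 0 := fun x => by
    have : IsEmpty (pullback i j) := ⟨fun p => h.disj _ _ p.2⟩
    rw [M.res_tr _ _ _ _ (isPullbackSquare_pullback i j),
      (GreenFunctor.subsingleton_of_isEmpty (M := M.toGreenFunctor) (pullback i j)).elim
        (M.res _ _) 0, map_zero]
  have h2 : ∀ x, M.res j (M.tr i x) = 0 := fun x => by
    have : IsEmpty (pullback j i) := ⟨fun p => h.disj _ _ p.2.symm⟩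
    rw [M.res_tr _ _ _ _ (isPullbackSquare_pullback j i),
      (GreenFunctor.subsingleton_of_isEmpty (M := M.toGreenFunctor) (pullback j i)).elim
        (M.res _ _) 0, map_zero]
  have e : z = M.tr i (M.res i z) + M.tr j (M.res j z) := by
    refine GreenFunctor.ext_coprod h ?_ ?_
    · rw [map_add, GreenFunctor.res_tr_of_injective h.inj_left, h1, add_zero]
    · rw [map_add, GreenFunctor.res_tr_of_injective h.inj_right, h2, zero_add]
  conv_lhs => rw [e]
  rw [map_add, M.tr_comp, M.tr_comp]

theorem tr_fold {X : FinGSet G} (c : M.obj (X.sum X)) :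
    M.tr (fold X) c = M.res (inl X X) c + M.res (inr X X) c :=
  (tr_coprod (isCoprod_sum X X) (fold X) c).trans
    (congrArg₂ (· + ·) (M.tr_id _) (M.tr_id _))

theorem normExt_fold {X : FinGSet G} (c : M.obj (X.sum X)) :
    normExt (fold X) (mem_fold X) c = M.res (inl X X) c * M.res (inr X X) c :=
  (normExt_coprod (isCoprod_sum X X) (fold X) (mem_fold X) c).trans
    (congrArg₂ (· * ·) (normExt_id _) (normExt_id _))

theorem tr_mul_tr {X X' Y : FinGSet G} (p : X →[G] Y) (q : X' →[G] Y) (x : M.obj X)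
    (y : M.obj X') : M.tr p x * M.tr q y =
      M.tr (p.comp (pullback.fst p q))
        (M.res (pullback.fst p q) x * M.res (pullback.snd p q) y) := by
  rw [mul_comm, M.frobenius, M.res_tr _ _ _ _ (isPullbackSquare_pullback p q), mul_comm,
    M.frobenius, ← M.tr_comp]

/-- The norm along a fold map is a product, and Frobenius reciprocity gives the product of two
transfers as one transfer from the fibre product. -/
theorem distributes_sumMap_fold {X X' Y : FinGSet G} (p : X →[G] Y) (q : X' →[G] Y) :
    Distributes M (sumMap p q) (fold Y) (mem_fold Y) := by
  intro x
  rw [T_N_fold, act_RNT, normExt_fold, normExt_fold, M.res_tr _ _ _ _ (isPullbackSquare_inl p q),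
    M.res_tr _ _ _ _ (isPullbackSquare_inr p q), tr_mul_tr, ← M.res_comp, ← M.res_comp,
    ← M.res_comp, ← M.res_comp]
  rfl

/-- Any set over Y ⊔ Y splits, so `q` is a disjoint union of two maps up to an isomorphism of its
source. -/
theorem distributes_fold {E Y : FinGSet G} (q : E →[G] Y.sum Y) :
    Distributes M q (fold Y) (mem_fold Y) := by
  have hb := (isCoprod_pullback q).bijective
  obtain ⟨e, he, -, h2⟩ := exists_inverse _ hb
  have h := (distributes_sumMap_fold (M := M) (pullback.snd q (inl Y Y))
    (pullback.snd q (inr Y Y))).comp_bijective he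
  have hq : (sumMap (pullback.snd q (inl Y Y)) (pullback.snd q (inr Y Y))).comp e = q := by
    refine hom_ext fun x => ?_
    have key : ∀ z, sumMap (pullback.snd q (inl Y Y)) (pullback.snd q (inr Y Y)) z =
        q (sumDesc (pullback.fst q (inl Y Y)) (pullback.fst q (inr Y Y)) z) := by
      rintro (z | z)
      · exact z.2.symm
      · exact z.2.symm
    exact (key (e x)).trans (congrArg q (h2 x))
  rwa [hq] at h

/-- Translates the reciprocity axioms into statements about composite polynomials. -/
theorem eq_of_isExponential {E A B : FinGSet G} {g : A →[G] B} {hg : O.Mem g} {p : E →[G] A}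
    {x : M.obj E} {z : M.obj B} (h : GreenFunctor.IsExponential M.norm g hg p x z) :
    z = act (T O p ≫ N g hg) x := by
  obtain ⟨y, hy, rfl⟩ := h
  rw [isNorm_iff] at hy
  rw [T_N, act_RNT, hy]

theorem distributes_fold_orbit {H K : Subgroup G} (f : (orbit H : FinGSet G) →[G] orbit K)
    (hf : O.Mem f) : Distributes M (fold (orbit H)) f hf := fun x => by
  rw [normExt_orbit, tr_fold]
  exact (eq_of_isExponential (M.norm_add f hf _ _ x rfl rfl)).symm

theorem distributes_orbit {L H K : Subgroup G} (q : (orbit L : FinGSet G) →[G] orbit H)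
    (f : (orbit H : FinGSet G) →[G] orbit K) (hf : O.Mem f) : Distributes M q f hf := fun x => by
  rw [normExt_orbit]
  exact (eq_of_isExponential (M.norm_tr f hf q x)).symm

end NormedGreenFunctor

theorem Nat.card_lt_of_injective_of_notMem_range {α β : Type*} [Finite β] (f : α → β)
    (hf : Function.Injective f) {b : β} (hb : b ∉ Set.range f) : Nat.card α < Nat.card β := by
  rw [Nat.card_congr (Equiv.ofInjective f hf)]
  exact Finite.card_subtype_lt hb

namespace NormedGreenFunctor

open PolyCat

variable {G : Type u} [Group G] [Finite G] {O : IndexingSystem G} {M : NormedGreenFunctor.{u, w} O}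

/-! ## Norms of zero -/

/-- A constant section of the dependent product of a fold map. -/
def constSec {A B : FinGSet G} (f : A →[G] B) (i : A →[G] A.sum A) (hi : ∀ a, fold A (i a) = a) :
    B →[G] depProd f (fold A) where
  toFun b := ⟨b, fun c _ => i c, fun c _ => hi c⟩
  map_smul' a b := PiPt.ext' rfl fun c _ hy => by
    have : ∀ d, a • d = c → i c = a • i d := by
      rintro d rfl
      exact map_smul i a d
    exact this (a⁻¹ • c) (smul_inv_smul a c)

omit [Finite G] in
-- Restricting the norm of an exponential diagram to a section of the dependent product gives back
-- the norm along `f`.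
theorem isPullbackSquare_section {A B D : FinGSet G} (f : A →[G] B) (b : D →[G] B) (s : B →[G] D)
    (hs : ∀ x, b (s x) = x) : ∃ h : A →[G] pullback f b,
      IsPullbackSquare f h s (pullback.snd f b) := by
  refine ⟨⟨fun a => ⟨(a, s (f a)), (hs _).symm⟩, fun γ a => Subtype.ext (Prod.ext rfl ?_)⟩,
    fun _ => rfl, ?_⟩
  · exact (congrArg s (map_smul f γ a)).trans (map_smul s γ _)
  · rintro x ⟨⟨a, d⟩, h⟩ e
    have e : s x = d := e
    have h : f a = b d := h
    subst e
    rw [hs] at h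
    subst h
    exact ⟨a, ⟨rfl, rfl⟩, fun p hp => congrArg (fun z => z.1.1) hp.2⟩

/-- The sum axiom for 0 + 0 = 0, by induction on a bound for the fibres. Surjectivity is essential:
over points with empty fibre the norm is an empty product, that is 1. -/
theorem normExt_zero {A B : FinGSet G} (g : A →[G] B) (hg : O.Mem g)
    (hs : Function.Surjective g) : normExt (M := M) g hg 0 = 0 := by
  obtain ⟨n, hn⟩ : ∃ n, ∀ b, Nat.card {a // g a = b} ≤ n :=
    ⟨Nat.card A, fun b => Finite.card_subtype_le _⟩
  induction n using Nat.strong_induction_on generalizing A B with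
  | _ n ih =>
  have key : ∀ {H K : Subgroup G} (f : (orbit H : FinGSet G) →[G] orbit K) (hf : O.Mem f),
      (∀ b, Nat.card {a // f a = b} ≤ n) → M.norm f hf 0 = 0 := by
    intro H K f hf hn
    let X : FinGSet G := orbit H
    let Y : FinGSet G := orbit K
    have hsf : Function.Surjective f := surjective_of_orbit f
    let c₀ := constSec f (inl X X) fun _ => rfl
    let c₁ := constSec f (inr X X) fun _ => rfl
    -- The two constant sections are disjoint because `f` has nonempty fibres.
    have hc : Function.Injective (sumDesc c₀ c₁) := by
      have h1 : ∀ x y : Y, c₀ x = c₁ y → False := by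
        intro x y h
        obtain ⟨a, rfl⟩ := hsf x
        have hy : f a = y := congrArg PiPt.base h
        exact Sum.inl_ne_inr (PiPt.sec_congr h rfl rfl hy)
      rintro (x | x) (y | y) h
      · exact congrArg Sum.inl (congrArg PiPt.base h)
      · exact (h1 x y h).elim
      · exact (h1 y x h.symm).elim
      · exact congrArg Sum.inr (congrArg PiPt.base h)
    obtain ⟨S, hS, hcop, hmem⟩ := isCoprod_compl (sumDesc c₀ c₁) hc
    let b := depProd.base f (fold X)
    let s := pullback.snd f b
    have hsm : O.Mem s := mem_pullback_snd hf _
    let y : M.obj (depProd f (fold X)) := normExt s hsm 0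
    have hy₀ : M.res c₀ y = M.norm f hf 0 := by
      obtain ⟨h, S⟩ := isPullbackSquare_section f b c₀ fun _ => rfl
      rw [res_normExt_square S hsm, map_zero, normExt_orbit]
    have hy₁ : M.res c₁ y = M.norm f hf 0 := by
      obtain ⟨h, S⟩ := isPullbackSquare_section f b c₁ fun _ => rfl
      rw [res_normExt_square S hsm, map_zero, normExt_orbit]
    -- Over the nonconstant sections, the norm is a product over the points with value in the left
    -- copy and those with value in the right copy. The left factor vanishes by induction.
    have hyS : M.res (sub.incl S hS) y = 0 := by
      have Sq := isPullbackSquare_pullback (sub.incl S hS) s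
      let ev := (depProd.eval f (fold X)).comp (pullback.snd (sub.incl S hS) s)
      rw [res_normExt_square Sq hsm, map_zero, normExt_coprod (isCoprod_pullback ev), map_zero]
      -- The left points of σ form a subset of a fibre of `f`; it is proper because σ, not being
      -- constantly left, takes a right value somewhere.
      have hlt : ∀ σ : sub S hS, Nat.card {a // ((pullback.fst (sub.incl S hS) s).comp
          (pullback.fst ev (inl X X))) a = σ} < Nat.card {a // f a = σ.1.base} := by
        intro σ
        have hex : ∃ (a : X) (ha : f a = σ.1.base) (x : X), σ.1.sec a ha = Sum.inr x := by
          by_contra hne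
          refine (hmem σ.1).1 σ.2 (Sum.inl σ.1.base) (PiPt.ext' rfl fun c hx hy => ?_)
          have hp := σ.1.p_sec c hy
          rcases e : σ.1.sec c hy with x | x
          · rw [e] at hp
            exact congrArg Sum.inl (show c = x from hp.symm)
          · exact (hne ⟨c, hy, x, e⟩).elim
        obtain ⟨a₁, ha₁, x₁, hx₁⟩ := hex
        refine Nat.card_lt_of_injective_of_notMem_range
          (fun q => ⟨q.1.1.1.1.2.1.1, ?_⟩) ?_ (b := ⟨a₁, ha₁⟩) ?_
        · have h1 := q.1.1.1.1.2.2
          have h2 := q.1.1.1.2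
          have h3 : q.1.1.1.1.1 = σ := q.2
          rw [h3] at h2
          exact h1.trans (congrArg PiPt.base h2.symm)
        · intro q q' hq
          have hq : q.1.1.1.1.2.1.1 = q'.1.1.1.1.2.1.1 := congrArg Subtype.val hq
          have h3 : q.1.1.1.1.1 = σ := q.2
          have h3' : q'.1.1.1.1.1 = σ := q'.2
          have h4 : q.1.1.1.1 = q'.1.1.1.1 := by
            refine Prod.ext (h3.trans h3'.symm) (Subtype.ext (Prod.ext hq ?_))
            have e1 := q.1.1.1.2
            have e2 := q'.1.1.1.2
            rw [h3] at e1
            rw [h3'] at e2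
            exact e1.symm.trans e2
          have h5 : q.1.1.1 = q'.1.1.1 := Subtype.ext h4
          refine Subtype.ext (Subtype.ext (Prod.ext h5 (Sum.inl_injective (β := X.carrier) ?_)))
          exact q.1.2.symm.trans ((congrArg ev h5).trans q'.1.2)
        · rintro ⟨q, hq⟩
          have hq : q.1.1.1.1.2.1.1 = a₁ := congrArg Subtype.val hq
          have h3 : q.1.1.1.1.1 = σ := q.2
          have e1 : q.1.1.1.1.1.1 = q.1.1.1.1.2.1.2 := q.1.1.1.2
          rw [h3] at e1
          have e2 : q.1.1.1.1.2.1.2.sec q.1.1.1.1.2.1.1 q.1.1.1.1.2.2 = Sum.inl q.1.1.2 := q.1.2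
          have e3 := PiPt.sec_congr e1 hq.symm ha₁ q.1.1.1.1.2.2
          exact Sum.inl_ne_inr (e2.symm.trans (e3.symm.trans hx₁))
      rw [ih (n - 1)]
      · exact zero_mul _
      · obtain ⟨a, ha⟩ := hsf (one K)
        have : Nonempty {a // f a = one K} := ⟨⟨a, ha⟩⟩
        exact Nat.sub_lt (Nat.card_pos.trans_le (hn (one K))) one_pos
      -- The left points still surject, since σ is not constantly right either.
      · intro σ
        have hex : ∃ (a : X) (ha : f a = σ.1.base) (x : X), σ.1.sec a ha = Sum.inl x := by
          by_contra hne
          refine (hmem σ.1).1 σ.2 (Sum.inr σ.1.base) (PiPt.ext' rfl fun c hx hy => ?_)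
          have hp := σ.1.p_sec c hy
          rcases e : σ.1.sec c hy with x | x
          · exact (hne ⟨c, hy, x, e⟩).elim
          · rw [e] at hp
            exact congrArg Sum.inr (show c = x from hp.symm)
        obtain ⟨a, ha, x, hx⟩ := hex
        exact ⟨⟨(⟨(σ, ⟨(a, σ.1), ha⟩), rfl⟩, x), hx⟩, rfl⟩
      · exact fun σ => Nat.le_sub_one_of_lt ((hlt σ).trans_le (hn _))
    have e := distributes_fold_orbit (M := M) f hf 0
    rw [map_zero, T_N, act_RNT, map_zero, tr_coprod hcop, tr_coprod (isCoprod_sum Y Y),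
      ← M.res_comp, ← M.res_comp, normExt_orbit] at e
    -- The transfer from the dependent product is split over the two constant sections and the rest.
    have e' : M.norm f hf 0 + M.norm f hf 0 + M.tr (b.comp (sub.incl S hS))
        (M.res (sub.incl S hS) y) = M.norm f hf 0 := by
      refine Eq.trans ?_ e
      congr 2
      · exact hy₀.symm.trans (M.tr_id _).symm
      · exact hy₁.symm.trans (M.tr_id _).symm
    rw [hyS, map_zero (M.tr _), add_zero] at e'
    exact add_eq_left.1 e'
  refine GreenFunctor.ext_orbit fun L k => ?_
  let C := NormCover.some g k
  rw [res_normExt hg C, val, map_zero]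
  -- Surjectivity makes the product nonempty, so a single vanishing factor is enough.
  obtain ⟨a, ha⟩ := hs (k (one L))
  obtain ⟨i, -⟩ := C.cover a (one L) ha
  refine Finset.prod_eq_zero (Finset.mem_univ i) ?_
  rw [map_zero (M.res (C.u i))]
  refine key _ _ fun l => le_trans ?_ (hn (k l))
  refine Nat.card_le_card_of_injective
    (fun h : {h // C.v i h = l} => (⟨C.u i h.1, by rw [C.comm, h.2]⟩ : {a // g a = k l})) ?_
  intro h h' e
  exact Subtype.ext (C.inj i _ _ (congrArg Subtype.val e) (h.2.trans h'.2.symm))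

end NormedGreenFunctor

namespace NormedGreenFunctor

open PolyCat

variable {G : Type u} [Group G] [Finite G] {O : IndexingSystem G} {M : NormedGreenFunctor.{u, w} O}

/-! ## Norms distribute over transfers -/

omit [Finite G] in
-- A bound on the fibres of the transfer map survives base change. It is therefore a usable
-- induction parameter, unlike the size of E.
theorem card_fiber_pullback_le {E A A' : FinGSet G} (p : E →[G] A) (k : A' →[G] A) {n : ℕ}
    (hp : ∀ a, Nat.card {e // p e = a} ≤ n) (a' : A') :
    Nat.card {e // pullback.fst k p e = a'} ≤ n := by
  refine le_trans ?_ (hp (k a'))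
  refine Nat.card_le_card_of_injective (fun e : {e // pullback.fst k p e = a'} =>
    (⟨e.1.1.2, e.1.2.symm.trans (congrArg k e.2)⟩ : {e // p e = k a'})) fun e e' h => ?_
  exact Subtype.ext ((isPullbackSquare_pullback k p).inj (e.2.trans e'.2.symm)
    (congrArg Subtype.val h))

/-- Distributivity over transfers with fibres of bounded size may be checked on orbits. -/
theorem distributes_of_orbit (n : ℕ)
    (h : ∀ {H K : Subgroup G} (f : (orbit H : FinGSet G) →[G] orbit K) (hf : O.Mem f)
      {E : FinGSet G} (p : E →[G] (orbit H : FinGSet G)), (∀ a, Nat.card {e // p e = a} ≤ n) →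
      Distributes M p f hf)
    {E A B : FinGSet G} (p : E →[G] A) (g : A →[G] B) (hg : O.Mem g)
    (hp : ∀ a, Nat.card {e // p e = a} ≤ n) : Distributes M p g hg := by
  -- The case of an orbit as target, by induction on the cardinality of `A`.
  have key : ∀ (m : ℕ) {K : Subgroup G} {E A : FinGSet G} (p : E →[G] A)
      (g : A →[G] (orbit K : FinGSet G)) (hg : O.Mem g), (∀ a, Nat.card {e // p e = a} ≤ n) →
      Nat.card A = m → Distributes M p g hg := by
    intro m
    induction m using Nat.strong_induction_on with
    | _ m ih =>
    intro K E A p g hg hp hA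
    rcases isEmpty_or_nonempty A with hE | ⟨⟨a⟩⟩
    · exact distributes_of_bijective ⟨fun e => isEmptyElim (p e), fun a => isEmptyElim a⟩ g hg
    · obtain ⟨S, hS, hc, hmem⟩ := isCoprod_compl (ofPoint a) (ofPoint_injective a)
      by_cases hsurj : Function.Surjective (ofPoint a)
      · exact Distributes.of_bijective_left ⟨ofPoint_injective a, hsurj⟩
          (h _ _ _ (card_fiber_pullback_le p _ hp))
      · obtain ⟨x, hx⟩ := not_forall.1 hsurj
        have hg₁ := SemiMackey.mem_comp_injective hg hc.inj_left
        have hg₂ := SemiMackey.mem_comp_injective hg hc.inj_right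
        have hm := mem_sumMap hg₁ hg₂
        have hp' := card_fiber_pullback_le p (sumDesc (ofPoint a) (sub.incl S hS)) hp
        -- Over the target G/K ⊔ G/K each summand can be checked separately, with a strictly smaller
        -- source.
        have h1 : Distributes M (pullback.fst (sumDesc (ofPoint a) (sub.incl S hS)) p)
            (sumMap (g.comp (ofPoint a)) (g.comp (sub.incl S hS))) hm := by
          intro x
          refine GreenFunctor.ext_coprod (isCoprod_sum _ _) ?_ ?_
          · refine Distributes.res hm (isPullbackSquare_inl _ _) ?_ x
            refine ih _ ?_ _ _ _ (card_fiber_pullback_le _ _ hp') rfl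
            rw [← hA]
            exact Nat.card_lt_of_injective_of_notMem_range (ofPoint a) (ofPoint_injective a) hx
          · refine Distributes.res hm (isPullbackSquare_inr _ _) ?_ x
            refine ih _ ?_ _ _ _ (card_fiber_pullback_le _ _ hp') rfl
            rw [← hA]
            refine Finite.card_subtype_lt (x := a) fun ha => ?_
            exact (hmem _).1 ha (one _) (ofPoint_one _)
        refine Distributes.of_bijective_left hc.bijective ?_
        -- The fold map back to G/K distributes over any transfer, so the fibre bound need not hold
        -- for the intermediate dependent product.
        have h2 := h1.comp (distributes_fold (M := M) _)
        have e : (fold (orbit K)).comp (sumMap (g.comp (ofPoint a)) (g.comp (sub.incl S hS))) =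
            g.comp (sumDesc (ofPoint a) (sub.incl S hS)) := by
          refine hom_ext ?_
          rintro (x | x) <;> rfl
        simp only [e] at h2
        exact h2
  intro x
  refine GreenFunctor.ext_orbit fun L k => ?_
  exact Distributes.res hg (isPullbackSquare_pullback k g)
    (key _ _ _ _ (card_fiber_pullback_le p _ hp) rfl) x

/-- Norms distribute over transfers. -/
theorem distributes {E A B : FinGSet G} (p : E →[G] A) (g : A →[G] B) (hg : O.Mem g) :
    Distributes M p g hg := by
  obtain ⟨n, hn⟩ : ∃ n, ∀ a, Nat.card {e // p e = a} ≤ n :=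
    ⟨Nat.card E, fun b => Finite.card_subtype_le _⟩
  induction n using Nat.strong_induction_on generalizing E A B with
  | _ n ih =>
  refine distributes_of_orbit n ?_ p g hg hn
  clear hn
  intro H K f hf E p hp
  rcases isEmpty_or_nonempty E with hE | ⟨⟨e₀⟩⟩
  · intro x
    have hsf : Function.Surjective f := surjective_of_orbit f
    -- Sections over the nonempty fibres of `f` would give points of `E`. Hence the polynomial side
    -- is 0, and the other side is N(0).
    have : IsEmpty (depProd f p) := ⟨fun z => by
      obtain ⟨a, ha⟩ := hsf z.base
      exact isEmptyElim (z.sec a ha)⟩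
    have e1 : x = 0 := (GreenFunctor.subsingleton_of_isEmpty (M := M.toGreenFunctor) E).elim _ _
    rw [T_N, act_RNT, e1, map_zero (M.tr _), normExt_zero f hf hsf,
      (GreenFunctor.subsingleton_of_isEmpty (M := M.toGreenFunctor) (depProd f p)).elim
        (normExt _ _ _) 0, map_zero]
  · obtain ⟨S, hS, hc, hmem⟩ := isCoprod_compl (ofPoint e₀) (ofPoint_injective e₀)
    by_cases hsurj : Function.Surjective (ofPoint e₀)
    · obtain ⟨j, hj, -, h2⟩ := exists_inverse (ofPoint e₀) ⟨ofPoint_injective e₀, hsurj⟩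
      have h := (distributes_orbit (M := M) (p.comp (ofPoint e₀)) f hf).comp_bijective hj
      have e : (p.comp (ofPoint e₀)).comp j = p := hom_ext fun x => congrArg p (h2 x)
      rwa [e] at h
    · obtain ⟨e₁, he₁⟩ := not_forall.1 hsurj
      have : Nonempty (sub S hS) := ⟨⟨e₁, (hmem e₁).2 fun y hy => he₁ ⟨y, hy⟩⟩⟩
      let p₁ := p.comp (ofPoint e₀)
      let p₂ := p.comp (sub.incl S hS)
      have hs₁ : Function.Surjective p₁ := surjective_of_orbit p₁
      have hs₂ : Function.Surjective p₂ := surjective_of_orbit p₂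
      obtain ⟨j, hj, -, h2⟩ := exists_inverse _ hc.bijective
      have hcomp : ∀ z, fold (orbit H) (sumMap p₁ p₂ z) =
          p (sumDesc (ofPoint e₀) (sub.incl S hS) z) := by
        rintro (z | z) <;> rfl
      have e : ((fold (orbit H)).comp (sumMap p₁ p₂)).comp j = p :=
        hom_ext fun x => (hcomp (j x)).trans (congrArg p (h2 x))
      -- The fibre of p₁ ⊔ p₂ over one copy of a point omits the part of the fibre of `p` that lies
      -- over the other copy, which is nonempty since p₁ and p₂ are both surjective.
      have hlt : ∀ c : (orbit H : FinGSet G).sum (orbit H),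
          Nat.card {z // sumMap p₁ p₂ z = c} < Nat.card {z // p z = fold (orbit H) c} := by
        intro c
        have hex : ∃ z, p (sumDesc (ofPoint e₀) (sub.incl S hS) z) = fold (orbit H) c ∧
            sumMap p₁ p₂ z ≠ c := by
          rcases c with c | c
          · obtain ⟨z, hz⟩ := hs₂ c
            exact ⟨Sum.inr z, hz, Sum.inr_ne_inl⟩
          · obtain ⟨z, hz⟩ := hs₁ c
            exact ⟨Sum.inl z, hz, Sum.inl_ne_inr⟩
        obtain ⟨z, hz, hzc⟩ := hex
        refine Nat.card_lt_of_injective_of_notMem_range (fun z : {z // sumMap p₁ p₂ z = c} =>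
          (⟨sumDesc (ofPoint e₀) (sub.incl S hS) z.1, by rw [← hcomp, z.2]⟩ :
            {z // p z = fold (orbit H) c})) ?_ (b := ⟨_, hz⟩) ?_
        · exact fun x y h => Subtype.ext (hc.bijective.1 (congrArg Subtype.val h))
        · rintro ⟨x, hx⟩
          have : x.1 = z := hc.bijective.1 (congrArg Subtype.val hx)
          exact hzc (this ▸ x.2)
      rw [← e]
      refine Distributes.comp_bijective ?_ hj
      -- The sum axiom handles the fold map. The remaining norm need not be between orbits, so the
      -- induction hypothesis must cover all norms.
      refine (distributes_fold_orbit f hf).comp_left ?_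
      have hpos : 0 < n := by
        refine lt_of_lt_of_le ?_ (hp (p e₀))
        have : Nonempty {z // p z = p e₀} := ⟨⟨e₀, rfl⟩⟩
        exact Nat.card_pos
      refine ih (n - 1) (Nat.sub_lt hpos one_pos) _ _ _ ?_
      exact card_fiber_pullback_le _ _ fun c =>
        Nat.le_sub_one_of_lt ((hlt c).trans_le (hp _))

/-! ## The Tambara functor of a Green functor with norms -/

/-- Write ψ as T N R. Absorb R into φ and rewrite the result as T' N' R'; then only T' followed by N
has to be exchanged, which is `distributes`. -/
theorem act_comp {X Y Z : PolyCat O} (φ : X ⟶ Y) (ψ : Y ⟶ Z) (x : M.obj X.set) :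
    act (φ ≫ ψ) x = act ψ (act φ x) := by
  obtain ⟨A, B, r, n, hn, t, rfl⟩ := exists_RNT ψ
  obtain ⟨A', B', r', n', hn', t', h⟩ := exists_RNT (φ ≫ R O r)
  rw [← Category.assoc, ← Category.assoc]
  refine (act_comp_T _ _ _).trans ?_
  rw [act_RNT, ← act_comp_R, h, act_RNT, ← distributes t' n hn, Category.assoc, Category.assoc,
    act_R_comp, act_N_comp]

variable (M) in
/-- The functor on polynomials defined by a Green functor with norms. -/
noncomputable def polyFunctor : PolyCat O ⥤ Type w where
  obj X := M.obj X.set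
  map φ := TypeCat.ofHom (act φ)
  map_id X := by
    ext x
    exact (act_N (MulActionHom.id G) (PolyCat.mem_id X.set) x).trans (normExt_id x)
  map_comp φ ψ := by
    ext x
    exact act_comp φ ψ x

theorem polyFunctor_R {X Y : FinGSet G} (f : X →[G] Y) (y : M.obj Y) :
    (polyFunctor M).map (R O f) y = M.res f y :=
  (M.tr_id _).trans (normExt_id _)

theorem polyFunctor_T {X Y : FinGSet G} (f : X →[G] Y) (x : M.obj X) :
    (polyFunctor M).map (T O f) x = M.tr f x :=
  congrArg (M.tr f) ((normExt_id _).trans (M.res_id _))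

theorem polyFunctor_N {X Y : FinGSet G} (f : X →[G] Y) (hf : O.Mem f) (x : M.obj X) :
    (polyFunctor M).map (N f hf) x = normExt f hf x :=
  act_N f hf x

variable (M) in
theorem preservesFiniteProducts_polyFunctor : Limits.PreservesFiniteProducts (polyFunctor M) := by
  have := M.additive_empty
  have h := preservesFiniteProducts_of_bijective (polyFunctor M) ?_
    ⟨⟨(0 : M.obj empty)⟩, fun a => this.elim (α := M.obj empty) _ _⟩
  · exact h
  · intro X Y
    refine Eq.mp (congrArg Function.Bijective (funext fun c => ?_)) (M.additive X Y)
    exact Prod.ext (polyFunctor_R (inl X Y) c).symm (polyFunctor_R (inr X Y) c).symm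

theorem isSum_polyFunctor {X : FinGSet G} (a b : M.obj X) : IsSum (polyFunctor M) a b (a + b) := by
  obtain ⟨c, hc⟩ := (M.additive X X).2 (a, b)
  have h1 : M.res (inl X X) c = a := congrArg Prod.fst hc
  have h2 : M.res (inr X X) c = b := congrArg Prod.snd hc
  refine ⟨c, (polyFunctor_R _ _).trans h1, (polyFunctor_R _ _).trans h2,
    (polyFunctor_T _ _).trans ?_⟩
  rw [tr_fold, h1, h2]

theorem isProd_polyFunctor {X : FinGSet G} (a b : M.obj X) :
    IsProd (polyFunctor M) a b (a * b) := by
  obtain ⟨c, hc⟩ := (M.additive X X).2 (a, b)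
  have h1 : M.res (inl X X) c = a := congrArg Prod.fst hc
  have h2 : M.res (inr X X) c = b := congrArg Prod.snd hc
  refine ⟨c, (polyFunctor_R _ _).trans h1, (polyFunctor_R _ _).trans h2,
    (polyFunctor_N _ _ _).trans ?_⟩
  rw [normExt_fold, h1, h2]

variable (M) in
theorem isZero_polyFunctor (X : FinGSet G) : IsZero (polyFunctor M) (0 : M.obj X) :=
  ⟨(0 : M.obj empty), (polyFunctor_T _ _).trans (map_zero (M.tr (fromEmpty X)))⟩

variable (M) in
theorem isOne_polyFunctor (X : FinGSet G) : IsOne (polyFunctor M) (1 : M.obj X) :=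
  ⟨(1 : M.obj empty), (polyFunctor_N _ (mem_fromEmpty X) _).trans
    (map_one (normExt (M := M) (fromEmpty X) (mem_fromEmpty X)))⟩

variable (M) in
/-- The Tambara functor of a Green functor with norms. -/
noncomputable def toTambara : TambaraFunctor.{u, w} O where
  obj := polyFunctor M
  property := by
    refine ⟨preservesFiniteProducts_polyFunctor M, fun X (a : M.obj X) =>
      ⟨(-a : M.obj X), (0 : M.obj X), isZero_polyFunctor M X, ?_⟩⟩
    have := isSum_polyFunctor a (-a)
    rwa [add_neg_cancel] at this

variable (M) in
/-- The Green functor underlying the Tambara functor of `M` is `M`. -/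
noncomputable def homToTambara :
    NormedGreenFunctor.Hom M (TambaraFunctor.toNormedGreen (toTambara M)) :=
  haveI := preservesFiniteProducts_polyFunctor M
  { app := fun X =>
      { toFun := fun x => x
        map_one' := TambaraFunctor.IsOne.eq (isOne_polyFunctor M X)
        map_mul' := fun a b => TambaraFunctor.IsProd.eq (isProd_polyFunctor a b)
        map_zero' := TambaraFunctor.IsZero.eq (isZero_polyFunctor M X)
        map_add' := fun a b => TambaraFunctor.IsSum.eq (isSum_polyFunctor a b) }
    app_res := fun f y => (polyFunctor_R f y).symm
    app_tr := fun f x => (polyFunctor_T f x).symm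
    app_norm := fun f hf x => ((polyFunctor_N f hf x).trans (normExt_orbit f hf x)).symm }

/-- A map of Green functors with norms that is bijective on values is an isomorphism. -/
noncomputable def isoOfBijective {M M' : NormedGreenFunctor.{u, w} O} (φ : M ⟶ M')
    (h : ∀ X, Function.Bijective (Hom.app φ X)) : M ≅ M' :=
  let e := fun X => RingEquiv.ofBijective (Hom.app φ X) (h X)
  { hom := φ
    inv :=
      { app := fun X => (e X).symm
        app_res := fun f y => (h _).1 (by
          refine ((e _).apply_symm_apply _).trans (((Hom.app_res φ f _).trans ?_).symm)
          exact congrArg (M'.res f) ((e _).apply_symm_apply y))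
        app_tr := fun f x => (h _).1 (by
          refine ((e _).apply_symm_apply _).trans (((Hom.app_tr φ f _).trans ?_).symm)
          exact congrArg (M'.tr f) ((e _).apply_symm_apply x))
        app_norm := fun f hf x => (h _).1 (by
          refine ((e _).apply_symm_apply _).trans (((Hom.app_norm φ f hf _).trans ?_).symm)
          exact congrArg (M'.norm f hf) ((e _).apply_symm_apply x)) }
    hom_inv_id := Hom.ext (funext fun X => RingHom.ext fun x => (e X).symm_apply_apply x)
    inv_hom_id := Hom.ext (funext fun X => RingHom.ext fun x => (e X).apply_symm_apply x) }

end NormedGreenFunctor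

/-! ### Essential surjectivity and the equivalence -/

instance {G : Type u} [Group G] [Finite G] (O : IndexingSystem G) :
    (TambaraFunctor.toNormedGreenFunctor.{u, w} O).EssSurj where
  mem_essImage M := ⟨NormedGreenFunctor.toTambara M, ⟨(NormedGreenFunctor.isoOfBijective
    (M' := TambaraFunctor.toNormedGreen (NormedGreenFunctor.toTambara M))
    (NormedGreenFunctor.homToTambara M) fun _ => Function.bijective_id).symm⟩⟩

instance {G : Type u} [Group G] [Finite G] (O : IndexingSystem G) :
    (TambaraFunctor.toNormedGreenFunctor.{u, w} O).IsEquivalence where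

theorem mainTheorem3 {G : Type u} [Group G] [Finite G] (O : IndexingSystem G) :
    ∃ (E : TambaraFunctor.{u, w} O ≌ NormedGreenFunctor.{u, w} O)
      (c : ∀ F : TambaraFunctor.{u, w} O, Underlying F (E.functor.obj F)),
      ∀ (F F' : TambaraFunctor.{u, w} O) (φ : F ⟶ F') (X : FinGSet G)
        (x : (E.functor.obj F).obj X),
        (c F').equiv X ((E.functor.map φ).app X x) = φ.hom.app ⟨X⟩ ((c F).equiv X x) := by
  exact ⟨(TambaraFunctor.toNormedGreenFunctor.{u, w} O).asEquivalence,
    TambaraFunctor.underlying, fun _ _ _ _ _ => rfl⟩
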